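/- Let $\mathrm{KT}^4=S^1\times(H_3(\mathbb Z)\backslash H_3(\mathbb R))$ be the Kodaira–Thurston manifold, that is, the quotient of $\mathbb R^4$ with coordinates $(t,x,y,z)$ by the identifications $(t,x,y,z)\sim(t+t_0,\,x+x_0,\,y+y_0,\,z+z_0+x_0y)$ for $t_0,x_0,y_0,z_0\in\mathbb Z$. For real $a$ and $b\neq 0$ let $J_{a,b}$ be the almost complex structure on $\mathrm{KT}^4$ given in the frame $\partial_t,\ \partial_x,\ \partial_y+x\,\partial_z,\ \partial_z$ by the matrix $$\begin{pmatrix}0&-1&0&0\\1&0&0&0\\0&0&a&b\\0&0&-\frac{a^2+1}{b}&-a\end{pmatrix},$$ and let $\phi_1=dt+i\,dx$, $\phi_2=(1-ai)\,dy-ib\,(dz-x\,dy)$, which span the $(1,0)$-forms. For $\rho\in\mathbb R$ let $h_\rho$ be the Hermitian metric on $(\mathrm{KT}^4,J_{a,b})$ for which $\phi_1-\rho\phi_2,\ \phi_2$ is a unitary basis of the $(1,0)$-forms. For an almost complex structure $J$ on $\mathrm{KT}^4$ and a Hermitian metric $h$ on $(\mathrm{KT}^4,J)$ let $\bar\partial$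 and $\partial$ be the components of $d$ of bidegree $(0,1)$ and $(1,0)$, let $\bar\partial^*=-{*}\,\partial\,{*}$ with $*$ the Hodge star of $h$, and let $h^{0,1}(J,h)$ be the complex dimension of the kernel of $\bar\partial\bar\partial^*+\bar\partial^*\bar\partial$ on the smooth $(0,1)$-forms. (1) Let $K\geq 1$ be an odd integer, $a\in\mathbb Q$, $b=\frac{8\pi\cdot 5^{(K-1)/2}}{3}$, and $\rho=r\pi$ with $r\in\mathbb Q$, $r\neq 0$. Then $h^{0,1}(J_{a,b},h_0)=K$ and $h^{0,1}(J_{a,b},h_\rho)=1$. (2) Consequently there are an almost complex structure $J$ on $\mathrm{KT}^4$ and two Hermitian metrics $h,h'$ on $(\mathrm{KT}^4,J)$ such that $h^{0,1}(J,h)$ and $h^{0,1}(J,h')$ are finite and different. -/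

import Mathlib

noncomputable section

open scoped ContDiff

namespace KT

/-! ### The Kodaira–Thurston manifold

`KT⁴ = S¹ × (H₃(ℤ) \ H₃(ℝ))` is the quotient of `ℝ⁴`, with coordinates
`(t, x, y, z) = (p 0, p 1, p 2, p 3)`, by the free and properly discontinuous action of the
discrete group `ℤ × H₃(ℤ)`. The point `p` stands for the pair of `t` and the Heisenberg matrix
`heis x y z`, and the group acts by translation of `t` and by left multiplication.
The smooth tensor fields on the closed manifold `KT⁴` are exactly the smooth tensor fields on its
universal covering `ℝ⁴` that are invariant under this group (a field on `KT⁴` corresponds to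
its pull-back), and they are treated as such below. -/

/-- The universal covering space `ℝ⁴` of `KT⁴`; also each of its tangent spaces. -/
abbrev R4 : Type := Fin 4 → ℝ

/-- The elements of the Heisenberg group. -/
def heis (x y z : ℝ) : Matrix (Fin 3) (Fin 3) ℝ := !![1, x, z; 0, 1, y; 0, 0, 1]

/-- The action of `γ = (t₀, x₀, y₀, z₀) ∈ ℤ × H₃(ℤ)`:
`(t, x, y, z) ↦ (t + t₀, x + x₀, y + y₀, z + z₀ + x₀ y)`. -/
def deck (γ : Fin 4 → ℤ) (p : R4) : R4 :=
  ![p 0 + γ 0, p 1 + γ 1, p 2 + γ 2, p 3 + γ 3 + γ 1 * p 2]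

/-- On the Heisenberg factor, `deck γ` is left multiplication by an integral matrix. -/
theorem heis_deck (γ : Fin 4 → ℤ) (p : R4) :
    heis (deck γ p 1) (deck γ p 2) (deck γ p 3) =
      heis (γ 1) (γ 2) (γ 3) * heis (p 1) (p 2) (p 3) := by
  ext i j
  fin_cases i <;> fin_cases j <;>
    simp [heis, deck, Matrix.mul_apply, Fin.sum_univ_three]
  ring

/-- The linear part of `deck γ`. -/
def deckLin (γ : Fin 4 → ℤ) : R4 →L[ℝ] R4 :=
  LinearMap.toContinuousLinearMap (Matrix.toLin'
    !![1, 0, 0, 0; 0, 1, 0, 0; 0, 0, 1, 0; 0, 0, (γ 1 : ℝ), 1])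

theorem deck_eq (γ : Fin 4 → ℤ) (p : R4) :
    deck γ p = deckLin γ p + fun i => (γ i : ℝ) := by
  ext i
  fin_cases i <;>
    simp [deck, deckLin, dotProduct, Fin.sum_univ_four]
  ring

theorem fderiv_deck (γ : Fin 4 → ℤ) (p : R4) : fderiv ℝ (deck γ) p = deckLin γ := by
  have h : deck γ = fun q => deckLin γ q + fun i => (γ i : ℝ) := funext (deck_eq γ)
  rw [h]
  simp

/-! ### Complex differential forms on `KT⁴` -/

/-- Complex valued alternating `k`-forms on a tangent space. -/
abbrev Alt (k : ℕ) : Type := R4 [⋀^Fin k]→L[ℝ] ℂ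

/-- The space `Ω^k(KT⁴, ℂ)` of smooth complex `k`-forms on `KT⁴`. -/
def formSpace (k : ℕ) : Submodule ℂ (R4 → Alt k) where
  carrier := {α | ContDiff ℝ ∞ α ∧
    ∀ γ p, (α (deck γ p)).compContinuousLinearMap (fderiv ℝ (deck γ) p) = α p}
  add_mem' := by
    rintro α β ⟨h1, h2⟩ ⟨h3, h4⟩
    refine ⟨h1.add h3, fun γ p => ?_⟩
    rw [Pi.add_apply, Pi.add_apply, ← h2 γ p, ← h4 γ p]
    rfl
  zero_mem' := ⟨contDiff_const, fun _ _ => rfl⟩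
  smul_mem' := by
    rintro c α ⟨h1, h2⟩
    refine ⟨contDiff_const.smul h1, fun γ p => ?_⟩
    rw [Pi.smul_apply, Pi.smul_apply, ← h2 γ p]
    rfl

/-! ### Almost complex structures and Hermitian metrics on `KT⁴` -/

/-- A smooth almost complex structure on `KT⁴`. -/
structure AlmostComplex where
  J : R4 → R4 →L[ℝ] R4
  smooth : ContDiff ℝ ∞ J
  sq : ∀ p v, J p (J p v) = -v
  invariant : ∀ γ p v, J (deck γ p) (fderiv ℝ (deck γ) p v) = fderiv ℝ (deck γ) p (J p v)

/-- A smooth Hermitian metric on `(KT⁴, J)`, given by its real part, a `J`-invariant Riemannian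
metric. -/
structure Hermitian (𝒥 : AlmostComplex) where
  g : R4 → R4 →L[ℝ] R4 →L[ℝ] ℝ
  smooth : ContDiff ℝ ∞ g
  symm : ∀ p u v, g p u v = g p v u
  pos : ∀ p v, v ≠ 0 → 0 < g p v v
  compatible : ∀ p u v, g p (𝒥.J p u) (𝒥.J p v) = g p u v
  invariant : ∀ γ p u v,
    g (deck γ p) (fderiv ℝ (deck γ) p u) (fderiv ℝ (deck γ) p v) = g p u v

/-! ### The decomposition into types -/

/-- The real linear maps occurring in the `j`-th argument when `v ↦ v^{1,0} = (v - i J v) / 2`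
is applied in the arguments `j ∈ S` and `v ↦ v^{0,1} = (v + i J v) / 2` in the others:
`j ∈ T` selects the imaginary part and `j ∉ T` the real part. -/
def slot (J : R4 →L[ℝ] R4) {k : ℕ} (S T : Finset (Fin k)) (j : Fin k) : R4 →L[ℝ] R4 :=
  (1 / 2 : ℝ) • (if j ∈ T then (if j ∈ S then -J else J) else ContinuousLinearMap.id ℝ R4)

/-- The `(p, k - p)`-component of a `k`-form: the sum over all `S` with `p` elements of the value of
the complex multilinear extension of `α` at the vectors `v_j^{1,0}`, `j ∈ S`, and
`v_j^{0,1}`, `j ∉ S`. The sum over `T` expands this value in real and imaginary parts. -/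
def typeProj (J : R4 →L[ℝ] R4) {k : ℕ} (p : ℕ) (α : Alt k) : Alt k where
  toContinuousMultilinearMap :=
    ∑ S ∈ Finset.powersetCard p Finset.univ, ∑ T : Finset (Fin k),
      Complex.I ^ T.card •
        α.toContinuousMultilinearMap.compContinuousLinearMap (slot J S T)
  map_eq_zero_of_eq' := by
    intro v i j hv hij
    have key : ∀ S T : Finset (Fin k),
        α (fun l => slot J S T l (v l)) +
          α (fun l => slot J (S.map (Equiv.swap i j).toEmbedding)
            (T.map (Equiv.swap i j).toEmbedding) l (v l)) = 0 := by
      intro S T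
      have h := α.toAlternatingMap.map_swap (fun l => slot J S T l (v l)) hij
      have h2 : (fun l => slot J (S.map (Equiv.swap i j).toEmbedding)
            (T.map (Equiv.swap i j).toEmbedding) l (v l)) =
          (fun l => slot J S T l (v l)) ∘ (Equiv.swap i j) := by
        funext l
        have hvl : v (Equiv.swap i j l) = v l := by
          rcases eq_or_ne l i with rfl | h1
          · simp [hv]
          · rcases eq_or_ne l j with rfl | h2
            · simp [hv]
            · rw [Equiv.swap_apply_of_ne_of_ne h1 h2]
        simp only [Function.comp_apply, slot, Finset.mem_map_equiv, Equiv.symm_swap, hvl]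
      rw [h2]
      change α ((fun l => slot J S T l (v l)) ∘ (Equiv.swap i j)) =
        -α (fun l => slot J S T l (v l)) at h
      rw [h, add_neg_cancel]
    have key2 : ∀ S T : Finset (Fin k),
        Complex.I ^ T.card * α (fun l => slot J S T l (v l)) +
          Complex.I ^ (T.map (Equiv.swap i j).toEmbedding).card *
          α (fun l => slot J (S.map (Equiv.swap i j).toEmbedding)
            (T.map (Equiv.swap i j).toEmbedding) l (v l)) = 0 := by
      intro S T
      rw [Finset.card_map, ← mul_add, key, mul_zero]
    have hfin : ∑ S ∈ Finset.powersetCard p (Finset.univ : Finset (Fin k)),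
        ∑ T : Finset (Fin k),
          Complex.I ^ T.card * α (fun l => slot J S T l (v l)) = 0 := by
      rw [← Finset.sum_product']
      refine Finset.sum_involution
        (fun x _ => (x.1.map (Equiv.swap i j).toEmbedding,
          x.2.map (Equiv.swap i j).toEmbedding)) ?_ ?_ ?_ ?_
      · intro x _
        exact key2 x.1 x.2
      · intro x _ hne heq
        apply hne
        have h := key2 x.1 x.2
        have e1 : x.1.map (Equiv.swap i j).toEmbedding = x.1 := congrArg Prod.fst heq
        have e2 : x.2.map (Equiv.swap i j).toEmbedding = x.2 := congrArg Prod.snd heq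
        rw [e1, e2] at h
        exact self_eq_neg.mp (eq_neg_of_add_eq_zero_left h)
      · intro x hx
        simpa [Finset.mem_powersetCard] using hx
      · intro x _
        ext l <;> simp [Finset.mem_map_equiv]
    simpa using hfin

theorem typeProj_apply (J : R4 →L[ℝ] R4) {k : ℕ} (p : ℕ) (α : Alt k) (v : Fin k → R4) :
    typeProj J p α v = ∑ S ∈ Finset.powersetCard p Finset.univ, ∑ T : Finset (Fin k),
      Complex.I ^ T.card * α (fun l => slot J S T l (v l)) := by
  change (∑ S ∈ Finset.powersetCard p Finset.univ, ∑ T : Finset (Fin k),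
      Complex.I ^ T.card •
        α.toContinuousMultilinearMap.compContinuousLinearMap (slot J S T)) v = _
  simp

/-- `∂̄` on forms of type `(p, q)`: the `(p, q + 1)`-component of the exterior derivative. -/
def dbar (𝒥 : AlmostComplex) {k : ℕ} (p : ℕ) (α : R4 → Alt k) : R4 → Alt (k + 1) :=
  fun x => typeProj (𝒥.J x) p (extDeriv α x)

/-- `∂` on forms of type `(p, q)`: the `(p + 1, q)`-component of the exterior derivative. -/
def del (𝒥 : AlmostComplex) {k : ℕ} (p : ℕ) (α : R4 → Alt k) : R4 → Alt (k + 1) :=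
  fun x => typeProj (𝒥.J x) (p + 1) (extDeriv α x)

/-! ### The Hodge star -/

/-- The coordinate vector `∂ᵢ`. -/
def e (i : Fin 4) : R4 := Pi.single i 1

/-- The form `dt ∧ dx ∧ dy ∧ dz`. -/
def det4 : Alt 4 :=
  Complex.ofRealCLM.compContinuousAlternatingMap
    { (Pi.basisFun ℝ (Fin 4)).det with
      cont := by
        change Continuous fun v : Fin 4 → R4 => (Pi.basisFun ℝ (Fin 4)).det v
        simp only [Pi.basisFun_det_apply]
        exact Continuous.matrix_det continuous_id }

/-- `contract k w η = η(w₀, …, w_{k-1}, ·, …, ·)`. -/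
def contract {m : ℕ} : (k : ℕ) → (Fin k → R4) → Alt (m + k) → Alt m
  | 0, _, η => η
  | k + 1, w, η => contract k (fun l => w l.succ) (η.curryLeft (w 0))

/-- The Gram matrix of a metric in the coordinates. -/
def gram (g : R4 →L[ℝ] R4 →L[ℝ] ℝ) : Matrix (Fin 4) (Fin 4) ℝ := Matrix.of fun i j => g (e i) (e j)

/-- The complex linear Hodge star from `k`-forms to `m`-forms, `m + k = 4`, in coordinates:
`(⋆α)(v₁, …, v_m) = (√(det g) / k!) ∑ g^{i₁ j₁} ⋯ g^{i_k j_k} α(∂_{i₁}, …, ∂_{i_k})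
  det(∂_{j₁}, …, ∂_{j_k}, v₁, …, v_m)`.
It is taken with respect to the orientation `dt ∧ dx ∧ dy ∧ dz`; the other orientation changes the
sign of `⋆` and leaves `⋆ ∂ ⋆` as it is. -/
def hodgeStar (g : R4 →L[ℝ] R4 →L[ℝ] ℝ) (k m : ℕ) (h : 4 = m + k) (α : Alt k) : Alt m :=
  ((Real.sqrt (gram g).det / (k.factorial : ℝ) : ℝ) : ℂ) •
    ∑ i : Fin k → Fin 4, ∑ j : Fin k → Fin 4,
      (((∏ l, (gram g)⁻¹ (i l) (j l) : ℝ) : ℂ) * α (fun l => e (i l))) •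
        contract k (fun l => e (j l)) (h ▸ det4)

/-- `∂̄* = -⋆ ∂ ⋆` from forms of type `(p, q)` and degree `k + 1` to forms of degree `k`.
Since `⋆` sends type `(p, q)` to type `(2 - q, 2 - p)`, the operator `∂` is the one on forms of
type `(2 - q, 2 - p)`. -/
def dbarStar {𝒥 : AlmostComplex} (h : Hermitian 𝒥) (k m : ℕ) (hk : 4 = m + (k + 1))
    (q : ℕ) (α : R4 → Alt (k + 1)) : R4 → Alt k :=
  fun x => -hodgeStar (h.g x) (m + 1) k (by omega)
    (del 𝒥 (2 - q) (fun y => hodgeStar (h.g y) (k + 1) m hk (α y)) x)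

/-- The Laplacian `∂̄ ∂̄* + ∂̄* ∂̄` on forms of type `(0, 1)`. -/
def laplacian {𝒥 : AlmostComplex} (h : Hermitian 𝒥) (s : R4 → Alt 1) : R4 → Alt 1 :=
  fun x => dbar 𝒥 0 (dbarStar h 0 3 rfl 1 s) x + dbarStar h 1 2 rfl 2 (dbar 𝒥 0 s) x

/-! Smoothness and linearity of these operators, so that the harmonic forms are a subspace. -/

theorem apply_eq_sum {k : ℕ} (α : Alt k) (v : Fin k → R4) :
    α v = ∑ i : Fin k → Fin 4, (((∏ l, v l (i l) : ℝ)) : ℂ) * α (fun l => e (i l)) := by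
  have h : v = fun l => ∑ i : Fin 4, v l i • e i := by
    funext l
    exact (pi_eq_sum_univ' (v l))
  conv_lhs => rw [h]
  have h2 := α.toMultilinearMap.map_sum (fun l (i : Fin 4) => v l i • e i)
  refine h2.trans (Finset.sum_congr rfl fun i _ => ?_)
  have h3 := α.toMultilinearMap.map_smul_univ (fun l => v l (i l)) (fun l => e (i l))
  refine h3.trans ?_
  rw [Complex.real_smul]
  rfl

theorem contDiff_alt {k : ℕ} {F : R4 → Alt k}
    (h : ∀ i : Fin k → Fin 4, ContDiff ℝ ∞ fun x => F x (fun l => e (i l))) :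
    ContDiff ℝ ∞ F := by
  let L : Alt k →ₗ[ℝ] ((Fin k → Fin 4) → ℂ) :=
    { toFun := fun α i => α (fun l => e (i l))
      map_add' := fun _ _ => rfl
      map_smul' := fun _ _ => rfl }
  have hL : LinearMap.ker L = ⊥ := by
    rw [LinearMap.ker_eq_bot']
    intro α hα
    ext v
    rw [apply_eq_sum]
    refine Finset.sum_eq_zero fun i _ => ?_
    have := congrFun hα i
    change α (fun l => e (i l)) = 0 at this
    rw [this, mul_zero]
  obtain ⟨R, hR⟩ := L.exists_leftInverse_of_injective hL
  have hF : F = fun x => LinearMap.toContinuousLinearMap R (L (F x)) := by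
    funext x
    exact (LinearMap.congr_fun hR (F x)).symm
  rw [hF]
  exact (LinearMap.toContinuousLinearMap R).contDiff.comp (contDiff_pi.2 h)

theorem contDiff_apply_const {k : ℕ} {F : R4 → Alt k} (hF : ContDiff ℝ ∞ F) (v : Fin k → R4) :
    ContDiff ℝ ∞ fun x => F x v :=
  (ContinuousAlternatingMap.apply ℝ R4 ℂ v).contDiff.comp hF

theorem contDiff_apply {k : ℕ} {F : R4 → Alt k} (hF : ContDiff ℝ ∞ F) {w : R4 → Fin k → R4}
    (hw : ∀ l, ContDiff ℝ ∞ fun x => w x l) : ContDiff ℝ ∞ fun x => F x (w x) := by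
  simp only [apply_eq_sum (F _) (w _)]
  refine ContDiff.sum fun i _ => ContDiff.mul ?_ (contDiff_apply_const hF _)
  have hp : ContDiff ℝ ∞ fun x => ∏ l, w x l (i l) :=
    contDiff_prod fun l _ => contDiff_pi.1 (hw l) (i l)
  exact Complex.ofRealCLM.contDiff.comp hp

theorem contDiff_typeProj {J : R4 → R4 →L[ℝ] R4} (hJ : ContDiff ℝ ∞ J) {k : ℕ} (p : ℕ)
    {F : R4 → Alt k} (hF : ContDiff ℝ ∞ F) : ContDiff ℝ ∞ fun x => typeProj (J x) p (F x) := by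
  refine contDiff_alt fun i => ?_
  simp only [typeProj_apply]
  refine ContDiff.sum fun S _ => ContDiff.sum fun T _ => contDiff_const.mul ?_
  refine contDiff_apply hF fun l => ?_
  have : ContDiff ℝ ∞ fun x => slot (J x) S T l := by
    unfold slot
    split_ifs
    · exact hJ.neg.const_smul (1 / 2 : ℝ)
    · exact hJ.const_smul (1 / 2 : ℝ)
    · exact contDiff_const
  exact this.clm_apply contDiff_const

theorem contDiff_extDeriv {k : ℕ} {F : R4 → Alt k} (hF : ContDiff ℝ ∞ F) :
    ContDiff ℝ ∞ (extDeriv F) := by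
  have h : ContDiff ℝ ∞ (fderiv ℝ F) := hF.fderiv_right (m := ∞) (by simp)
  exact (ContinuousAlternatingMap.alternatizeUncurryFinCLM (n := k) ℝ R4 ℂ).contDiff.comp h

theorem typeProj_add (J : R4 →L[ℝ] R4) {k : ℕ} (p : ℕ) (α β : Alt k) :
    typeProj J p (α + β) = typeProj J p α + typeProj J p β := by
  ext v
  simp only [typeProj_apply, ContinuousAlternatingMap.add_apply, mul_add, Finset.sum_add_distrib]

theorem typeProj_smul (J : R4 →L[ℝ] R4) {k : ℕ} (p : ℕ) (c : ℂ) (α : Alt k) :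
    typeProj J p (c • α) = c • typeProj J p α := by
  ext v
  simp only [typeProj_apply, ContinuousAlternatingMap.smul_apply, smul_eq_mul, Finset.mul_sum]
  refine Finset.sum_congr rfl fun S _ => Finset.sum_congr rfl fun T _ => by ring

theorem extDeriv_csmul {k : ℕ} (c : ℂ) {F : R4 → Alt k} (hF : ContDiff ℝ ∞ F) (x : R4) :
    extDeriv (fun y => c • F y) x = c • extDeriv F x := by
  have hd : DifferentiableAt ℝ F x := (hF.differentiable (by simp)) x
  have hd2 : DifferentiableAt ℝ (fun y => c • F y) x := hd.const_smul c
  ext v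
  rw [extDeriv_apply hd2, ContinuousAlternatingMap.smul_apply, extDeriv_apply hd,
    Finset.smul_sum]
  refine Finset.sum_congr rfl fun i _ => ?_
  have hd3 : DifferentiableAt ℝ (fun y => F y (i.removeNth v)) x :=
    (contDiff_apply_const hF _).differentiable (by simp) x
  have h1 : fderiv ℝ (fun y => (c • F y) (i.removeNth v)) x =
      c • fderiv ℝ (fun y => F y (i.removeNth v)) x := fderiv_fun_const_smul hd3 c
  rw [h1, smul_comm c]
  rfl

theorem gram_det_pos {𝒥 : AlmostComplex} (h : Hermitian 𝒥) (x : R4) : 0 < (gram (h.g x)).det := by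
  apply Matrix.PosDef.det_pos
  refine Matrix.PosDef.of_dotProduct_mulVec_pos ?_ ?_
  · ext i j
    simp [gram, Matrix.conjTranspose_apply, h.symm x (e j)]
  · intro v hv
    have hv2 : v = ∑ i, v i • e i := pi_eq_sum_univ' v
    have := h.pos x v hv
    rw [hv2] at this
    simp only [map_sum, map_smul, _root_.sum_apply, _root_.smul_apply,
      smul_eq_mul] at this
    simp only [dotProduct, Matrix.mulVec, gram, Matrix.of_apply, star_trivial, Finset.mul_sum]
    refine this.trans_eq ?_
    simp only [Finset.mul_sum]
    refine Finset.sum_congr rfl fun i _ => Finset.sum_congr rfl fun j _ => ?_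
    rw [h.symm x (e j)]
    ring

theorem contDiff_gram {𝒥 : AlmostComplex} (h : Hermitian 𝒥) (i j : Fin 4) :
    ContDiff ℝ ∞ fun x => gram (h.g x) i j :=
  (h.smooth.clm_apply contDiff_const).clm_apply contDiff_const

theorem contDiff_det {n : ℕ} {A : R4 → Matrix (Fin n) (Fin n) ℝ}
    (hA : ∀ i j, ContDiff ℝ ∞ fun x => A x i j) : ContDiff ℝ ∞ fun x => (A x).det := by
  simp only [Matrix.det_apply']
  exact ContDiff.sum fun σ _ => contDiff_const.mul (contDiff_prod fun i _ => hA _ _)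

theorem contDiff_gram_inv {𝒥 : AlmostComplex} (h : Hermitian 𝒥) (i j : Fin 4) :
    ContDiff ℝ ∞ fun x => (gram (h.g x))⁻¹ i j := by
  simp only [Matrix.inv_def, Ring.inverse_eq_inv', Matrix.smul_apply, smul_eq_mul]
  refine ContDiff.mul ((contDiff_det (contDiff_gram h)).inv fun x => (gram_det_pos h x).ne') ?_
  simp only [Matrix.adjugate_apply]
  refine contDiff_det fun a b => ?_
  simp only [Matrix.updateRow_apply]
  split_ifs
  · exact contDiff_const
  · exact contDiff_gram h a b

theorem hodgeStar_apply (g : R4 →L[ℝ] R4 →L[ℝ] ℝ) (k m : ℕ) (h : 4 = m + k) (α : Alt k)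
    (v : Fin m → R4) :
    hodgeStar g k m h α v = ((Real.sqrt (gram g).det / (k.factorial : ℝ) : ℝ) : ℂ) *
      ∑ i : Fin k → Fin 4, ∑ j : Fin k → Fin 4,
        (((∏ l, (gram g)⁻¹ (i l) (j l) : ℝ) : ℂ) * α (fun l => e (i l))) *
          contract k (fun l => e (j l)) (h ▸ det4 : Alt (m + k)) v := by
  rw [hodgeStar, ContinuousAlternatingMap.smul_apply, smul_eq_mul]
  simp only [ContinuousAlternatingMap.sum_apply]
  rfl

theorem contDiff_hodgeStar {𝒥 : AlmostComplex} (h : Hermitian 𝒥) (k m : ℕ) (hkm : 4 = m + k)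
    {F : R4 → Alt k} (hF : ContDiff ℝ ∞ F) :
    ContDiff ℝ ∞ fun x => hodgeStar (h.g x) k m hkm (F x) := by
  refine contDiff_alt fun n => ?_
  simp only [hodgeStar_apply]
  refine ContDiff.mul ?_ (ContDiff.sum fun i _ => ContDiff.sum fun j _ => ContDiff.mul
    (ContDiff.mul ?_ (contDiff_apply_const hF _)) contDiff_const)
  · have hp : ContDiff ℝ ∞ fun x => Real.sqrt (gram (h.g x)).det / (k.factorial : ℝ) :=
      ((contDiff_det (contDiff_gram h)).sqrt fun x => (gram_det_pos h x).ne').div_const _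
    exact Complex.ofRealCLM.contDiff.comp hp
  · have hp : ContDiff ℝ ∞ fun x => ∏ l, (gram (h.g x))⁻¹ (i l) (j l) :=
      contDiff_prod fun l _ => contDiff_gram_inv h _ _
    exact Complex.ofRealCLM.contDiff.comp hp

theorem hodgeStar_add (g : R4 →L[ℝ] R4 →L[ℝ] ℝ) (k m : ℕ) (h : 4 = m + k) (α β : Alt k) :
    hodgeStar g k m h (α + β) = hodgeStar g k m h α + hodgeStar g k m h β := by
  ext v
  simp only [hodgeStar_apply, ContinuousAlternatingMap.add_apply, mul_add, add_mul,
    Finset.sum_add_distrib]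

theorem hodgeStar_smul (g : R4 →L[ℝ] R4 →L[ℝ] ℝ) (k m : ℕ) (h : 4 = m + k) (c : ℂ) (α : Alt k) :
    hodgeStar g k m h (c • α) = c • hodgeStar g k m h α := by
  ext v
  simp only [hodgeStar_apply, ContinuousAlternatingMap.smul_apply, smul_eq_mul, Finset.mul_sum]
  refine Finset.sum_congr rfl fun i _ => Finset.sum_congr rfl fun j _ => by ring

theorem contDiff_dbar (𝒥 : AlmostComplex) {k : ℕ} (p : ℕ) {F : R4 → Alt k}
    (hF : ContDiff ℝ ∞ F) : ContDiff ℝ ∞ (dbar 𝒥 p F) :=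
  contDiff_typeProj 𝒥.smooth p (contDiff_extDeriv hF)

theorem dbar_add (𝒥 : AlmostComplex) {k : ℕ} (p : ℕ) {F G : R4 → Alt k}
    (hF : ContDiff ℝ ∞ F) (hG : ContDiff ℝ ∞ G) :
    dbar 𝒥 p (F + G) = dbar 𝒥 p F + dbar 𝒥 p G := by
  funext x
  simp only [dbar, Pi.add_apply]
  rw [extDeriv_add (hF.differentiable (by simp) x) (hG.differentiable (by simp) x), typeProj_add]

theorem dbar_smul (𝒥 : AlmostComplex) {k : ℕ} (p : ℕ) (c : ℂ) {F : R4 → Alt k}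
    (hF : ContDiff ℝ ∞ F) : dbar 𝒥 p (c • F) = c • dbar 𝒥 p F := by
  funext x
  simp only [dbar, Pi.smul_apply]
  rw [← typeProj_smul, ← extDeriv_csmul c hF]
  rfl

theorem contDiff_dbarStar {𝒥 : AlmostComplex} (h : Hermitian 𝒥) (k m : ℕ) (hk : 4 = m + (k + 1))
    (q : ℕ) {F : R4 → Alt (k + 1)} (hF : ContDiff ℝ ∞ F) :
    ContDiff ℝ ∞ (dbarStar h k m hk q F) :=
  (contDiff_hodgeStar h (m + 1) k (by omega) (contDiff_dbar 𝒥 (2 - q + 1)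
    (contDiff_hodgeStar h (k + 1) m hk hF))).neg

theorem dbarStar_add {𝒥 : AlmostComplex} (h : Hermitian 𝒥) (k m : ℕ) (hk : 4 = m + (k + 1))
    (q : ℕ) {F G : R4 → Alt (k + 1)} (hF : ContDiff ℝ ∞ F) (hG : ContDiff ℝ ∞ G) :
    dbarStar h k m hk q (F + G) = dbarStar h k m hk q F + dbarStar h k m hk q G := by
  funext x
  have h1 := congrFun (dbar_add 𝒥 (2 - q + 1) (contDiff_hodgeStar h (k + 1) m hk hF)
    (contDiff_hodgeStar h (k + 1) m hk hG)) x
  simp only [dbarStar, Pi.add_apply, hodgeStar_add]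
  rw [← neg_add, ← hodgeStar_add]
  exact congrArg (fun α => -hodgeStar (h.g x) (m + 1) k (by omega) α) h1

theorem dbarStar_smul {𝒥 : AlmostComplex} (h : Hermitian 𝒥) (k m : ℕ) (hk : 4 = m + (k + 1))
    (q : ℕ) (c : ℂ) {F : R4 → Alt (k + 1)} (hF : ContDiff ℝ ∞ F) :
    dbarStar h k m hk q (c • F) = c • dbarStar h k m hk q F := by
  funext x
  have h1 := congrFun (dbar_smul 𝒥 (2 - q + 1) c (contDiff_hodgeStar h (k + 1) m hk hF)) x
  simp only [dbarStar, Pi.smul_apply, hodgeStar_smul]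
  rw [smul_neg, ← hodgeStar_smul]
  exact congrArg (fun α => -hodgeStar (h.g x) (m + 1) k (by omega) α) h1

/-- The space `ℋ^{0,1}`: the kernel of the `∂̄`-Laplacian in the space of smooth `(0, 1)`-forms. -/
def harmonic {𝒥 : AlmostComplex} (h : Hermitian 𝒥) : Submodule ℂ (R4 → Alt 1) where
  carrier := {s | s ∈ formSpace 1 ∧ (∀ x, typeProj (𝒥.J x) 0 (s x) = s x) ∧ laplacian h s = 0}
  add_mem' := by
    rintro s s' ⟨h1, h2, h3⟩ ⟨h4, h5, h6⟩
    refine ⟨(formSpace 1).add_mem h1 h4, fun x => ?_, ?_⟩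
    · rw [Pi.add_apply, typeProj_add, h2, h5]
    · rw [← add_zero (0 : R4 → Alt 1)]
      nth_rw 1 [← h3]
      rw [← h6]
      funext x
      simp only [laplacian, Pi.add_apply]
      rw [dbarStar_add h 0 3 rfl 1 h1.1 h4.1, dbar_add 𝒥 0 h1.1 h4.1,
        dbarStar_add h 1 2 rfl 2 (contDiff_dbar 𝒥 0 h1.1) (contDiff_dbar 𝒥 0 h4.1),
        dbar_add 𝒥 0 (contDiff_dbarStar h 0 3 rfl 1 h1.1) (contDiff_dbarStar h 0 3 rfl 1 h4.1)]
      simp only [Pi.add_apply]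
      abel
  zero_mem' := by
    have hz : ∀ x, typeProj (𝒥.J x) 0 ((0 : R4 → Alt 1) x) = (0 : R4 → Alt 1) x := fun x => by
      ext v
      rw [typeProj_apply]
      simp
    refine ⟨(formSpace 1).zero_mem, hz, ?_⟩
    have hs : ContDiff ℝ ∞ (0 : R4 → Alt 1) := contDiff_const
    have z : ∀ {k : ℕ} (F : R4 → Alt k), (0 : ℂ) • F = 0 := fun F =>
      funext fun x => zero_smul ℂ (F x)
    have e1 := dbarStar_smul h 0 3 rfl 1 0 hs
    have e2 := dbar_smul 𝒥 0 0 hs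
    have e3 := dbar_smul 𝒥 0 0 (contDiff_dbarStar h 0 3 rfl 1 hs)
    have e4 := dbarStar_smul h 1 2 rfl 2 0 (contDiff_dbar 𝒥 0 hs)
    rw [z, z] at e1 e2 e3 e4
    funext x
    simp only [laplacian]
    rw [e1, e2, e3, e4]
    exact add_zero 0
  smul_mem' := by
    rintro c s ⟨h1, h2, h3⟩
    refine ⟨(formSpace 1).smul_mem c h1, fun x => ?_, ?_⟩
    · rw [Pi.smul_apply, typeProj_smul, h2]
    · rw [← smul_zero c, ← h3]
      funext x
      simp only [laplacian, Pi.smul_apply]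
      rw [dbarStar_smul h 0 3 rfl 1 c h1.1, dbar_smul 𝒥 0 c h1.1,
        dbarStar_smul h 1 2 rfl 2 c (contDiff_dbar 𝒥 0 h1.1),
        dbar_smul 𝒥 0 c (contDiff_dbarStar h 0 3 rfl 1 h1.1)]
      simp only [Pi.smul_apply, smul_add]

/-- The Hodge number `h^{0,1}` of an almost complex structure on `KT⁴` and a Hermitian metric. -/
def h01 {𝒥 : AlmostComplex} (h : Hermitian 𝒥) : ℕ := Module.finrank ℂ (harmonic h)

/-! ### The almost complex structures `J_{a,b}` and the metrics `h_ρ` -/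

/-- The matrix of `J_{a,b}` in the invariant frame `∂_t, ∂_x, ∂_y + x ∂_z, ∂_z`. -/
def matJ (a b : ℝ) : Matrix (Fin 4) (Fin 4) ℝ :=
  !![0, -1, 0, 0; 1, 0, 0, 0; 0, 0, a, b; 0, 0, -(a ^ 2 + 1) / b, -a]

/-- The vector with coefficients `c` in the frame `∂_t, ∂_x, ∂_y + x ∂_z, ∂_z` at `p`. -/
def frame (p : R4) : R4 →L[ℝ] R4 :=
  LinearMap.toContinuousLinearMap (Matrix.toLin'
    !![1, 0, 0, 0; 0, 1, 0, 0; 0, 0, 1, 0; 0, 0, p 1, 1])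

/-- The coefficients of a vector in the frame `∂_t, ∂_x, ∂_y + x ∂_z, ∂_z` at `p`. -/
def coframe (p : R4) : R4 →L[ℝ] R4 :=
  LinearMap.toContinuousLinearMap (Matrix.toLin'
    !![1, 0, 0, 0; 0, 1, 0, 0; 0, 0, 1, 0; 0, 0, -p 1, 1])

theorem frame_apply (p v : R4) : frame p v = ![v 0, v 1, v 2, p 1 * v 2 + v 3] := by
  ext i
  fin_cases i <;> simp [frame, dotProduct, Fin.sum_univ_four]

theorem coframe_apply (p v : R4) : coframe p v = ![v 0, v 1, v 2, -p 1 * v 2 + v 3] := by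
  ext i
  fin_cases i <;> simp [coframe, dotProduct, Fin.sum_univ_four]

theorem frame_coframe (p v : R4) : frame p (coframe p v) = v := by
  rw [frame_apply, coframe_apply]
  ext i
  fin_cases i <;> simp

theorem coframe_frame (p v : R4) : coframe p (frame p v) = v := by
  rw [frame_apply, coframe_apply]
  ext i
  fin_cases i <;> simp

theorem deckLin_apply (γ : Fin 4 → ℤ) (v : R4) :
    deckLin γ v = ![v 0, v 1, v 2, γ 1 * v 2 + v 3] := by
  ext i
  fin_cases i <;> simp [deckLin, dotProduct, Fin.sum_univ_four]

theorem coframe_deck (γ : Fin 4 → ℤ) (p v : R4) :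
    coframe (deck γ p) (fderiv ℝ (deck γ) p v) = coframe p v := by
  rw [fderiv_deck, coframe_apply, coframe_apply, deckLin_apply]
  ext i
  fin_cases i <;> simp [deck]
  ring

theorem frame_deck (γ : Fin 4 → ℤ) (p v : R4) :
    frame (deck γ p) v = fderiv ℝ (deck γ) p (frame p v) := by
  rw [← frame_coframe (deck γ p) (fderiv ℝ (deck γ) p (frame p v)), coframe_deck, coframe_frame]

theorem contDiff_frame : ContDiff ℝ ∞ frame := by
  refine contDiff_clm_apply_iff.2 fun v => contDiff_pi.2 fun i => ?_
  simp only [frame_apply]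
  fin_cases i <;> simp <;> fun_prop

theorem contDiff_coframe : ContDiff ℝ ∞ coframe := by
  refine contDiff_clm_apply_iff.2 fun v => contDiff_pi.2 fun i => ?_
  simp only [coframe_apply]
  fin_cases i <;> simp <;> fun_prop

theorem matJ_sq (a b : ℝ) (hb : b ≠ 0) : matJ a b * matJ a b = -1 := by
  ext i j
  fin_cases i <;> fin_cases j <;>
    simp [matJ, Matrix.mul_apply, Fin.sum_univ_four] <;> field_simp <;> ring

/-- The almost complex structure `J_{a,b}`, `b ≠ 0`, on `KT⁴`. -/
def Jab (a b : ℝ) (hb : b ≠ 0) : AlmostComplex where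
  J p := (frame p).comp
    ((LinearMap.toContinuousLinearMap (Matrix.toLin' (matJ a b))).comp (coframe p))
  smooth := contDiff_frame.clm_comp (contDiff_const.clm_comp contDiff_coframe)
  sq p v := by
    simp only [ContinuousLinearMap.comp_apply, coframe_frame,
      LinearMap.coe_toContinuousLinearMap', Matrix.toLin'_apply, Matrix.mulVec_mulVec,
      matJ_sq a b hb]
    rw [Matrix.neg_mulVec, Matrix.one_mulVec, map_neg, frame_coframe]
  invariant γ p v := by
    simp only [ContinuousLinearMap.comp_apply, coframe_deck, frame_deck]

/-- The form `φ₁ = dt + i dx`. -/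
def phi1 : R4 →L[ℝ] ℂ :=
  LinearMap.toContinuousLinearMap
    { toFun := fun v => (v 0 : ℂ) + Complex.I * (v 1 : ℂ)
      map_add' := fun u v => by simp; ring
      map_smul' := fun c v => by simp; ring }

/-- The form `φ₂ = (1 - a i) dy - i b (dz - x dy)` at `p`. -/
def phi2 (a b : ℝ) (p : R4) : R4 →L[ℝ] ℂ :=
  LinearMap.toContinuousLinearMap
    { toFun := fun v => (1 - a * Complex.I) * (v 2 : ℂ) -
        Complex.I * b * ((v 3 : ℂ) - (p 1 : ℂ) * (v 2 : ℂ))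
      map_add' := fun u v => by simp; ring
      map_smul' := fun c v => by simp; ring }

theorem contDiff_phi2 (a b : ℝ) : ContDiff ℝ ∞ (phi2 a b) := by
  refine contDiff_clm_apply_iff.2 fun v => ?_
  have h : ContDiff ℝ ∞ fun p : R4 => ((p 1 : ℝ) : ℂ) :=
    Complex.ofRealCLM.contDiff.comp (contDiff_pi.1 contDiff_id 1)
  change ContDiff ℝ ∞ fun p : R4 => (1 - a * Complex.I) * (v 2 : ℂ) -
        Complex.I * b * ((v 3 : ℂ) - (p 1 : ℂ) * (v 2 : ℂ))
  fun_prop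

theorem phi1_apply (v : R4) : phi1 v = (v 0 : ℂ) + Complex.I * (v 1 : ℂ) := rfl

theorem phi2_apply (a b : ℝ) (p v : R4) : phi2 a b p v = (1 - a * Complex.I) * (v 2 : ℂ) -
    Complex.I * b * ((v 3 : ℂ) - (p 1 : ℂ) * (v 2 : ℂ)) := rfl

theorem Jab_apply (a b : ℝ) (hb : b ≠ 0) (p v : R4) :
    (Jab a b hb).J p v = ![-v 1, v 0, a * v 2 + b * (v 3 - p 1 * v 2),
      p 1 * (a * v 2 + b * (v 3 - p 1 * v 2)) +
        (-(a ^ 2 + 1) / b * v 2 - a * (v 3 - p 1 * v 2))] := by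
  change frame p (Matrix.toLin' (matJ a b) (coframe p v)) = _
  rw [coframe_apply, frame_apply]
  ext i
  fin_cases i <;> simp [matJ] <;> ring

/-- `φ₁` is of type `(1, 0)`. -/
theorem phi1_J (a b : ℝ) (hb : b ≠ 0) (p v : R4) :
    phi1 ((Jab a b hb).J p v) = Complex.I * phi1 v := by
  rw [Jab_apply, phi1_apply, phi1_apply]
  simp only [Matrix.cons_val]
  push_cast
  linear_combination -(v 1 : ℂ) * Complex.I_sq

/-- `φ₂` is of type `(1, 0)`. -/
theorem phi2_J (a b : ℝ) (hb : b ≠ 0) (p v : R4) :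
    phi2 a b p ((Jab a b hb).J p v) = Complex.I * phi2 a b p v := by
  have hb' : (b : ℂ) ≠ 0 := by exact_mod_cast hb
  rw [Jab_apply, phi2_apply, phi2_apply]
  simp only [Matrix.cons_val]
  push_cast
  field_simp
  linear_combination ((a : ℂ) * v 2 + b * (v 3 - p 1 * v 2)) * Complex.I_sq

theorem phi1_deck (γ : Fin 4 → ℤ) (p v : R4) : phi1 (fderiv ℝ (deck γ) p v) = phi1 v := by
  rw [fderiv_deck, deckLin_apply]
  rfl

theorem phi2_deck (a b : ℝ) (γ : Fin 4 → ℤ) (p v : R4) :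
    phi2 a b (deck γ p) (fderiv ℝ (deck γ) p v) = phi2 a b p v := by
  rw [fderiv_deck, deckLin_apply, phi2_apply, phi2_apply]
  simp only [deck, Matrix.cons_val]
  push_cast
  ring

/-- The real bilinear form `(u, v) ↦ Re (ψ(u) conj ψ(v))`. -/
def sqNorm (ψ : R4 →L[ℝ] ℂ) : R4 →L[ℝ] R4 →L[ℝ] ℝ := (innerSL ℝ).bilinearComp ψ ψ

theorem sqNorm_apply (ψ : R4 →L[ℝ] ℂ) (u v : R4) :
    sqNorm ψ u v = (ψ u * (starRingEnd ℂ) (ψ v)).re := by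
  change inner ℝ (ψ u) (ψ v) = _
  rw [Complex.inner]
  simp
  ring

theorem contDiff_sqNorm {ψ : R4 → R4 →L[ℝ] ℂ} (hψ : ContDiff ℝ ∞ ψ) :
    ContDiff ℝ ∞ fun p => sqNorm (ψ p) := by
  refine contDiff_clm_apply_iff.2 fun u => contDiff_clm_apply_iff.2 fun v => ?_
  exact (hψ.clm_apply contDiff_const).inner ℝ (hψ.clm_apply contDiff_const)

/-- The metric `h_ρ` on `(KT⁴, J_{a,b})` for which `φ₁ - ρ φ₂, φ₂` is a unitary basis of the
`(1, 0)`-forms: `h_ρ(u, v) = Re (ψ₁(u) conj ψ₁(v) + ψ₂(u) conj ψ₂(v))` with `ψ₁ = φ₁ - ρ φ₂`,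
`ψ₂ = φ₂`. -/
def hrho (a b : ℝ) (hb : b ≠ 0) (ρ : ℝ) : Hermitian (Jab a b hb) where
  g p := sqNorm (phi1 - ρ • phi2 a b p) + sqNorm (phi2 a b p)
  smooth := (contDiff_sqNorm (contDiff_const.sub ((contDiff_phi2 a b).const_smul ρ))).add
    (contDiff_sqNorm (contDiff_phi2 a b))
  symm p u v := by
    change inner ℝ ((phi1 - ρ • phi2 a b p) u) ((phi1 - ρ • phi2 a b p) v) +
      inner ℝ (phi2 a b p u) (phi2 a b p v) =
      inner ℝ ((phi1 - ρ • phi2 a b p) v) ((phi1 - ρ • phi2 a b p) u) +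
      inner ℝ (phi2 a b p v) (phi2 a b p u)
    rw [real_inner_comm, real_inner_comm (phi2 a b p v)]
  pos p v hv := by
    change 0 < inner ℝ (phi1 v - ρ • phi2 a b p v) (phi1 v - ρ • phi2 a b p v) +
      inner ℝ (phi2 a b p v) (phi2 a b p v)
    rw [real_inner_self_eq_norm_sq, real_inner_self_eq_norm_sq]
    by_contra hneg
    have h1 := sq_nonneg ‖phi1 v - ρ • phi2 a b p v‖
    have h2 := sq_nonneg ‖phi2 a b p v‖
    have h3 : phi2 a b p v = 0 := by
      rw [← norm_eq_zero, ← sq_eq_zero_iff]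
      linarith
    have h4 : phi1 v = 0 := by
      have : ‖phi1 v - ρ • phi2 a b p v‖ = 0 := by
        rw [← sq_eq_zero_iff]
        linarith
      rw [h3, smul_zero, sub_zero, norm_eq_zero] at this
      exact this
    rw [phi1_apply] at h4
    rw [phi2_apply] at h3
    have r0 := congrArg Complex.re h4
    have r1 := congrArg Complex.im h4
    have r2 := congrArg Complex.re h3
    have r3 := congrArg Complex.im h3
    simp at r0 r1 r2 r3
    simp [r2, hb] at r3
    apply hv
    ext i
    fin_cases i <;> simp [r0, r1, r2, r3]
  compatible p u v := by
    have hI : ∀ z w : ℂ, inner ℝ (Complex.I * z) (Complex.I * w) = inner ℝ z w := fun z w => by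
      simp [Complex.inner]
    have hs : ∀ w : R4, (phi1 - ρ • phi2 a b p) ((Jab a b hb).J p w) =
        Complex.I * (phi1 - ρ • phi2 a b p) w := fun w => by
      change phi1 _ - ρ • phi2 a b p _ = Complex.I * (phi1 w - ρ • phi2 a b p w)
      rw [phi1_J, phi2_J, mul_sub, mul_smul_comm]
    change inner ℝ ((phi1 - ρ • phi2 a b p) _) ((phi1 - ρ • phi2 a b p) _) +
      inner ℝ (phi2 a b p _) (phi2 a b p _) = _
    rw [hs, hs, phi2_J, phi2_J, hI, hI]
    rfl
  invariant γ p u v := by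
    have hs : ∀ w : R4, (phi1 - ρ • phi2 a b (deck γ p)) (fderiv ℝ (deck γ) p w) =
        (phi1 - ρ • phi2 a b p) w := fun w => by
      change phi1 _ - ρ • phi2 a b _ _ = phi1 w - ρ • phi2 a b p w
      rw [phi1_deck, phi2_deck]
    change inner ℝ ((phi1 - ρ • phi2 a b (deck γ p)) _) ((phi1 - ρ • phi2 a b (deck γ p)) _) +
      inner ℝ (phi2 a b (deck γ p) _) (phi2 a b (deck γ p) _) = _
    rw [hs, hs, phi2_deck, phi2_deck]
    rfl

/-- The parameter `b = 8π · 5^{(K-1)/2} / 3` for odd `K`. -/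
def bK (K : ℕ) : ℝ := 8 * Real.pi * 5 ^ ((K - 1) / 2) / 3

theorem bK_ne_zero (K : ℕ) : bK K ≠ 0 := by
  unfold bK
  positivity

end KT

end

/-! ### Transcendence of π. -/

open scoped ContDiff

noncomputable section

namespace PiTranscendence

open Polynomial

/-! Write a (0,1)-form as `s = f ψ̄₁ + g ψ̄₂` with `ψ₁ = φ₁ - ρ φ₂`, `ψ₂ = φ₂`. Since `dφ₁ = 0` and
`dφ₂ = i b dx ∧ dy`, the operators `∂̄` and `∂̄*` become first order operators on `(f, g)` with
constant coefficients in the invariant frame (`dbar_oneForm`, `dbarStar_oneForm`). The frame fields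
are skew-adjoint in `L²`, so pairing the Laplace equation with `s` shows that `s` is harmonic
exactly when `∂̄ s = 0` and `∂̄* s = 0` (`div_curl_eq_zero`, `laplacian_oneForm_eq_zero_iff`).

This system commutes with translations in `t` and `z`, hence splits into Fourier modes. Put `K = 2N
+ 1`, `b = 4πβ`, `β = 2 · 5^N / 3`.

Modes of frequency `n ≠ 0` along `z` vanish. There `[D 1, D 2] = D 3` is a nonzero scalar, so
suitable combinations of `f` and `g` are exchanged by creation and annihilation operators of a
harmonic oscillator, and the spectrum is that of the oscillator (`ladder_eigenvalue`,
`exists_ladder_eigenvalue`). The resulting equation forces frequency 0 along `t`; squared, it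
becomes a polynomial equation for `π` over ℚ with nonzero constant term, since `ρ` is a rational
multiple of `π`. This contradicts Lindemann's theorem (`oscillator_ne`, `mode_eq_zero`).

Modes constant along `z` live on the torus with coordinates `t, x, y`. For each character the system
is a 2 × 2 linear system, and the solution space has as dimension the number of frequencies `(l, k,
m)` at which its determinant vanishes (`coeffMap_bijective`). For `ρ = 0` these are `l = 0` and the
lattice points of the circle `k² + m² = βk`; factorization in the Gaussian integers counts `2N + 1`
of them (`card_circle`). For `ρ = rπ ≠ 0` the transcendence of `π` leaves `l = m = 0` and `k (β - k)
= 0`, hence only the origin because `β` is not an integer (`freq_eq_zero`). -/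

theorem exists_common_int_poly {κ : Type*} (s : Finset κ) (β : κ → ℂ)
    (h0 : ∀ i ∈ s, β i ≠ 0) (halg : ∀ i ∈ s, IsAlgebraic ℤ (β i)) :
    ∃ f : ℤ[X], f.eval 0 ≠ 0 ∧ ∀ i ∈ s, β i ∈ f.aroots ℂ := by
  classical
  have key : ∀ i : κ, ∃ f : ℤ[X], i ∈ s → (f.eval 0 ≠ 0 ∧ aeval (β i) f = 0) := by
    intro i
    by_cases hi : i ∈ s
    · obtain ⟨f, hf0, hf⟩ := (halg i hi).exists_nonzero_coeff_and_aeval_eq_zero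
        (mem_nonZeroDivisors_of_ne_zero (h0 i hi))
      exact ⟨f, fun _ => ⟨by rwa [← coeff_zero_eq_eval_zero], hf⟩⟩
    · exact ⟨0, fun h => absurd h hi⟩
  choose f hf using key
  have hne : (∏ i ∈ s, f i).eval 0 ≠ 0 := by
    rw [eval_prod]
    exact Finset.prod_ne_zero_iff.2 fun i hi => (hf i hi).1
  refine ⟨∏ i ∈ s, f i, hne, fun i hi => ?_⟩
  rw [mem_aroots]
  refine ⟨fun h => hne (by rw [h]; simp), ?_⟩
  rw [map_prod]
  exact Finset.prod_eq_zero hi (hf i hi).2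

theorem exists_common_denominator {κ : Type*} (s : Finset κ) (β : κ → ℂ)
    (halg : ∀ i ∈ s, IsAlgebraic ℤ (β i)) :
    ∃ a : ℤ, a ≠ 0 ∧ ∀ i ∈ s, IsIntegral ℤ ((a : ℂ) * β i) := by
  classical
  induction s using Finset.induction_on with
  | empty => exact ⟨1, one_ne_zero, by simp⟩
  | insert i s hi ih =>
    obtain ⟨a, ha, h⟩ := ih fun j hj => halg j (Finset.mem_insert_of_mem hj)
    obtain ⟨y, hy, hy2⟩ := (halg i (Finset.mem_insert_self i s)).exists_integral_multiple
    refine ⟨a * y, mul_ne_zero ha hy, fun j hj => ?_⟩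
    have hint : ∀ n : ℤ, IsIntegral ℤ (n : ℂ) := fun n => isIntegral_algebraMap (R := ℤ) (x := n)
    rcases Finset.mem_insert.1 hj with rfl | hj
    · have := (hint a).mul hy2
      rw [zsmul_eq_mul, ← mul_assoc] at this
      exact_mod_cast this
    · have := (hint y).mul (h j hj)
      rw [← mul_assoc, mul_comm (y : ℂ)] at this
      exact_mod_cast this

/-- Each monomial is `a ^ D z ^ j = a ^ (D - j) (a z) ^ j`. -/
theorem isIntegral_pow_mul_aeval {z : ℂ} {a : ℤ} (h : IsIntegral ℤ ((a : ℂ) * z)) (g : ℤ[X])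
    {D : ℕ} (hD : g.natDegree ≤ D) : IsIntegral ℤ ((a : ℂ) ^ D * aeval z g) := by
  have hint : ∀ n : ℤ, IsIntegral ℤ (n : ℂ) := fun n => isIntegral_algebraMap (R := ℤ) (x := n)
  rw [aeval_eq_sum_range, Finset.mul_sum]
  refine IsIntegral.sum _ fun j hj => ?_
  have hj' : j ≤ D := (Nat.lt_succ_iff.1 (Finset.mem_range.1 hj)).trans hD
  have e : (a : ℂ) ^ D * g.coeff j • z ^ j =
      (g.coeff j : ℂ) * (a : ℂ) ^ (D - j) * ((a : ℂ) * z) ^ j := by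
    rw [zsmul_eq_mul, mul_pow]
    conv_lhs => rw [← Nat.sub_add_cancel hj', pow_add]
    ring
  rw [e]
  exact ((hint _).mul ((hint a).pow _)).mul (h.pow _)

/-- Hermite's argument. For large primes `p` the numbers `n exp (β i)` are extremely close to `p g
(β i)`, with `g` integral and `p ∤ n`. If the sum vanished, then `n q + p ∑ g (β i)`, after clearing
denominators by a power of `a`, would be an integer that is nonzero modulo `p` and yet smaller than
1. -/
theorem natCast_add_sum_exp_ne_zero {κ : Type*} (s : Finset κ) (β : κ → ℂ)
    (h0 : ∀ i ∈ s, β i ≠ 0) (halg : ∀ i ∈ s, IsAlgebraic ℤ (β i))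
    (hrat : ∀ g : ℤ[X], ∃ y : ℚ, ∑ i ∈ s, aeval (β i) g = (y : ℂ)) {q : ℕ} (hq : q ≠ 0) :
    (q : ℂ) + ∑ i ∈ s, Complex.exp (β i) ≠ 0 := by
  intro hsum
  obtain ⟨f, hf0, hf⟩ := exists_common_int_poly s β h0 halg
  obtain ⟨a, ha, hint⟩ := exists_common_denominator s β halg
  obtain ⟨c, hc⟩ := LindemannWeierstrass.exp_polynomial_approx f hf0
  set d := f.natDegree with hd
  -- the bound tends to zero
  have hlim : Filter.Tendsto (fun p : ℕ => (s.card : ℝ) * (|(a : ℝ)| ^ d * |c| + 1) *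
      (((|(a : ℝ)| ^ d * |c| + 1) ^ p) / p.factorial)) Filter.atTop (nhds 0) := by
    have := (FloorSemiring.tendsto_pow_div_factorial_atTop (|(a : ℝ)| ^ d * |c| + 1)).const_mul
      ((s.card : ℝ) * (|(a : ℝ)| ^ d * |c| + 1))
    simpa using this
  obtain ⟨p0, hp0⟩ := Filter.eventually_atTop.1 (hlim.eventually (gt_mem_nhds one_pos))
  -- The prime exceeds `|f 0|`, as the approximation theorem demands, and also `q` and `|a|`, so
  -- that it divides neither; `p0 + 2` makes the error bound at `p - 1` smaller than 1.
  obtain ⟨p, hpge, hp⟩ := Nat.exists_infinite_primes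
    (p0 + 2 + (eval 0 f).natAbs + q + a.natAbs)
  obtain ⟨n, hn, g, hg, happ⟩ := hc p (by omega) hp
  obtain ⟨y, hy⟩ := hrat g
  -- integrality
  have hD : g.natDegree ≤ d * p := hg.trans ((Nat.sub_le _ _).trans (by rw [mul_comm]))
  -- The power `a ^ (d * p)` suffices as `g` has degree at most `d * p`. A rational number integral
  -- over ℤ is an integer, here `z`.
  have hI : IsIntegral ℤ ((((a : ℚ) ^ (d * p) * y : ℚ)) : ℂ) := by
    have : (((a : ℚ) ^ (d * p) * y : ℚ) : ℂ) =
        ∑ i ∈ s, (a : ℂ) ^ (d * p) * aeval (β i) g := by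
      rw [← Finset.mul_sum, hy]
      push_cast
      rfl
    rw [this]
    exact IsIntegral.sum _ fun i hi => isIntegral_pow_mul_aeval (hint i hi) g hD
  have hI2 : IsIntegral ℤ ((a : ℚ) ^ (d * p) * y) :=
    (isIntegral_algHom_iff ((Algebra.ofId ℚ ℂ).restrictScalars ℤ)
      (algebraMap ℚ ℂ).injective).1 hI
  obtain ⟨z, hz⟩ := IsIntegrallyClosed.isIntegral_iff.1 hI2
  have hz' : (z : ℂ) = (a : ℂ) ^ (d * p) * ∑ i ∈ s, aeval (β i) g := by
    rw [hy]
    have h2 := congrArg (fun t : ℚ => (t : ℂ)) hz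
    simpa using h2
  have hM : ((a ^ (d * p) * (n * q) + p * z : ℤ) : ℂ) =
      -((a : ℂ) ^ (d * p) * ∑ i ∈ s, (n • Complex.exp (β i) - p • aeval (β i) g)) := by
    rw [Finset.sum_sub_distrib, ← Finset.smul_sum, ← Finset.smul_sum]
    have : ∑ i ∈ s, Complex.exp (β i) = -(q : ℂ) := by linear_combination hsum
    rw [this, zsmul_eq_mul, nsmul_eq_mul]
    push_cast
    rw [hz']
    ring
  have hpZ : Prime (p : ℤ) := Nat.prime_iff_prime_int.1 hp
  have hne : (a ^ (d * p) * (n * q) + p * z : ℤ) ≠ 0 := by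
    intro h
    have hdvd : (p : ℤ) ∣ a ^ (d * p) * (n * q) := ⟨-z, by linear_combination h⟩
    rcases hpZ.dvd_or_dvd hdvd with h1 | h1
    · have h2 := hpZ.dvd_of_dvd_pow h1
      have := Nat.le_of_dvd (Int.natAbs_pos.2 ha) (Int.natCast_dvd.1 h2)
      omega
    · rcases hpZ.dvd_or_dvd h1 with h1 | h1
      · exact hn h1
      · have := Nat.le_of_dvd (Nat.pos_of_ne_zero hq) (Int.natCast_dvd_natCast.1 h1)
        omega
  have hge : (1 : ℝ) ≤ ‖((a ^ (d * p) * (n * q) + p * z : ℤ) : ℂ)‖ := by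
    rw [Complex.norm_intCast]
    exact_mod_cast Int.one_le_abs hne
  have hp1 : p = (p - 1) + 1 := by have := hp.one_lt; omega
  have hle : ‖((a ^ (d * p) * (n * q) + p * z : ℤ) : ℂ)‖ ≤
      (s.card : ℝ) * (|(a : ℝ)| ^ d * |c| + 1) *
      (((|(a : ℝ)| ^ d * |c| + 1) ^ (p - 1)) / (p - 1).factorial) := by
    rw [hM, norm_neg, norm_mul, norm_pow, Complex.norm_intCast]
    have h1 : ‖∑ i ∈ s, (n • Complex.exp (β i) - p • aeval (β i) g)‖ ≤
        s.card * (|c| ^ p / (p - 1).factorial) := by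
      refine (norm_sum_le_of_le _ fun i hi => (happ (hf i hi)).trans ?_).trans
        (le_of_eq (by rw [Finset.sum_const, nsmul_eq_mul]))
      refine div_le_div_of_nonneg_right ?_ (Nat.cast_nonneg _)
      rw [← abs_pow]
      exact le_abs_self _
    calc _ ≤ |(a : ℝ)| ^ (d * p) * (s.card * (|c| ^ p / (p - 1).factorial)) := by gcongr
      _ = s.card * ((|(a : ℝ)| ^ d * |c|) ^ p / (p - 1).factorial) := by
        rw [mul_pow, ← pow_mul]; ring
      _ ≤ s.card * ((|(a : ℝ)| ^ d * |c| + 1) ^ p / (p - 1).factorial) := by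
        refine mul_le_mul_of_nonneg_left (div_le_div_of_nonneg_right
          (pow_le_pow_left₀ (by positivity) ?_ _) (Nat.cast_nonneg _)) (Nat.cast_nonneg _)
        linarith
      _ = _ := by
        have e : (|(a : ℝ)| ^ d * |c| + 1) ^ p =
            (|(a : ℝ)| ^ d * |c| + 1) ^ (p - 1) * (|(a : ℝ)| ^ d * |c| + 1) := by
          rw [← pow_succ, ← hp1]
        rw [e]
        ring
  have := hp0 (p - 1) (by omega)
  linarith

theorem isAlgebraic_I : IsAlgebraic ℚ Complex.I := by
  refine ⟨X ^ 2 + 1, ?_, by simp⟩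
  have : (X ^ 2 + 1 : ℚ[X]) = X ^ 2 + C 1 := by simp
  rw [this]
  exact X_pow_add_C_ne_zero (by norm_num) 1

/-- If `π` were algebraic, the product of `1 + exp θ` over the conjugates `θ` of `iπ` would vanish.
Expanded, it is a sum of `exp` over all subset sums of the conjugates; the zero sums contribute a
positive integer, and the nonzero ones form a Galois-stable family. The conjugates are taken in an
algebraic closure `L` of ℚ, which is Galois over ℚ, and are mapped to ℂ by `φ`. -/
theorem not_isAlgebraic_pi_of_isAlgClosure (L : Type) [Field L] [Algebra ℚ L] [IsAlgClosed L]
    [Algebra.IsAlgebraic ℚ L] : ¬ IsAlgebraic ℚ Real.pi := by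
  classical
  have hsep : Algebra.IsSeparable ℚ L := inferInstance
  have hnorm : Normal ℚ L := normal_iff.2 fun x =>
    ⟨Algebra.IsIntegral.isIntegral x, IsAlgClosed.splits _⟩
  have hgal : IsGalois ℚ L := ⟨⟩
  intro halg
  have halgC : IsAlgebraic ℚ ((Real.pi : ℂ)) := halg.algebraMap (A := ℂ)
  have hθ : IsAlgebraic ℚ ((Real.pi : ℂ) * Complex.I) := halgC.mul isAlgebraic_I
  let φ : L →ₐ[ℚ] ℂ := IsAlgClosed.lift
  let m := minpoly ℚ ((Real.pi : ℂ) * Complex.I)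
  have hm0 : m ≠ 0 := minpoly.ne_zero hθ.isIntegral
  let R : Finset L := (m.aroots L).toFinset
  have hR : ∀ x, x ∈ R ↔ aeval x m = 0 := fun x => by
    simp [R, hm0]
  -- `iπ` comes from `L`
  obtain ⟨t, htR, ht⟩ : ∃ t ∈ R, φ t = (Real.pi : ℂ) * Complex.I := by
    have hs : (m.map (algebraMap ℚ L)).Splits := IsAlgClosed.splits _
    have h1 := hs.image_rootSet φ
    have h2 : (Real.pi : ℂ) * Complex.I ∈ m.rootSet ℂ := by
      rw [mem_rootSet]
      exact ⟨hm0, minpoly.aeval _ _⟩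
    rw [← h1] at h2
    obtain ⟨t, ht, ht2⟩ := h2
    exact ⟨t, (hR t).2 (mem_rootSet.1 ht).2, ht2⟩
  have hprod : ∏ x ∈ R, (1 + Complex.exp (φ x)) = 0 := by
    refine Finset.prod_eq_zero htR ?_
    rw [ht, Complex.exp_pi_mul_I]
    ring
  rw [Finset.prod_one_add] at hprod
  have hexp : ∀ S ∈ R.powerset, ∏ x ∈ S, Complex.exp (φ x) = Complex.exp (φ (∑ x ∈ S, x)) := by
    intro S _
    rw [map_sum, Complex.exp_sum]
  rw [Finset.sum_congr rfl hexp] at hprod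
  rw [← Finset.sum_filter_add_sum_filter_not R.powerset (fun S => ∑ x ∈ S, x = 0)] at hprod
  have h1 : ∑ S ∈ R.powerset with ∑ x ∈ S, x = 0, Complex.exp (φ (∑ x ∈ S, x)) =
      ((R.powerset.filter (fun S => ∑ x ∈ S, x = 0)).card : ℂ) := by
    rw [Finset.sum_congr rfl (g := fun _ => (1 : ℂ))]
    · simp
    · intro S hS
      rw [(Finset.mem_filter.1 hS).2]
      simp
  rw [h1] at hprod
  refine natCast_add_sum_exp_ne_zero
    (R.powerset.filter (fun S => ¬ ∑ x ∈ S, x = 0)) (fun S => φ (∑ x ∈ S, x)) ?_ ?_ ?_ ?_ hprod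
  · intro S hS
    rw [Ne, map_eq_zero]
    exact (Finset.mem_filter.1 hS).2
  · intro S _
    have h2 : IsAlgebraic ℚ (φ (∑ x ∈ S, x)) :=
      (Algebra.IsAlgebraic.isAlgebraic (R := ℚ) (∑ x ∈ S, x)).algHom φ
    exact (IsFractionRing.isAlgebraic_iff ℤ ℚ ℂ).2 h2
  · intro g
    set Y : L := ∑ S ∈ R.powerset with ¬ ∑ x ∈ S, x = 0, aeval (∑ x ∈ S, x) g with hY
    -- An automorphism permutes the roots, hence the subsets of `R` with nonzero sum.
    have hfix : ∀ σ : L ≃ₐ[ℚ] L, σ Y = Y := by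
      intro σ
      have hσ : ∀ x, x ∈ R ↔ σ x ∈ R := fun x => by
        rw [hR, hR, aeval_algHom_apply, map_eq_zero_iff σ σ.injective]
      have hsumσ : ∀ S : Finset L, ∑ x ∈ S.map σ.toEquiv.toEmbedding, x = σ (∑ x ∈ S, x) :=
        fun S => by simp [map_sum]
      rw [hY, map_sum]
      refine Finset.sum_bij (fun S _ => S.map σ.toEquiv.toEmbedding) ?_ ?_ ?_ ?_
      · intro S hS
        rw [Finset.mem_filter, Finset.mem_powerset] at hS ⊢
        refine ⟨fun x hx => ?_, ?_⟩
        · obtain ⟨w, hw, rfl⟩ := Finset.mem_map.1 hx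
          exact (hσ w).1 (hS.1 hw)
        · rw [hsumσ, map_eq_zero_iff σ σ.injective]
          exact hS.2
      · intro S _ S' _ h
        exact Finset.map_injective _ h
      · intro S hS
        rw [Finset.mem_filter, Finset.mem_powerset] at hS
        have e : (S.map σ.symm.toEquiv.toEmbedding).map σ.toEquiv.toEmbedding = S := by
          ext x
          simp
        refine ⟨S.map σ.symm.toEquiv.toEmbedding, ?_, e⟩
        rw [Finset.mem_filter, Finset.mem_powerset]
        refine ⟨fun x hx => ?_, ?_⟩
        · obtain ⟨w, hw, rfl⟩ := Finset.mem_map.1 hx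
          rw [hσ]
          simpa using hS.1 hw
        · intro h
          apply hS.2
          rw [← e, hsumσ, h, map_zero]
      · intro S _
        rw [hsumσ]
        exact (aeval_algHom_apply ((σ : L →ₐ[ℚ] L).restrictScalars ℤ) (∑ x ∈ S, x) g).symm
    obtain ⟨y, hy⟩ := (InfiniteGalois.mem_range_algebraMap_iff_fixed Y).2 hfix
    refine ⟨y, ?_⟩
    have h3 : φ Y = ∑ S ∈ R.powerset with ¬ ∑ x ∈ S, x = 0, aeval (φ (∑ x ∈ S, x)) g := by
      rw [hY, map_sum]
      refine Finset.sum_congr rfl fun S _ => ?_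
      exact (aeval_algHom_apply (φ.restrictScalars ℤ) (∑ x ∈ S, x) g).symm
    rw [← h3, ← hy]
    simp
  -- The empty subset has sum zero, so the integer term is positive.
  · rw [Ne, Finset.card_eq_zero]
    exact Finset.ne_empty_of_mem (a := ∅) (by simp)

/-- Lindemann's theorem. -/
theorem transcendental_pi : Transcendental ℚ Real.pi :=
  @not_isAlgebraic_pi_of_isAlgClosure (AlgebraicClosure ℚ) _ (AlgebraicClosure.instAlgebra ℚ) _
    (AlgebraicClosure.isAlgebraic ℚ)

end PiTranscendence

end

/-! ### Lattice points on a circle, counted with Gaussian integers. -/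

open scoped ContDiff

noncomputable section

namespace GaussianCount

local notation "A₅" => (⟨-1, 2⟩ : GaussianInt)
local notation "B₅" => (⟨2, -1⟩ : GaussianInt)

theorem norm_eq (z : GaussianInt) : z.norm = z.re ^ 2 + z.im ^ 2 := by
  rw [Zsqrtd.norm_def]; ring

/-- Modulo 5 the norm `x² + y²` factors as `(x - 2y)(x + 2y)`; divisibility of one factor by 5 is
divisibility of `z` by `A₅` or by `B₅`, the two primes above 5 up to units. -/
theorem exists_factor {z : GaussianInt} {M : ℕ} (h : z.norm = 5 ^ (M + 1)) :
    ∃ w : GaussianInt, w.norm = 5 ^ M ∧ (z = A₅ * w ∨ z = B₅ * w) := by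
  have hz := h
  rw [norm_eq, pow_succ] at hz
  have hdvd : (5 : ℤ) ∣ (z.re - 2 * z.im) * (z.re + 2 * z.im) :=
    ⟨5 ^ M - z.im ^ 2, by linear_combination hz⟩
  have hnorm : ∀ c w : GaussianInt, c.norm = 5 → z = c * w → w.norm = 5 ^ M := by
    intro c w hc hw
    have := congrArg Zsqrtd.norm hw
    rw [Zsqrtd.norm_mul, hc, h, pow_succ] at this
    linarith
  rcases (Int.prime_iff_natAbs_prime.2 (by norm_num)).dvd_or_dvd hdvd with ⟨c, hc⟩ | ⟨c, hc⟩
  · have e : z = A₅ * ⟨-c, -z.im - 2 * c⟩ := by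
      ext
      · simp
        linarith
      · simp
    exact ⟨_, hnorm A₅ _ (by rw [norm_eq]; norm_num) e, Or.inl e⟩
  · have e : z = B₅ * ⟨2 * c - z.im, c⟩ := by
      ext
      · simp
        linarith
      · simp
    exact ⟨_, hnorm B₅ _ (by rw [norm_eq]; norm_num) e, Or.inr e⟩

theorem exists_factorization (M : ℕ) : ∀ {z : GaussianInt}, z.norm = 5 ^ M →
    ∃ j ≤ M, ∃ u : GaussianInt, u.norm = 1 ∧ z = u * (A₅ ^ j * B₅ ^ (M - j)) := by
  induction M with
  | zero =>
    intro z h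
    exact ⟨0, le_rfl, z, by simpa using h, by simp⟩
  | succ M ih =>
    intro z h
    obtain ⟨w, hw, hzw⟩ := exists_factor h
    obtain ⟨j, hj, u, hu, rfl⟩ := ih hw
    rcases hzw with rfl | rfl
    · refine ⟨j + 1, by omega, u, hu, ?_⟩
      rw [Nat.add_sub_add_right]
      ring
    · refine ⟨j, by omega, u, hu, ?_⟩
      rw [Nat.succ_sub hj, pow_succ]
      ring

/-- The homomorphism to `ZMod 5` with `i ↦ 2` kills `B₅` and sends `A₅` to the unit 3. -/
theorem pow_ne_pow {d : ℕ} (hd : d ≠ 0) : B₅ ^ d ≠ A₅ ^ d := by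
  intro h
  have h3 : (3 : ZMod 5) ≠ 0 := by decide
  have hA3 : (((-1 : ℤ) : ZMod 5) + ((2 : ℤ) : ZMod 5) * 2) = 3 := by decide
  have hB3 : (((2 : ℤ) : ZMod 5) + ((-1 : ℤ) : ZMod 5) * 2) = 0 := by decide
  have hsq : (2 : ZMod 5) * 2 = ((-1 : ℤ) : ZMod 5) := by decide
  have : Fact (Nat.Prime 5) := ⟨by norm_num⟩
  let φ : GaussianInt →+* ZMod 5 := Zsqrtd.lift ⟨2, hsq⟩
  have h2 := congrArg φ h
  have hA : φ A₅ = 3 := by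
    simpa only [φ, Zsqrtd.lift_apply_apply] using hA3
  have hB : φ B₅ = 0 := by
    simpa only [φ, Zsqrtd.lift_apply_apply] using hB3
  rw [map_pow, map_pow, hA, hB, zero_pow hd] at h2
  exact pow_ne_zero d h3 h2.symm

theorem A_ne_zero : A₅ ≠ 0 := by
  intro h
  simpa using congrArg Zsqrtd.re h

theorem B_ne_zero : B₅ ≠ 0 := by
  intro h
  simpa using congrArg Zsqrtd.re h

theorem eq_of_pow_mul_pow_eq {M j j' : ℕ} (hj : j ≤ M) (hj' : j' ≤ M)
    (h : A₅ ^ j * B₅ ^ (M - j) = A₅ ^ j' * B₅ ^ (M - j')) : j = j' := by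
  wlog hlt : j < j' generalizing j j'
  · rcases lt_trichotomy j j' with h1 | h1 | h1
    · exact absurd h1 hlt
    · exact h1
    · exact (this hj' hj h.symm h1).symm
  exfalso
  have h1 : M - j = (M - j') + (j' - j) := by omega
  have h2 : A₅ ^ j' = A₅ ^ j * A₅ ^ (j' - j) := by rw [← pow_add]; congr 1; omega
  rw [h1, h2, pow_add, mul_assoc] at h
  have h3 := mul_left_cancel₀ (pow_ne_zero j A_ne_zero) h
  rw [mul_comm (A₅ ^ (j' - j))] at h3
  exact pow_ne_pow (by omega) (mul_left_cancel₀ (pow_ne_zero (M - j') B_ne_zero) h3)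

/-- Reduction modulo `3`. -/
def red : GaussianInt →+* GaussianInt ⧸ Ideal.span {(3 : GaussianInt)} := Ideal.Quotient.mk _

theorem red_eq_iff (z w : GaussianInt) : red z = red w ↔ (3 : GaussianInt) ∣ z - w := by
  rw [red, Ideal.Quotient.eq, Ideal.mem_span_singleton]

theorem three_dvd_iff (z : GaussianInt) : (3 : GaussianInt) ∣ z ↔ 3 ∣ z.re ∧ 3 ∣ z.im := by
  constructor
  · rintro ⟨w, rfl⟩
    exact ⟨⟨w.re, by simp⟩, ⟨w.im, by simp⟩⟩
  · rintro ⟨⟨c, hc⟩, ⟨d, hd⟩⟩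
    exact ⟨⟨c, d⟩, by ext <;> simp [hc, hd]⟩

/-- The generators `A₅ = -1 + 2i` and `B₅ = 2 - i` are chosen congruent modulo 3, so that the
residue of `A₅ ^ j * B₅ ^ (2 * N - j)` does not depend on `j`, and one unit serves all `j`. -/
theorem red_A : red A₅ = red B₅ := by
  rw [red_eq_iff, three_dvd_iff]; norm_num

theorem red_B_sq : red B₅ ^ 2 = red ⟨0, -1⟩ := by
  rw [← map_pow, red_eq_iff, three_dvd_iff, sq]; norm_num

theorem red_five : red 5 = -1 := by
  rw [← map_one red, ← map_neg, red_eq_iff, three_dvd_iff]; norm_num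

/-- The unit that puts `A₅ ^ j * B₅ ^ (2 * N - j)` into the residue class of `-5 ^ N`. -/
def unitOf (N : ℕ) : GaussianInt := (-1) ^ (N + 1) * ⟨0, 1⟩ ^ N

theorem norm_unitOf (N : ℕ) : (unitOf N).norm = 1 := by
  have h1 : (-1 : GaussianInt).norm = 1 := by rw [norm_eq]; norm_num
  have h2 : (⟨0, 1⟩ : GaussianInt).norm = 1 := by rw [norm_eq]; norm_num
  have := fun (z : GaussianInt) n => map_pow (Zsqrtd.normMonoidHom (d := -1)) z n
  simp only [Zsqrtd.normMonoidHom, MonoidHom.coe_mk, OneHom.coe_mk] at this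
  rw [unitOf, Zsqrtd.norm_mul, this, this, h1, h2]
  simp

theorem red_prod {N j : ℕ} (hj : j ≤ 2 * N) :
    red (A₅ ^ j * B₅ ^ (2 * N - j)) = red ⟨0, -1⟩ ^ N := by
  rw [map_mul, map_pow, map_pow, red_A, ← pow_add, Nat.add_sub_cancel' hj, pow_mul, red_B_sq]

theorem red_unitOf_mul (N : ℕ) : red (unitOf N) * red ⟨0, -1⟩ ^ N = -red 5 ^ N := by
  have h : (⟨0, 1⟩ : GaussianInt) * ⟨0, -1⟩ = 1 := by ext <;> simp
  rw [← map_pow, ← map_mul, unitOf, mul_assoc, ← mul_pow, h, one_pow, mul_one, map_pow, map_neg,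
    map_one, red_five, pow_succ]
  ring

/-- The coordinates of a unit lie in `{-1, 0, 1}`, and these are distinct modulo 3. -/
theorem eq_of_red_eq {u v : GaussianInt} (hu : u.norm = 1) (hv : v.norm = 1)
    (h : red u = red v) : u = v := by
  rw [red_eq_iff, three_dvd_iff] at h
  obtain ⟨h1, h2⟩ := h
  rw [norm_eq] at hu hv
  have b : ∀ x y : ℤ, x ^ 2 + y ^ 2 = 1 → -1 ≤ x ∧ x ≤ 1 ∧ -1 ≤ y ∧ y ≤ 1 := by
    intro x y h
    refine ⟨?_, ?_, ?_, ?_⟩ <;> nlinarith [sq_nonneg x, sq_nonneg y]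
  obtain ⟨a1, a2, a3, a4⟩ := b _ _ hu
  obtain ⟨b1, b2, b3, b4⟩ := b _ _ hv
  simp only [Zsqrtd.re_sub, Zsqrtd.im_sub] at h1 h2
  ext <;> omega

theorem red_unit (N : ℕ) (z w : GaussianInt) (h : red z * red ⟨0, -1⟩ ^ N =
    red w * red ⟨0, -1⟩ ^ N) : red z = red w := by
  have hu : IsUnit (red ⟨0, -1⟩ ^ N) := by
    refine IsUnit.pow N (IsUnit.of_mul_eq_one (red ⟨0, 1⟩) ?_)
    rw [← map_mul, ← map_one red]
    congr 1
  exact hu.mul_right_cancel h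

/-- The lattice points on the circle `3 (k² + m²) = 2 · 5^N k`. -/
abbrev circle (N : ℕ) : Type := {q : ℤ × ℤ // 3 * (q.1 ^ 2 + q.2 ^ 2) = 2 * 5 ^ N * q.1}

/-- Completing the square, the equation says that `(3k - 5^N) + 3m i` has norm `5^(2N)`. So the
points correspond to the elements of this norm congruent to `-5^N` modulo 3. Such an element is `u
A₅ ^ j B₅ ^ (2N - j)` with `0 ≤ j ≤ 2N`, where the congruence fixes the unit `u` and `j` remains
free. -/
theorem card_circle (N : ℕ) : Nonempty (circle N ≃ Fin (2 * N + 1)) := by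
  have key : ∀ j : Fin (2 * N + 1), ∃ q : circle N,
      (⟨3 * q.1.1 - 5 ^ N, 3 * q.1.2⟩ : GaussianInt) =
        unitOf N * (A₅ ^ (j : ℕ) * B₅ ^ (2 * N - j)) := by
    intro j
    have hj : (j : ℕ) ≤ 2 * N := Nat.lt_succ_iff.1 j.2
    set z := unitOf N * (A₅ ^ (j : ℕ) * B₅ ^ (2 * N - j)) with hz
    have hred : red z = red (-5 ^ N) := by
      rw [hz, map_mul, red_prod hj, red_unitOf_mul, map_neg, map_pow]
    rw [red_eq_iff, three_dvd_iff] at hred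
    have e5 : ((5 : GaussianInt) ^ N) = ((5 ^ N : ℤ) : GaussianInt) := by push_cast; rfl
    rw [e5] at hred
    rw [sub_neg_eq_add, Zsqrtd.re_add, Zsqrtd.im_add, Zsqrtd.re_intCast, Zsqrtd.im_intCast,
      add_zero] at hred
    obtain ⟨⟨k, hk⟩, ⟨m, hm⟩⟩ := hred
    have hm' : z.im = 3 * m := by linarith
    have hk' : z.re = 3 * k - 5 ^ N := by linarith
    have hn : z.norm = 5 ^ (2 * N) := by
      have h5 : ∀ M : ℕ, ∀ c : GaussianInt, c.norm = 5 → (c ^ M).norm = 5 ^ M := by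
        intro M c hc
        have := map_pow (Zsqrtd.normMonoidHom (d := -1)) c M
        simp only [Zsqrtd.normMonoidHom, MonoidHom.coe_mk, OneHom.coe_mk] at this
        rw [this, hc]
      rw [hz, Zsqrtd.norm_mul, Zsqrtd.norm_mul, norm_unitOf, h5 _ _ (by rw [norm_eq]; norm_num),
        h5 _ _ (by rw [norm_eq]; norm_num), one_mul, ← pow_add, Nat.add_sub_cancel' hj]
    refine ⟨⟨(k, m), ?_⟩, ?_⟩
    · rw [norm_eq, hk', hm', pow_mul'] at hn
      simp only
      linarith
    · ext
      · exact hk'.symm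
      · exact hm'.symm
  choose g hg using key
  refine ⟨(Equiv.ofBijective g ⟨?_, ?_⟩).symm⟩
  · intro j j' h
    have h1 := hg j
    rw [h, hg j'] at h1
    have hu : unitOf N ≠ 0 := by
      intro h
      have := norm_unitOf N
      rw [h] at this
      simp at this
    exact (Fin.ext (eq_of_pow_mul_pow_eq (Nat.lt_succ_iff.1 j'.2) (Nat.lt_succ_iff.1 j.2)
      (mul_left_cancel₀ hu h1))).symm
  · rintro ⟨⟨k, m⟩, hq⟩
    simp only at hq
    have hn : (⟨3 * k - 5 ^ N, 3 * m⟩ : GaussianInt).norm = 5 ^ (2 * N) := by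
      rw [norm_eq, pow_mul']
      simp only
      linarith
    obtain ⟨j, hj, u, hu, hz⟩ := exists_factorization _ hn
    have hred : red (⟨3 * k - 5 ^ N, 3 * m⟩ : GaussianInt) = red (-5 ^ N) := by
      rw [red_eq_iff, three_dvd_iff]
      have e5 : ((5 : GaussianInt) ^ N) = ((5 ^ N : ℤ) : GaussianInt) := by push_cast; rfl
      rw [e5]
      simp only [Zsqrtd.re_sub, Zsqrtd.im_sub, Zsqrtd.re_neg, Zsqrtd.im_neg, Zsqrtd.re_intCast,
        Zsqrtd.im_intCast]
      exact ⟨⟨k, by ring⟩, ⟨m, by ring⟩⟩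
    have huu : u = unitOf N := by
      refine eq_of_red_eq hu (norm_unitOf N) (red_unit N _ _ ?_)
      rw [red_unitOf_mul, ← red_prod hj, ← map_mul, ← hz, hred, map_neg, map_pow]
    refine ⟨⟨j, by omega⟩, ?_⟩
    have h2 := hg ⟨j, by omega⟩
    rw [← huu, ← hz] at h2
    have r1 := congrArg Zsqrtd.re h2
    have r2 := congrArg Zsqrtd.im h2
    simp only at r1 r2
    apply Subtype.ext
    apply Prod.ext <;> simp only <;> omega

end GaussianCount

end

open scoped ContDiff

noncomputable section

namespace KT

open Complex MeasureTheory intervalIntegral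

/-! ### Fourier coefficients along a line -/

/-- The `n`-th Fourier coefficient of `F` along the segment from `p` to `p + v`. -/
def proj (v : R4) (n : ℤ) (F : R4 → ℂ) (p : R4) : ℂ :=
  ∫ ζ in (0 : ℝ)..1, exp (-(2 * Real.pi * I * n * ζ)) * F (p + ζ • v)

theorem continuous_integrand (v : R4) (n : ℤ) {F : R4 → ℂ} (hF : Continuous F) :
    Continuous fun q : R4 × ℝ => exp (-(2 * Real.pi * I * n * q.2)) * F (q.1 + q.2 • v) := by
  fun_prop

theorem continuous_line (v : R4) (n : ℤ) {F : R4 → ℂ} (hF : Continuous F) (p : R4) :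
    Continuous fun ζ : ℝ => exp (-(2 * Real.pi * I * n * ζ)) * F (p + ζ • v) := by
  fun_prop

theorem continuous_proj (v : R4) (n : ℤ) {F : R4 → ℂ} (hF : Continuous F) :
    Continuous (proj v n F) :=
  continuous_parametric_intervalIntegral_of_continuous' (continuous_integrand v n hF) 0 1

/-- Differentiation under the integral; the derivative of the integrand is bounded on the compact
set `closedBall p 1 × [0, 1]`. -/
theorem hasFDerivAt_proj (v : R4) (n : ℤ) {F : R4 → ℂ} (hF : ContDiff ℝ 1 F) (p : R4) :
    HasFDerivAt (proj v n F)
      (∫ ζ in (0 : ℝ)..1, exp (-(2 * Real.pi * I * n * ζ)) • fderiv ℝ F (p + ζ • v)) p := by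
  have hF' : Continuous (fderiv ℝ F) := hF.continuous_fderiv one_ne_zero
  have hc : Continuous fun q : R4 × ℝ =>
      exp (-(2 * Real.pi * I * n * q.2)) • fderiv ℝ F (q.1 + q.2 • v) := by fun_prop
  obtain ⟨C, hC⟩ := ((isCompact_closedBall p 1).prod (isCompact_Icc (a := (0 : ℝ)) (b := 1)))
    |>.exists_bound_of_continuousOn hc.continuousOn
  refine hasFDerivAt_integral_of_dominated_of_fderiv_le (bound := fun _ => C)
    (F := fun p ζ => exp (-(2 * Real.pi * I * n * (ζ : ℝ))) * F (p + ζ • v))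
    (F' := fun p ζ => exp (-(2 * Real.pi * I * n * (ζ : ℝ))) • fderiv ℝ F (p + ζ • v))
    (s := Metric.closedBall p 1) (Metric.closedBall_mem_nhds p one_pos) ?_ ?_ ?_ ?_ ?_ ?_
  · exact Filter.Eventually.of_forall fun q =>
      (continuous_line v n hF.continuous q).aestronglyMeasurable
  · exact (continuous_line v n hF.continuous p).intervalIntegrable 0 1
  · exact (hc.comp (Continuous.prodMk_right p)).aestronglyMeasurable
  · refine ae_of_all _ fun ζ hζ q hq => hC (q, ζ) ⟨hq, ?_⟩
    rw [Set.uIoc_of_le zero_le_one] at hζ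
    exact Set.Ioc_subset_Icc_self hζ
  · exact intervalIntegrable_const
  · refine ae_of_all _ fun ζ _ q _ => ?_
    have h1 : HasFDerivAt F (fderiv ℝ F (q + ζ • v)) (q + ζ • v) :=
      ((hF.differentiable one_ne_zero) _).hasFDerivAt
    have h2 : HasFDerivAt (fun q : R4 => F (q + ζ • v)) (fderiv ℝ F (q + ζ • v)) q :=
      HasFDerivAt.comp q h1 ((hasFDerivAt_id q).add_const (ζ • v))
    exact h2.const_mul _

theorem fderiv_proj (v : R4) (n : ℤ) {F : R4 → ℂ} (hF : ContDiff ℝ 1 F) (p w : R4) :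
    fderiv ℝ (proj v n F) p w = proj v n (fun q => fderiv ℝ F q w) p := by
  have hF' : Continuous (fderiv ℝ F) := hF.continuous_fderiv one_ne_zero
  have hc : Continuous fun ζ : ℝ =>
      exp (-(2 * Real.pi * I * n * ζ)) • fderiv ℝ F (p + ζ • v) := by fun_prop
  rw [(hasFDerivAt_proj v n hF p).fderiv,
    ContinuousLinearMap.intervalIntegral_apply (hc.intervalIntegrable 0 1)]
  rfl

theorem contDiff_proj (v : R4) (n : ℤ) {F : R4 → ℂ} (hF : ContDiff ℝ ∞ F) :
    ContDiff ℝ ∞ (proj v n F) := by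
  rw [contDiff_infty]
  intro k
  induction k generalizing F with
  | zero => exact contDiff_zero.2 (continuous_proj v n hF.continuous)
  | succ k ih =>
    have h1 : ContDiff ℝ 1 F := hF.of_le (by simp)
    rw [Nat.cast_add, Nat.cast_one]
    refine contDiff_succ_iff_fderiv_apply.2
      ⟨fun p => (hasFDerivAt_proj v n h1 p).differentiableAt, by simp, fun w => ?_⟩
    simp only [fderiv_proj v n h1]
    exact ih ((hF.fderiv_right (m := ∞) (by simp)).clm_apply contDiff_const)

/-- Integration by parts along the segment; the boundary terms cancel by periodicity of `F` and of
the exponential. -/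
theorem proj_fderiv_self (v : R4) (n : ℤ) {F : R4 → ℂ} (hF : ContDiff ℝ 1 F)
    (hper : ∀ p, F (p + v) = F p) (p : R4) :
    proj v n (fun q => fderiv ℝ F q v) p = 2 * Real.pi * I * n * proj v n F p := by
  have hF' : Continuous (fun q => fderiv ℝ F q v) :=
    (hF.continuous_fderiv one_ne_zero).clm_apply continuous_const
  have h1 : ∀ ζ : ℝ, HasDerivAt
      (fun ζ : ℝ => exp (-(2 * Real.pi * I * n * ζ)) * F (p + ζ • v))
      (exp (-(2 * Real.pi * I * n * ζ)) * fderiv ℝ F (p + ζ • v) v -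
        2 * Real.pi * I * n * (exp (-(2 * Real.pi * I * n * ζ)) * F (p + ζ • v))) ζ := by
    intro ζ
    have hl : HasDerivAt (fun ζ : ℝ => p + ζ • v) v ζ := by
      simpa using ((hasDerivAt_id ζ).smul_const v).const_add p
    have hFl : HasDerivAt (fun ζ : ℝ => F (p + ζ • v)) (fderiv ℝ F (p + ζ • v) v) ζ :=
      ((hF.differentiable one_ne_zero) _).hasFDerivAt.comp_hasDerivAt ζ hl
    have he : HasDerivAt (fun ζ : ℝ => exp (-(2 * Real.pi * I * n * ζ)))
        (exp (-(2 * Real.pi * I * n * ζ)) * (-(2 * Real.pi * I * n * 1))) ζ :=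
      (((hasDerivAt_id (ζ : ℂ)).comp_ofReal.const_mul (2 * Real.pi * I * n)).neg).cexp
    refine (he.mul hFl).congr_deriv ?_
    ring
  have hi1 := (continuous_line v n hF' p).intervalIntegrable (μ := volume) 0 1
  have hi2 := ((continuous_line v n hF.continuous p).const_mul
    (2 * Real.pi * I * n)).intervalIntegrable (μ := volume) 0 1
  have h2 := integral_eq_sub_of_hasDerivAt (fun ζ _ => h1 ζ) (hi1.sub hi2)
  rw [integral_sub hi1 hi2, intervalIntegral.integral_const_mul] at h2
  have h3 : exp (-(2 * Real.pi * I * n * ((1 : ℝ) : ℂ))) = 1 := by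
    rw [Complex.exp_eq_one_iff]
    exact ⟨-n, by push_cast; ring⟩
  rw [h3] at h2
  simp only [one_smul, hper, zero_smul, add_zero, one_mul, ofReal_zero, mul_zero, neg_zero,
    Complex.exp_zero, sub_self] at h2
  exact sub_eq_zero.1 h2

theorem proj_add (v : R4) (n : ℤ) {F G : R4 → ℂ} (hF : Continuous F) (hG : Continuous G) (p : R4) :
    proj v n (F + G) p = proj v n F p + proj v n G p := by
  unfold proj
  rw [← integral_add ((continuous_line v n hF p).intervalIntegrable 0 1)
    ((continuous_line v n hG p).intervalIntegrable 0 1)]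
  simp only [Pi.add_apply, mul_add]

theorem proj_smul (v : R4) (n : ℤ) (c : ℂ) (F : R4 → ℂ) (p : R4) :
    proj v n (c • F) p = c * proj v n F p := by
  unfold proj
  rw [← intervalIntegral.integral_const_mul]
  congr 1
  funext ζ
  simp only [Pi.smul_apply, smul_eq_mul]
  ring

/-- Uniqueness for Fourier series of continuous functions. -/
theorem eq_zero_of_fourier_eq_zero {h : ℝ → ℂ} (hc : Continuous h) (hper : ∀ x, h (x + 1) = h x)
    (h0 : ∀ n : ℤ, ∫ ζ in (0 : ℝ)..1, exp (-(2 * Real.pi * I * n * ζ)) * h ζ = 0) (x : ℝ) :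
    h x = 0 := by
  have hp : Function.Periodic h 1 := hper
  have hfact : Fact ((0 : ℝ) < 1) := ⟨one_pos⟩
  have hcont : Continuous hp.lift :=
    continuous_quot_lift _ hc
  let f : C(AddCircle (1 : ℝ), ℂ) := ⟨hp.lift, hcont⟩
  have hcoef : ∀ n, fourierCoeff f n = 0 := by
    intro n
    rw [fourierCoeff_eq_intervalIntegral f n 0, zero_add, one_div, inv_one, one_smul]
    refine Eq.trans (integral_congr fun ζ _ => ?_) (h0 n)
    simp only [fourier_coe_apply, f, ContinuousMap.coe_mk, hp.lift_coe, smul_eq_mul]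
    congr 2
    push_cast
    ring
  have hs : Summable (fourierCoeff f) := by
    rw [show fourierCoeff f = 0 from funext hcoef]
    exact summable_zero
  have h1 := has_pointwise_sum_fourier_series_of_summable hs (x : AddCircle (1 : ℝ))
  simp only [hcoef, zero_smul] at h1
  exact h1.unique hasSum_zero

theorem eq_zero_of_proj_eq_zero {v : R4} {F : R4 → ℂ} (hF : Continuous F)
    (hper : ∀ p, F (p + v) = F p) {p : R4} (h0 : ∀ n : ℤ, proj v n F p = 0) (x : ℝ) :
    F (p + x • v) = 0 :=
  eq_zero_of_fourier_eq_zero (h := fun ζ => F (p + ζ • v)) (by fun_prop)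
    (fun x => by simp only [add_smul, one_smul, ← add_assoc, hper]) h0 x

theorem const_of_proj_eq_zero {v : R4} {F : R4 → ℂ} (hF : Continuous F)
    (hper : ∀ p, F (p + v) = F p) {p : R4} (h0 : ∀ n : ℤ, n ≠ 0 → proj v n F p = 0) (x : ℝ) :
    F (p + x • v) = F p := by
  -- A constant has derivative 0, so `proj_fderiv_self` gives `0 = 2πi n` times its coefficient.
  have hconst : ∀ n : ℤ, n ≠ 0 → ∀ c : ℂ,
      ∫ ζ in (0 : ℝ)..1, exp (-(2 * Real.pi * I * n * ζ)) * c = 0 := by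
    intro n hn c
    have := proj_fderiv_self v n (F := fun _ => c) contDiff_const (fun _ => rfl) p
    simp only [fderiv_fun_const, Pi.zero_apply, _root_.zero_apply, proj, mul_zero,
      intervalIntegral.integral_zero] at this
    have hne : (2 * Real.pi * I * n : ℂ) ≠ 0 := by
      simp [Real.pi_ne_zero, hn, I_ne_zero]
    exact (mul_eq_zero.1 this.symm).resolve_left hne
  -- After subtraction of the mean value all coefficients vanish, also the one with `n = 0`.
  have key := eq_zero_of_fourier_eq_zero (h := fun ζ => F (p + ζ • v) - proj v 0 F p)
    (by fun_prop) (fun x => by simp only [add_smul, one_smul, ← add_assoc, hper]) (fun n => by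
      simp only [mul_sub]
      rw [integral_sub ((continuous_line v n hF p).intervalIntegrable 0 1)
        (Continuous.intervalIntegrable (by fun_prop) 0 1)]
      rcases eq_or_ne n 0 with rfl | hn
      · simp [proj]
      · rw [hconst n hn, sub_zero]
        exact h0 n hn)
  have h1 := key x
  have h2 := key 0
  simp only [zero_smul, add_zero] at h1 h2
  rw [sub_eq_zero.1 h1, sub_eq_zero.1 h2]

end KT

end

open scoped ContDiff

noncomputable section

namespace KT

open Complex MeasureTheory intervalIntegral

/-! ### Functions on `KT⁴` and the invariant frame -/

/-- The smooth complex functions on `KT⁴`. -/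
def smoothFn : Submodule ℂ (R4 → ℂ) where
  carrier := {F | ContDiff ℝ ∞ F ∧ ∀ γ p, F (deck γ p) = F p}
  add_mem' := by
    rintro F G ⟨h1, h2⟩ ⟨h3, h4⟩
    exact ⟨h1.add h3, fun γ p => by simp [h2, h4]⟩
  zero_mem' := ⟨contDiff_const, fun _ _ => rfl⟩
  smul_mem' := by
    rintro c F ⟨h1, h2⟩
    exact ⟨contDiff_const.smul h1, fun γ p => by simp [h2]⟩

/-- The type of smooth complex functions on `KT⁴`. -/
abbrev Fn : Type := smoothFn

instance : CoeFun Fn fun _ => R4 → ℂ := ⟨Subtype.val⟩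

theorem Fn.ext {F G : Fn} (h : ∀ p, F p = G p) : F = G := Subtype.ext (funext h)

theorem Fn.contDiff (F : Fn) : ContDiff ℝ ∞ (F : R4 → ℂ) := F.2.1

theorem Fn.contDiff_one (F : Fn) : ContDiff ℝ 1 (F : R4 → ℂ) := F.2.1.of_le (by simp)

theorem Fn.continuous (F : Fn) : Continuous (F : R4 → ℂ) := F.2.1.continuous

theorem Fn.differentiableAt (F : Fn) (p : R4) :
    DifferentiableAt ℝ (F : R4 → ℂ) p := F.2.1.differentiable (by simp) p

theorem contDiff_deck (γ : Fin 4 → ℤ) : ContDiff ℝ ∞ (deck γ) := by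
  rw [show deck γ = fun q => deckLin γ q + fun i => (γ i : ℝ) from funext (deck_eq γ)]
  exact (deckLin γ).contDiff.add contDiff_const

/-- The derivation of functions given by the `i`-th vector field of the frame
`∂_t, ∂_x, ∂_y + x ∂_z, ∂_z`. -/
def D (i : Fin 4) : Fn →ₗ[ℂ] smoothFn where
  toFun F := ⟨fun p => fderiv ℝ F p (frame p (e i)), by
    refine ⟨(F.contDiff.fderiv_right (m := ∞) (by simp)).clm_apply
      (contDiff_frame.clm_apply contDiff_const), fun γ p => ?_⟩
    have h1 : (F : R4 → ℂ) ∘ deck γ = F := funext (F.2.2 γ)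
    have h2 := fderiv_comp p (F.differentiableAt (deck γ p))
      ((contDiff_deck γ).differentiable (by simp) p)
    rw [h1] at h2
    change fderiv ℝ F (deck γ p) (frame (deck γ p) (e i)) = fderiv ℝ F p (frame p (e i))
    rw [frame_deck, h2]
    rfl⟩
  map_add' F G := by
    refine Fn.ext fun p => ?_
    change fderiv ℝ ((F : R4 → ℂ) + (G : R4 → ℂ)) p _ = fderiv ℝ F p _ + fderiv ℝ G p _
    rw [fderiv_add (F.differentiableAt p) (G.differentiableAt p)]
    rfl
  map_smul' c F := by
    refine Fn.ext fun p => ?_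
    change fderiv ℝ (c • (F : R4 → ℂ)) p _ = c • fderiv ℝ F p _
    rw [fderiv_const_smul (F.differentiableAt p) c]
    rfl

theorem D_apply (i : Fin 4) (F : Fn) (p : R4) :
    D i F p = fderiv ℝ F p (frame p (e i)) := rfl

theorem frame_e (p : R4) (i : Fin 4) :
    frame p (e i) = e i + (if i = 2 then p 1 else 0) • e 3 := by
  rw [frame_apply]
  ext j
  fin_cases i <;> fin_cases j <;> simp [e]

theorem fderiv_frame_e (p w : R4) (i : Fin 4) :
    fderiv ℝ (fun q => frame q (e i)) p w = (if i = 2 then w 1 else 0) • e 3 := by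
  simp only [frame_e]
  split_ifs
  · have h : HasFDerivAt (fun q : R4 => e i + q 1 • e 3)
        ((ContinuousLinearMap.proj (R := ℝ) (φ := fun _ : Fin 4 => ℝ) 1).smulRight (e 3)) p :=
      (((ContinuousLinearMap.proj (R := ℝ) (φ := fun _ : Fin 4 => ℝ)
        1).hasFDerivAt).smul_const (e 3)).const_add (e i)
    rw [h.fderiv]
    rfl
  · simp

/-- The second derivative differs from the Hessian by the derivative of the frame itself, and only
`∂_y + x ∂_z` varies, in the direction of `∂_x`. Symmetry of the Hessian then yields the brackets.
-/
theorem D_D_apply (i j : Fin 4) (F : Fn) (p : R4) :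
    D j (D i F) p = fderiv ℝ (fderiv ℝ F) p (frame p (e j)) (frame p (e i)) +
      (if i = 2 ∧ j = 1 then D 3 F p else 0) := by
  rw [D_apply]
  have h1 : DifferentiableAt ℝ (fderiv ℝ (F : R4 → ℂ)) p :=
    (F.contDiff.fderiv_right (m := ∞) (by simp)).differentiable (by simp) p
  have h2 : DifferentiableAt ℝ (fun q => frame q (e i)) p :=
    (contDiff_frame.clm_apply contDiff_const).differentiable (by simp) p
  have h3 := fderiv_clm_apply h1 h2
  change fderiv ℝ (fun q => fderiv ℝ F q (frame q (e i))) p _ = _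
  rw [h3]
  simp only [_root_.add_apply, ContinuousLinearMap.comp_apply,
    ContinuousLinearMap.flip_apply, fderiv_frame_e, map_smul]
  rw [add_comm]
  congr 1
  have h4 : frame p (e j) 1 = if j = 1 then 1 else 0 := by
    rw [frame_apply]
    fin_cases j <;> simp [e]
  rw [h4, D_apply, frame_e]
  by_cases hi : i = 2 <;> by_cases hj : j = 1 <;> simp [hi, hj]

/-- The bracket relations of the frame. -/
theorem D_comm (i j : Fin 4) (F : Fn) :
    D j (D i F) - D i (D j F) =
      (if i = 2 ∧ j = 1 then D 3 F else 0) - (if j = 2 ∧ i = 1 then D 3 F else 0) := by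
  refine Fn.ext fun p => ?_
  have hs : IsSymmSndFDerivAt ℝ (F : R4 → ℂ) p :=
    F.contDiff.contDiffAt.isSymmSndFDerivAt
      (by rw [minSmoothness_of_isRCLikeNormedField]; exact WithTop.coe_le_coe.2 le_top)
  change D j (D i F) p - D i (D j F) p = _
  rw [D_D_apply, D_D_apply, hs.eq (frame p (e j)) (frame p (e i))]
  split_ifs <;> simp

theorem D1_D2 (F : Fn) : D 1 (D 2 F) = D 2 (D 1 F) + D 3 F := by
  have := D_comm 2 1 F
  simp only [and_self, if_true, Fin.reduceEq, if_false, sub_zero] at this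
  rw [← this]
  abel

theorem D_D_comm {i j : Fin 4} (F : Fn) (h1 : ¬(i = 2 ∧ j = 1)) (h2 : ¬(j = 2 ∧ i = 1)) :
    D j (D i F) = D i (D j F) := by
  have := D_comm i j F
  rw [if_neg h1, if_neg h2, sub_zero] at this
  exact sub_eq_zero.1 this

/-! ### Fourier components along the central directions -/

/-- The coordinate vectors `∂_t` and `∂_z`, whose flows commute with the deck transformations. -/
def IsCentral (i : Fin 4) : Prop := i = 0 ∨ i = 3

theorem deck_add_central {i : Fin 4} (hi : IsCentral i) (γ : Fin 4 → ℤ) (p : R4) (ζ : ℝ) :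
    deck γ (p + ζ • e i) = deck γ p + ζ • e i := by
  ext j
  rcases hi with rfl | rfl <;> fin_cases j <;> simp [deck, e] <;> ring

theorem frame_add_central {i : Fin 4} (hi : IsCentral i) (p : R4) (ζ : ℝ) :
    frame (p + ζ • e i) = frame p := by
  ext v j
  rw [frame_apply, frame_apply]
  rcases hi with rfl | rfl <;> fin_cases j <;> simp [e]

theorem frame_central {i : Fin 4} (hi : IsCentral i) (p : R4) : frame p (e i) = e i := by
  rcases hi with rfl | rfl <;> simp [frame_e]

theorem periodic_central {i : Fin 4} (hi : IsCentral i) (F : Fn) (p : R4) :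
    F (p + e i) = F p := by
  rw [← F.2.2 (Pi.single i 1) p]
  refine congrArg F.1 ?_
  ext j
  rcases hi with rfl | rfl <;> fin_cases j <;> simp [deck, e]

/-- The `n`-th Fourier component in a central direction. -/
def comp (i : Fin 4) (hi : IsCentral i) (n : ℤ) : Fn →ₗ[ℂ] smoothFn where
  toFun F := ⟨proj (e i) n F, contDiff_proj _ _ F.contDiff, fun γ p => by
    unfold proj
    simp only [← deck_add_central hi, F.2.2]⟩
  map_add' F G := by
    refine Fn.ext fun p => ?_
    exact proj_add _ _ F.continuous G.continuous p
  map_smul' c F := by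
    refine Fn.ext fun p => ?_
    exact proj_smul _ _ c F p

theorem comp_apply (i : Fin 4) (hi : IsCentral i) (n : ℤ) (F : Fn) (p : R4) :
    comp i hi n F p = proj (e i) n F p := rfl

/-- The frame does not change under translation in a central direction, so averaging along that
direction commutes with all frame derivatives. -/
theorem D_comp {i : Fin 4} (hi : IsCentral i) (n : ℤ) (j : Fin 4) (F : Fn) :
    D j (comp i hi n F) = comp i hi n (D j F) := by
  refine Fn.ext fun p => ?_
  change fderiv ℝ (proj (e i) n F) p _ = proj (e i) n (fun q => fderiv ℝ F q (frame q (e j))) p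
  rw [fderiv_proj _ _ F.contDiff_one]
  unfold proj
  simp only [frame_add_central hi]

theorem comp_D_self {i : Fin 4} (hi : IsCentral i) (n : ℤ) (F : Fn) :
    comp i hi n (D i F) = (2 * Real.pi * I * n : ℂ) • comp i hi n F := by
  refine Fn.ext fun p => ?_
  change proj (e i) n (fun q => fderiv ℝ F q (frame q (e i))) p = _ * proj (e i) n F p
  simp only [frame_central hi]
  exact proj_fderiv_self _ _ F.contDiff_one (periodic_central hi F) p

theorem eq_zero_of_comp_eq_zero {i : Fin 4} (hi : IsCentral i) {F : Fn}
    (h : ∀ n, comp i hi n F = 0) : F = 0 := by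
  refine Fn.ext fun p => ?_
  have := eq_zero_of_proj_eq_zero F.continuous (periodic_central hi F) (p := p)
    (fun n => by rw [← comp_apply i hi, h]; rfl) 0
  rw [zero_smul, add_zero] at this
  exact this

theorem const_of_comp_eq_zero {i : Fin 4} (hi : IsCentral i) {F : Fn}
    (h : ∀ n, n ≠ 0 → comp i hi n F = 0) (p : R4) (x : ℝ) :
    F (p + x • e i) = F p :=
  const_of_proj_eq_zero F.continuous (periodic_central hi F)
    (fun n hn => by rw [← comp_apply i hi, h n hn]; rfl) x

theorem const_of_D_eq_zero {i : Fin 4} (hi : IsCentral i) {F : Fn} (h : D i F = 0) (p : R4)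
    (x : ℝ) : F (p + x • e i) = F p := by
  refine const_of_comp_eq_zero hi (fun n hn => ?_) p x
  have h1 := comp_D_self hi n F
  rw [h, map_zero] at h1
  refine (smul_eq_zero.1 h1.symm).resolve_left ?_
  simp [Real.pi_ne_zero, hn, I_ne_zero]

end KT

end

open scoped ContDiff

noncomputable section

namespace KT

open Complex MeasureTheory intervalIntegral ComplexConjugate

/-! ### Integration over `KT⁴` -/

theorem central0 : IsCentral 0 := Or.inl rfl

theorem central3 : IsCentral 3 := Or.inr rfl

theorem proj_periodic {v w : R4} {n : ℤ} {G : R4 → ℂ} (h : ∀ p, G (p + w) = G p) (p : R4) :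
    proj v n G (p + w) = proj v n G p := by
  unfold proj
  simp only [add_right_comm p w, h]

theorem proj_zero_fun (v : R4) (n : ℤ) : proj v n (fun _ => 0) = fun _ => 0 := by
  funext p
  simp [proj]

theorem Fn.periodic_e2 (F : Fn) (p : R4) : F (p + e 2) = F p := by
  rw [← F.2.2 (Pi.single 2 1) p]
  refine congrArg F.1 ?_
  ext j
  fin_cases j <;> simp [deck, e]

/-- The deck transformation with `x₀ = 1` also shifts `z` by `y`; constancy along `∂_z` absorbs this
shift. -/
theorem Fn.periodic_e1 {F : Fn} (h : ∀ p (x : ℝ), F (p + x • e 3) = F p) (p : R4) :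
    F (p + e 1) = F p := by
  rw [← F.2.2 (Pi.single 1 1) p, ← h (p + e 1) (p 2)]
  refine congrArg F.1 ?_
  ext j
  fin_cases j <;> simp [deck, e]

/-- The part of a function that is constant along the central directions. -/
def centralAvg : Fn →ₗ[ℂ] Fn := comp 0 central0 0 ∘ₗ comp 3 central3 0

theorem centralAvg_D (i : Fin 4) (F : Fn) : centralAvg (D i F) = D i (centralAvg F) := by
  simp [centralAvg, D_comp]

theorem centralAvg_D0 (F : Fn) : centralAvg (D 0 F) = 0 := by
  rw [centralAvg, LinearMap.comp_apply, ← D_comp, comp_D_self]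
  simp

theorem centralAvg_D3 (F : Fn) : centralAvg (D 3 F) = 0 := by
  simp [centralAvg, comp_D_self]

theorem centralAvg_const (F : Fn) (p : R4) (x : ℝ) :
    centralAvg F (p + x • e 3) = centralAvg F p :=
  const_of_D_eq_zero central3 (by rw [← centralAvg_D, centralAvg_D3]) p x

/-- The integral over `KT⁴`. -/
def avg : Fn →ₗ[ℂ] ℂ where
  toFun F := proj (e 1) 0 (proj (e 2) 0 (centralAvg F)) 0
  map_add' F G := by
    have h : proj (e 2) 0 (centralAvg (F + G)) =
        proj (e 2) 0 (centralAvg F) + proj (e 2) 0 (centralAvg G) := by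
      funext p
      rw [map_add]
      exact proj_add _ _ (centralAvg F).continuous (centralAvg G).continuous p
    rw [h, proj_add _ _ (continuous_proj _ _ (centralAvg F).continuous)
      (continuous_proj _ _ (centralAvg G).continuous)]
  map_smul' c F := by
    have h : proj (e 2) 0 (centralAvg (c • F)) = c • proj (e 2) 0 (centralAvg F) := by
      funext p
      rw [map_smul]
      exact proj_smul _ _ c (centralAvg F) p
    rw [h, proj_smul]
    rfl

theorem avg_apply (F : Fn) : avg F = proj (e 1) 0 (proj (e 2) 0 (centralAvg F)) 0 := rfl

/-- Averaging over `t` and `z` kills `D 0` and `D 3`. The averaged function is constant along `z`,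
hence periodic in `x` and `y`, and on it `D 1` and `D 2` are the plain `∂_x` and `∂_y`, whose
integrals over a period vanish. -/
theorem avg_D (i : Fin 4) (F : Fn) : avg (D i F) = 0 := by
  have hz : ∀ {G : Fn}, G = 0 → proj (e 1) 0 (proj (e 2) 0 G) 0 = 0 := by
    rintro G rfl
    change proj (e 1) 0 (proj (e 2) 0 (fun _ => 0)) 0 = 0
    rw [proj_zero_fun, proj_zero_fun]
  have hp1 := Fn.periodic_e1 (centralAvg_const F)
  have hp2 := (centralAvg F).periodic_e2
  fin_cases i
  · exact hz (centralAvg_D0 F)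
  · change avg (D 1 F) = 0
    rw [avg_apply, centralAvg_D]
    have h1 : ((D 1 (centralAvg F) : Fn) : R4 → ℂ) = fun q => fderiv ℝ (centralAvg F) q (e 1) := by
      funext q
      rw [D_apply, frame_e]
      simp
    have h2 : proj (e 2) 0 (fun q => fderiv ℝ (centralAvg F) q (e 1)) =
        fun q => fderiv ℝ (proj (e 2) 0 (centralAvg F)) q (e 1) :=
      funext fun q => (fderiv_proj _ _ (centralAvg F).contDiff_one q (e 1)).symm
    rw [h1, h2, proj_fderiv_self]
    · simp
    · exact (contDiff_proj _ _ (centralAvg F).contDiff).of_le (by simp)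
    · exact proj_periodic hp1
  · change avg (D 2 F) = 0
    rw [avg_apply, centralAvg_D]
    have h3 : D 3 (centralAvg F) = 0 := by rw [← centralAvg_D, centralAvg_D3]
    have h1 : ((D 2 (centralAvg F) : Fn) : R4 → ℂ) = fun q => fderiv ℝ (centralAvg F) q (e 2) := by
      funext q
      have h4 : D 3 (centralAvg F) q = 0 := by rw [h3]; rfl
      rw [D_apply, frame_central central3] at h4
      rw [D_apply, frame_e, map_add, map_smul, h4, smul_zero, add_zero]
    have h2 : proj (e 2) 0 (fun q => fderiv ℝ (centralAvg F) q (e 2)) = fun _ => 0 := by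
      funext q
      rw [proj_fderiv_self _ _ (centralAvg F).contDiff_one hp2]
      simp
    rw [h1, h2, proj_zero_fun]
  · exact hz (centralAvg_D3 F)

/-- The function `F · conj G`. -/
def mulConj (F G : Fn) : Fn :=
  ⟨fun p => F p * conj (G p), F.contDiff.mul (conjCLE.contDiff.comp G.contDiff),
    fun γ p => by simp only [F.2.2, G.2.2]⟩

theorem mulConj_apply (F G : Fn) (p : R4) : mulConj F G p = F p * conj (G p) := rfl

theorem D_mulConj (i : Fin 4) (F G : Fn) :
    D i (mulConj F G) = mulConj (D i F) G + mulConj F (D i G) := by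
  refine Fn.ext fun p => ?_
  have h1 := (F.differentiableAt p).hasFDerivAt
  have h2 : HasFDerivAt (fun q => conj (G q))
      ((conjCLE : ℂ →L[ℝ] ℂ).comp (fderiv ℝ G p)) p :=
    (conjCLE : ℂ →L[ℝ] ℂ).hasFDerivAt.comp p (G.differentiableAt p).hasFDerivAt
  have h3 : HasFDerivAt (mulConj F G) _ p := h1.mul h2
  rw [D_apply, h3.fderiv]
  change F p * conj (fderiv ℝ G p _) + conj (G p) * fderiv ℝ F p _ =
    fderiv ℝ F p _ * conj (G p) + F p * conj (fderiv ℝ G p _)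
  ring

/-- The `L²` inner product of functions on `KT⁴`, linear in the first variable. -/
def ip (F G : Fn) : ℂ := avg (mulConj F G)

theorem ip_add_left (F G H : Fn) : ip (F + G) H = ip F H + ip G H := by
  rw [ip, ip, ip, ← map_add]
  congr 1
  exact Fn.ext fun p => add_mul (F p) (G p) _

theorem ip_smul_left (c : ℂ) (F H : Fn) : ip (c • F) H = c * ip F H := by
  rw [ip, ip, ← smul_eq_mul c, ← map_smul]
  congr 1
  exact Fn.ext fun p => mul_assoc c (F p) _

theorem ip_add_right (F G H : Fn) : ip F (G + H) = ip F G + ip F H := by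
  rw [ip, ip, ip, ← map_add]
  congr 1
  refine Fn.ext fun p => ?_
  change F p * conj (G p + H p) = F p * conj (G p) + F p * conj (H p)
  rw [map_add, mul_add]

theorem ip_smul_right (c : ℂ) (F H : Fn) : ip F (c • H) = conj c * ip F H := by
  rw [ip, ip, ← smul_eq_mul (conj c), ← map_smul]
  congr 1
  refine Fn.ext fun p => ?_
  change F p * conj (c * H p) = conj c * (F p * conj (H p))
  rw [map_mul]
  ring

theorem ip_neg_left (F H : Fn) : ip (-F) H = -ip F H := by
  rw [← neg_one_smul ℂ F, ip_smul_left, neg_one_mul]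

theorem ip_neg_right (F H : Fn) : ip F (-H) = -ip F H := by
  rw [← neg_one_smul ℂ H, ip_smul_right]
  simp

theorem ip_sub_left (F G H : Fn) : ip (F - G) H = ip F H - ip G H := by
  rw [sub_eq_add_neg, ip_add_left, ip_neg_left, sub_eq_add_neg]

theorem ip_sub_right (F G H : Fn) : ip F (G - H) = ip F G - ip F H := by
  rw [sub_eq_add_neg, ip_add_right, ip_neg_right, sub_eq_add_neg]

theorem ip_zero_left (H : Fn) : ip 0 H = 0 := by
  rw [← zero_smul ℂ (0 : Fn), ip_smul_left, zero_mul]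

/-- The frame fields are skew-adjoint. -/
theorem ip_D_left (i : Fin 4) (F G : Fn) : ip (D i F) G = -ip F (D i G) := by
  have h := avg_D i (mulConj F G)
  rw [D_mulConj, map_add] at h
  exact eq_neg_of_add_eq_zero_left h

theorem conj_proj_zero (v : R4) (F : R4 → ℂ) (p : R4) :
    conj (proj v 0 F p) = proj v 0 (fun q => conj (F q)) p := by
  unfold proj
  rw [← intervalIntegral_conj]
  simp

theorem ip_conj_symm (F G : Fn) : conj (ip F G) = ip G F := by
  have h1 : ∀ {A B : R4 → ℂ} (v : R4), (∀ q, conj (A q) = B q) →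
      ∀ q, conj (proj v 0 A q) = proj v 0 B q := by
    intro A B v h q
    rw [conj_proj_zero, funext h]
  refine h1 _ (h1 _ (h1 _ (h1 _ fun q => ?_))) 0
  simp [mulConj_apply, mul_comm]

/-! ### Positivity -/

/-- Continuous functions with nonnegative real values. -/
def IsNonneg (G : R4 → ℂ) : Prop := Continuous G ∧ ∀ p, 0 ≤ (G p).re ∧ (G p).im = 0

theorem proj_zero_eq {G : R4 → ℂ} (hG : IsNonneg G) (v p : R4) :
    proj v 0 G p = ((∫ ζ in (0 : ℝ)..1, (G (p + ζ • v)).re : ℝ) : ℂ) := by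
  rw [← intervalIntegral.integral_ofReal]
  unfold proj
  refine integral_congr fun ζ _ => ?_
  apply Complex.ext <;> simp [(hG.2 _).2]

theorem IsNonneg.proj {G : R4 → ℂ} (hG : IsNonneg G) (v : R4) : IsNonneg (proj v 0 G) := by
  refine ⟨continuous_proj v 0 hG.1, fun p => ?_⟩
  rw [proj_zero_eq hG]
  refine ⟨?_, ofReal_im _⟩
  rw [ofReal_re]
  exact integral_nonneg zero_le_one fun ζ _ => (hG.2 _).1

theorem IsNonneg.eq_zero_of_proj {G : R4 → ℂ} (hG : IsNonneg G) {v p : R4}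
    (h : KT.proj v 0 G p = 0) {ζ : ℝ} (hζ : ζ ∈ Set.Icc (0 : ℝ) 1) : G (p + ζ • v) = 0 := by
  rw [proj_zero_eq hG, ofReal_eq_zero] at h
  by_contra hne
  have hpos : 0 < (G (p + ζ • v)).re := by
    refine lt_of_le_of_ne (hG.2 _).1 fun h0 => hne ?_
    apply Complex.ext
    · simpa using h0.symm
    · simpa using (hG.2 _).2
  have hc : Continuous fun ζ : ℝ => (G (p + ζ • v)).re := by
    have := hG.1
    fun_prop
  exact (integral_pos one_pos hc.continuousOn (fun x _ => (hG.2 _).1) ⟨ζ, hζ, hpos⟩).ne' h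

theorem isNonneg_mulConj_self (F : Fn) : IsNonneg (mulConj F F) := by
  refine ⟨(mulConj F F).continuous, fun p => ?_⟩
  rw [mulConj_apply, mul_conj]
  exact ⟨by rw [ofReal_re]; exact normSq_nonneg _, ofReal_im _⟩

theorem exists_deck_mem (p : R4) : ∃ γ, ∀ i, deck γ p i ∈ Set.Icc (0 : ℝ) 1 := by
  have h : ∀ x : ℝ, x + ((-⌊x⌋ : ℤ) : ℝ) ∈ Set.Icc (0 : ℝ) 1 := by
    intro x
    have h1 := Int.floor_le x
    have h2 := (Int.lt_floor_add_one x).le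
    push_cast
    constructor <;> linarith
  -- The shift in `z` is chosen after the shear `x₀ y` caused by the shift in `x`.
  refine ⟨![-⌊p 0⌋, -⌊p 1⌋, -⌊p 2⌋, -⌊p 3 + ((-⌊p 1⌋ : ℤ) : ℝ) * p 2⌋], fun i => ?_⟩
  fin_cases i
  · exact h (p 0)
  · exact h (p 1)
  · exact h (p 2)
  · have := h (p 3 + ((-⌊p 1⌋ : ℤ) : ℝ) * p 2)
    rw [add_right_comm] at this
    exact this

theorem ip_self_im (F : Fn) : (ip F F).im = 0 :=
  ((((((isNonneg_mulConj_self F).proj (e 3)).proj (e 0)).proj (e 2)).proj (e 1)).2 0).2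

theorem ip_self_nonneg (F : Fn) : 0 ≤ (ip F F).re :=
  ((((((isNonneg_mulConj_self F).proj (e 3)).proj (e 0)).proj (e 2)).proj (e 1)).2 0).1

/-- The inner product is an iterated integral of `|F|²` over the unit cube. A continuous nonnegative
function with zero integral vanishes, one variable at a time, and the cube meets every orbit. -/
theorem eq_zero_of_ip_self {F : Fn} (h : (ip F F).re = 0) : F = 0 := by
  have h0 : ip F F = 0 := Complex.ext h (ip_self_im F)
  have n0 := isNonneg_mulConj_self F
  have n1 := n0.proj (e 3)
  have n2 := n1.proj (e 0)
  have n3 := n2.proj (e 2)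
  refine Fn.ext fun p => ?_
  obtain ⟨γ, hγ⟩ := exists_deck_mem p
  have k := n0.eq_zero_of_proj (n1.eq_zero_of_proj (n2.eq_zero_of_proj
    (n3.eq_zero_of_proj h0 (hγ 1)) (hγ 2)) (hγ 0)) (hγ 3)
  rw [mulConj_apply, mul_conj, ofReal_eq_zero, normSq_eq_zero] at k
  rw [← F.2.2 γ p]
  refine Eq.trans (congrArg F.1 ?_) k
  ext j
  fin_cases j <;> simp [e]

theorem ip_self_pos {F : Fn} (h : F ≠ 0) : 0 < (ip F F).re :=
  lt_of_le_of_ne (ip_self_nonneg F) fun h0 => h (eq_zero_of_ip_self h0.symm)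

/-! ### Characters -/

/-- The phase `2πi (l t + k x + m y)`. -/
def phase (l k m : ℤ) : R4 →L[ℝ] ℂ :=
  LinearMap.toContinuousLinearMap
    { toFun := fun v => 2 * Real.pi * I * (l * v 0 + k * v 1 + m * v 2)
      map_add' := fun u v => by simp; ring
      map_smul' := fun c v => by simp; ring }

theorem phase_apply (l k m : ℤ) (v : R4) :
    phase l k m v = 2 * Real.pi * I * (l * v 0 + k * v 1 + m * v 2) := rfl

/-- The function `exp (2πi (l t + k x + m y))`. -/
def character (l k m : ℤ) : Fn :=
  ⟨fun p => exp (phase l k m p), (phase l k m).contDiff.cexp, fun γ p => by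
    rw [exp_eq_exp_iff_exists_int]
    refine ⟨l * γ 0 + k * γ 1 + m * γ 2, ?_⟩
    rw [phase_apply, phase_apply]
    simp [deck]
    ring⟩

theorem character_apply (l k m : ℤ) (p : R4) : character l k m p = exp (phase l k m p) := rfl

theorem D_character (l k m : ℤ) (i : Fin 4) : D i (character l k m) =
    phase l k m (e i) • character l k m := by
  refine Fn.ext fun p => ?_
  have h : HasFDerivAt (character l k m) _ p := (phase l k m).hasFDerivAt.cexp
  rw [D_apply, h.fderiv]
  change exp (phase l k m p) • phase l k m (frame p (e i)) = phase l k m (e i) * _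
  have h3 : phase l k m (e 3) = 0 := by simp [phase_apply, e]
  rw [frame_e, map_add, map_smul, h3, smul_zero, add_zero, smul_eq_mul, mul_comm]
  rfl

theorem D0_character (l k m : ℤ) :
    D 0 (character l k m) = (2 * Real.pi * I * l : ℂ) • character l k m := by
  rw [D_character]; simp [phase_apply, e]

theorem D1_character (l k m : ℤ) :
    D 1 (character l k m) = (2 * Real.pi * I * k : ℂ) • character l k m := by
  rw [D_character]; simp [phase_apply, e]

theorem D2_character (l k m : ℤ) :
    D 2 (character l k m) = (2 * Real.pi * I * m : ℂ) • character l k m := by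
  rw [D_character]; simp [phase_apply, e]

theorem D3_character (l k m : ℤ) : D 3 (character l k m) = 0 := by
  rw [D_character]; simp [phase_apply, e]

theorem character_ne_zero (l k m : ℤ) : character l k m ≠ 0 := by
  intro h
  have := congrArg (fun F : Fn => F 0) h
  exact exp_ne_zero _ this

/-- Eigenfunctions of a skew-adjoint `D i` with distinct imaginary eigenvalues are orthogonal. -/
theorem ip_character_of_ne {l k m l' k' m' : ℤ} (h : (l, k, m) ≠ (l', k', m')) :
    ip (character l k m) (character l' k' m') = 0 := by
  have key : ∀ (i : Fin 4) (c c' : ℤ), c ≠ c' →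
      D i (character l k m) = (2 * Real.pi * I * c : ℂ) • character l k m →
      D i (character l' k' m') = (2 * Real.pi * I * c' : ℂ) • character l' k' m' →
      ip (character l k m) (character l' k' m') = 0 := by
    intro i c c' hc h1 h2
    have h3 := ip_D_left i (character l k m) (character l' k' m')
    rw [h1, h2, ip_smul_left, ip_smul_right] at h3
    have h4 : (2 * Real.pi * I * ((c : ℂ) - c')) * ip (character l k m) (character l' k' m') =
        0 := by
      simp only [map_mul, conj_I, conj_ofReal, map_intCast, map_ofNat] at h3
      linear_combination h3
    refine (mul_eq_zero.1 h4).resolve_left ?_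
    have : (c : ℂ) - c' ≠ 0 := sub_ne_zero.2 (by exact_mod_cast hc)
    simp [Real.pi_ne_zero, I_ne_zero, this]
  by_cases hl : l = l'
  · by_cases hk : k = k'
    · have hm : m ≠ m' := fun hm => h (by rw [hl, hk, hm])
      exact key 2 m m' hm (D2_character _ _ _) (D2_character _ _ _)
    · exact key 1 k k' hk (D1_character _ _ _) (D1_character _ _ _)
  · exact key 0 l l' hl (D0_character _ _ _) (D0_character _ _ _)

/-- A conjugate character in the integrand turns a mean value into a Fourier coefficient; used in
each direction, this rewrites `ip F (character l k m)` as an iterated Fourier coefficient. -/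
theorem proj_zero_mul_character {χ G : R4 → ℂ} {v : R4} {n : ℤ}
    (hχ : ∀ p (ζ : ℝ), χ (p + ζ • v) = exp (-(2 * Real.pi * I * n * ζ)) * χ p) :
    proj v 0 (fun p => G p * χ p) = fun p => proj v n G p * χ p := by
  funext p
  unfold proj
  rw [← intervalIntegral.integral_mul_const]
  refine integral_congr fun ζ _ => ?_
  simp only [hχ, Int.cast_zero, mul_zero, zero_mul, neg_zero, Complex.exp_zero, one_mul]
  ring

theorem conj_character_add (l k m : ℤ) (i : Fin 4) (n : ℤ)
    (h : phase l k m (e i) = 2 * Real.pi * I * n) (p : R4) (ζ : ℝ) :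
    conj (character l k m (p + ζ • e i)) =
      exp (-(2 * Real.pi * I * n * ζ)) * conj (character l k m p) := by
  rw [character_apply, character_apply, map_add, map_smul, h, exp_add, map_mul, mul_comm,
    ← exp_conj (ζ • _)]
  congr 2
  simp [conj_ofNat]
  ring

/-- A function that is constant in the direction of `∂_z` and orthogonal to all characters
vanishes. -/
theorem eq_zero_of_ip_character {F : Fn} (hF : ∀ p (x : ℝ), F (p + x • e 3) = F p)
    (h : ∀ l k m, ip F (character l k m) = 0) : F = 0 := by
  have e3 : proj (e 3) 0 F = F := by
    funext p
    simp [proj, hF]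
  have hip : ∀ l k m, proj (e 1) k (proj (e 2) m (proj (e 0) l F)) 0 = 0 := by
    intro l k m
    have h1 := h l k m
    let χ : R4 → ℂ := fun p => conj (character l k m p)
    have c3 := proj_zero_mul_character (χ := χ) (G := F) (conj_character_add l k m 3 0
      (by simp [phase_apply, e]))
    have c0 := proj_zero_mul_character (χ := χ) (G := F) (conj_character_add l k m 0 l
      (by simp [phase_apply, e]))
    have c2 := proj_zero_mul_character (χ := χ) (G := proj (e 0) l F) (conj_character_add l k m 2 m
      (by simp [phase_apply, e]))
    have c1 := proj_zero_mul_character (χ := χ) (G := proj (e 2) m (proj (e 0) l F))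
      (conj_character_add l k m 1 k (by simp [phase_apply, e]))
    rw [e3] at c3
    change proj (e 1) 0 (proj (e 2) 0 (proj (e 0) 0 (proj (e 3) 0
      (fun p => F p * conj (character l k m p))))) 0 = 0 at h1
    rw [c3, c0, c2, c1] at h1
    exact (mul_eq_zero.1 h1).resolve_right fun h2 => exp_ne_zero _ ((map_eq_zero _).1 h2)
  have hp1 := Fn.periodic_e1 hF
  have hp2 := F.periodic_e2
  have hp0 := periodic_central central0 F
  refine Fn.ext fun p => ?_
  -- The iterated coefficients are removed from the outside inwards, by uniqueness of Fourier series
  -- in `x`, in `y` and in `t`.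
  have q1 : ∀ l m (x : ℝ), proj (e 2) m (proj (e 0) l F) (0 + x • e 1) = 0 := fun l m x =>
    eq_zero_of_proj_eq_zero (continuous_proj _ _ (continuous_proj _ _ F.continuous))
      (proj_periodic (proj_periodic hp1)) (fun k => hip l k m) x
  have q2 : ∀ l (x y : ℝ), proj (e 0) l F (0 + x • e 1 + y • e 2) = 0 := fun l x y =>
    eq_zero_of_proj_eq_zero (continuous_proj _ _ F.continuous)
      (proj_periodic hp2) (fun m => q1 l m x) y
  have q3 := eq_zero_of_proj_eq_zero F.continuous hp0 (fun l => q2 l (p 1) (p 2)) (p 0)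
  rw [← hF _ (p 3)] at q3
  refine Eq.trans (congrArg F.1 ?_) q3
  ext j
  fin_cases j <;> simp [e]

end KT

end

open scoped ContDiff

noncomputable section

namespace KT

open Complex ComplexConjugate

/-! ### The first order system -/

/-- The derivation along `ρ ∂_t + (∂_y + x ∂_z) - (a / b) ∂_z`. -/
def E2 (a b ρ : ℝ) : Fn →ₗ[ℂ] Fn := (ρ : ℂ) • D 0 + D 2 - (a / b : ℂ) • D 3

/-- The derivation along `ρ ∂_x - (1 / b) ∂_z`. -/
def E3 (b ρ : ℝ) : Fn →ₗ[ℂ] Fn := (ρ : ℂ) • D 1 - (1 / b : ℂ) • D 3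

/-- The vector field dual to `ψ₁`. -/
def W1 : Fn →ₗ[ℂ] Fn := (1 / 2 : ℂ) • (D 0 - I • D 1)

/-- The conjugate of `W1`. -/
def W1bar : Fn →ₗ[ℂ] Fn := (1 / 2 : ℂ) • (D 0 + I • D 1)

/-- The vector field dual to `ψ₂`. -/
def W2 (a b ρ : ℝ) : Fn →ₗ[ℂ] Fn := (1 / 2 : ℂ) • (E2 a b ρ - I • E3 b ρ)

/-- The conjugate of `W2`. -/
def W2bar (a b ρ : ℝ) : Fn →ₗ[ℂ] Fn := (1 / 2 : ℂ) • (E2 a b ρ + I • E3 b ρ)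

/-- The divergence: `-2 divOp f g` is `∂̄*` of `f ψ̄₁ + g ψ̄₂`. -/
def divOp (a b ρ : ℝ) : Fn × Fn →ₗ[ℂ] Fn := W1.coprod (W2 a b ρ)

/-- The curl: the coefficient of `∂̄ (f ψ̄₁ + g ψ̄₂)` with respect to `ψ̄₁ ∧ ψ̄₂`. -/
def curlOp (a b ρ : ℝ) : Fn × Fn →ₗ[ℂ] Fn :=
  (-(W2bar a b ρ + (ρ * b / 4 : ℂ) • LinearMap.id)).coprod (W1bar + (b / 4 : ℂ) • LinearMap.id)

theorem divOp_apply (a b ρ : ℝ) (f g : Fn) : divOp a b ρ (f, g) = W1 f + W2 a b ρ g := rfl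

theorem curlOp_apply (a b ρ : ℝ) (f g : Fn) : curlOp a b ρ (f, g) =
    -(W2bar a b ρ f + (ρ * b / 4 : ℂ) • f) + (W1bar g + (b / 4 : ℂ) • g) := rfl

theorem W1_apply (f : Fn) : W1 f = (1 / 2 : ℂ) • (D 0 f - I • D 1 f) := rfl

theorem W1bar_apply (f : Fn) : W1bar f = (1 / 2 : ℂ) • (D 0 f + I • D 1 f) := rfl

theorem W2_apply (a b ρ : ℝ) (f : Fn) : W2 a b ρ f = (1 / 2 : ℂ) •
    (((ρ : ℂ) • D 0 f + D 2 f - (a / b : ℂ) • D 3 f) -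
      I • ((ρ : ℂ) • D 1 f - (1 / b : ℂ) • D 3 f)) := rfl

theorem W2bar_apply (a b ρ : ℝ) (f : Fn) : W2bar a b ρ f = (1 / 2 : ℂ) •
    (((ρ : ℂ) • D 0 f + D 2 f - (a / b : ℂ) • D 3 f) +
      I • ((ρ : ℂ) • D 1 f - (1 / b : ℂ) • D 3 f)) := rfl

theorem ip_W1bar (F G : Fn) : ip (W1bar F) G = -ip F (W1 G) := by
  simp only [W1bar_apply, W1_apply, ip_smul_left, ip_smul_right, ip_add_left, ip_sub_right,
    ip_D_left, map_div₀, map_one, conj_I, map_ofNat]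
  ring

theorem ip_W1 (F G : Fn) : ip (W1 F) G = -ip F (W1bar G) := by
  simp only [W1bar_apply, W1_apply, ip_smul_left, ip_smul_right, ip_add_right, ip_sub_left,
    ip_D_left, map_div₀, map_one, conj_I, map_ofNat]
  ring

theorem ip_W2bar (a b ρ : ℝ) (F G : Fn) : ip (W2bar a b ρ F) G = -ip F (W2 a b ρ G) := by
  simp only [W2bar_apply, W2_apply, ip_smul_left, ip_smul_right, ip_add_left, ip_sub_left,
    ip_add_right, ip_sub_right, ip_D_left, map_div₀, map_one, conj_I, map_ofNat, conj_ofReal]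
  ring

theorem ip_W2 (a b ρ : ℝ) (F G : Fn) : ip (W2 a b ρ F) G = -ip F (W2bar a b ρ G) := by
  simp only [W2bar_apply, W2_apply, ip_smul_left, ip_smul_right, ip_add_left, ip_sub_left,
    ip_add_right, ip_sub_right, ip_D_left, map_div₀, map_one, conj_I, map_ofNat, conj_ofReal]
  ring

/-- The second order system implies the first order system, by integration by parts. -/
theorem div_curl_eq_zero {a b ρ : ℝ} {f g u w : Fn}
    (hu : u = (-2 : ℂ) • divOp a b ρ (f, g)) (hw : w = curlOp a b ρ (f, g))
    (h1 : W1bar u + (2 : ℂ) • (W2 a b ρ w - (ρ * b / 4 : ℂ) • w) = 0)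
    (h2 : W2bar a b ρ u + (2 : ℂ) • (-W1 w + (b / 4 : ℂ) • w) = 0) :
    divOp a b ρ (f, g) = 0 ∧ curlOp a b ρ (f, g) = 0 := by
  have e1 : ip (W1bar u + (2 : ℂ) • (W2 a b ρ w - (ρ * b / 4 : ℂ) • w)) f = 0 := by
    rw [h1, ip_zero_left]
  have e2 : ip (W2bar a b ρ u + (2 : ℂ) • (-W1 w + (b / 4 : ℂ) • w)) g = 0 := by
    rw [h2, ip_zero_left]
  have e3 : ip u u = -2 * (ip u (W1 f) + ip u (W2 a b ρ g)) := by
    nth_rw 2 [hu]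
    rw [ip_smul_right, divOp_apply, ip_add_right, map_neg, map_ofNat]
  have e4 : ip w w = -(ip w (W2bar a b ρ f) + (ρ * b / 4 : ℂ) * ip w f) +
      (ip w (W1bar g) + (b / 4 : ℂ) * ip w g) := by
    nth_rw 2 [hw]
    rw [curlOp_apply]
    simp only [ip_add_right, ip_neg_right, ip_smul_right, map_div₀, map_mul, conj_ofReal,
      map_ofNat]
  simp only [ip_add_left, ip_smul_left, ip_sub_left, ip_neg_left, ip_W1, ip_W1bar, ip_W2,
    ip_W2bar] at e1 e2
  -- The two equations are paired with `f` and `g` and added. Moving the derivatives to the right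
  -- reassembles the divergence against `u` and the curl against `w`, giving `‖u‖² + 4 ‖w‖² = 0`.
  have e5 : ip u u + 4 * ip w w = 0 := by linear_combination e3 + 4 * e4 + 2 * e1 + 2 * e2
  have e6 := congrArg re e5
  have hu0 := ip_self_nonneg u
  have hw0 := ip_self_nonneg w
  simp at e6
  have hu1 := eq_zero_of_ip_self (F := u) (by linarith)
  have hw1 := eq_zero_of_ip_self (F := w) (by linarith)
  refine ⟨?_, hw ▸ hw1⟩
  rw [hu1] at hu
  exact (smul_eq_zero.1 hu.symm).resolve_left (by norm_num)

/-- The space of solutions of the first order system. -/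
def solSpace (a b ρ : ℝ) : Submodule ℂ (Fn × Fn) :=
  LinearMap.ker (divOp a b ρ) ⊓ LinearMap.ker (curlOp a b ρ)

theorem mem_solSpace {a b ρ : ℝ} {x : Fn × Fn} :
    x ∈ solSpace a b ρ ↔ divOp a b ρ x = 0 ∧ curlOp a b ρ x = 0 := Iff.rfl

theorem comp_mem_solSpace {a b ρ : ℝ} {f g : Fn} (h : (f, g) ∈ solSpace a b ρ) {i : Fin 4}
    (hi : IsCentral i) (n : ℤ) : (comp i hi n f, comp i hi n g) ∈ solSpace a b ρ := by
  rw [mem_solSpace, divOp_apply, curlOp_apply] at h ⊢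
  have h1 := congrArg (comp i hi n) h.1
  have h2 := congrArg (comp i hi n) h.2
  simp only [W1_apply, W2_apply, W1bar_apply, W2bar_apply, map_add, map_sub, map_smul, map_neg,
    map_zero, D_comp] at h1 h2 ⊢
  exact ⟨h1, h2⟩

/-! ### Ladder operators -/

/-- The operator `i s D₁ - D₂ + c`. -/
def ladder (s : ℝ) (c : ℂ) : Fn →ₗ[ℂ] Fn := (I * s) • D 1 - D 2 + c • LinearMap.id

theorem ladder_apply (s : ℝ) (c : ℂ) (u : Fn) :
    ladder s c u = (I * s) • D 1 u - D 2 u + c • u := rfl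

theorem D3_ladder {s : ℝ} {c z : ℂ} {u : Fn} (h : D 3 u = z • u) :
    D 3 (ladder s c u) = z • ladder s c u := by
  have h1 : D 3 (D 1 u) = z • D 1 u := by
    rw [D_D_comm u (by decide) (by decide), h, map_smul]
  have h2 : D 3 (D 2 u) = z • D 2 u := by
    rw [D_D_comm u (by decide) (by decide), h, map_smul]
  simp only [ladder_apply, map_add, map_sub, map_smul, h, h1, h2]
  module

/-- The commutator is `2 i s [D 1, D 2] = 2 i s D 3`, a scalar on an eigenspace of `D 3`: the
canonical commutation relation. -/
theorem ladder_comm {s : ℝ} {c c' z : ℂ} {u : Fn} (h : D 3 u = z • u) :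
    ladder (-s) c' (ladder s c u) = ladder s c (ladder (-s) c' u) + (2 * I * s * z) • u := by
  simp only [ladder_apply, map_add, map_sub, map_smul, D1_D2, h]
  push_cast
  module

theorem ip_ladder (s : ℝ) (c c' : ℂ) (v u : Fn) :
    ip (ladder (-s) c' v) u = -ip v (ladder s c u) + (conj c + c') * ip v u := by
  simp only [ladder_apply, ip_add_left, ip_sub_left, ip_smul_left, ip_add_right, ip_sub_right,
    ip_smul_right, ip_D_left, map_mul, conj_I, conj_ofReal]
  push_cast
  ring

/-- Up to constants `ladder (-s) c'` is minus the adjoint of `ladder s c`. With `v = ladder s c u`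
and `d = conj c + c'` the left side is `-‖v‖² + Re (d ⟨v, u⟩)`, and completing the square bounds it.
So the eigenvalues of the product are bounded above. -/
theorem ip_ladder_ladder_le (s : ℝ) (c c' : ℂ) (u : Fn) :
    (ip (ladder (-s) c' (ladder s c u)) u).re ≤ normSq (conj c + c') / 4 * (ip u u).re := by
  rw [ip_ladder s c c']
  set v := ladder s c u
  set d := conj c + c'
  have h := ip_self_nonneg (v - (conj d / 2) • u)
  have e1 : ip (v - (conj d / 2) • u) (v - (conj d / 2) • u) =
      ip v v - d / 2 * ip v u - conj d / 2 * conj (ip v u) + d * conj d / 4 * ip u u := by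
    simp only [ip_sub_left, ip_sub_right, ip_smul_left, ip_smul_right, map_div₀, conj_conj,
      map_ofNat, ip_conj_symm]
    ring
  have e2 : d / 2 * ip v u + conj d / 2 * conj (ip v u) = ((d * ip v u).re : ℂ) := by
    have := re_eq_add_conj (d * ip v u)
    rw [this, map_mul]
    ring
  have e3 : d * conj d / 4 * ip u u = ((normSq d / 4 : ℝ) : ℂ) * ip u u := by
    rw [mul_conj]
    push_cast
    ring
  have e4 : ip (v - (conj d / 2) • u) (v - (conj d / 2) • u) =
      ip v v - ((d * ip v u).re : ℂ) + ((normSq d / 4 : ℝ) : ℂ) * ip u u := by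
    rw [e1, ← e2, e3]
    ring
  rw [e4, add_re, sub_re, ofReal_re, re_ofReal_mul] at h
  rw [add_re, neg_re]
  linarith

/-- Applying `ladder s c` raises the eigenvalue by `d`. As eigenvalues are bounded above, some step
must give the zero function, and that happens only when the current eigenvalue `lam + k d` is 0. -/
theorem ladder_eigenvalue {s : ℝ} {c c' z lam : ℂ} {d : ℝ} (hd : 0 < d) (hz : 2 * I * s * z = d)
    {F : Fn} (hF : F ≠ 0) (h3 : D 3 F = z • F)
    (h : ladder (-s) c' (ladder s c F) = lam • F) : ∃ k : ℕ, lam = -(k * d) := by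
  by_contra! hne
  have key : ∀ k : ℕ, ∃ G : Fn, G ≠ 0 ∧ D 3 G = z • G ∧
      ladder (-s) c' (ladder s c G) = (lam + k * d) • G := by
    intro k
    induction k with
    | zero => exact ⟨F, hF, h3, by simpa using h⟩
    | succ k ih =>
      obtain ⟨G, hG, hG3, hGe⟩ := ih
      refine ⟨ladder s c G, ?_, D3_ladder hG3, ?_⟩
      · intro h0
        rw [h0, map_zero] at hGe
        have := (smul_eq_zero.1 hGe.symm).resolve_right hG
        exact hne k (by linear_combination this)
      · rw [ladder_comm (D3_ladder hG3), hGe, map_smul, hz]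
        push_cast
        module
  obtain ⟨k, hk⟩ := exists_nat_gt ((normSq (conj c + c') / 4 - lam.re) / d)
  obtain ⟨G, hG, -, hGe⟩ := key k
  have h1 := ip_ladder_ladder_le s c c' G
  rw [hGe, ip_smul_left, mul_re, ip_self_im, mul_zero, sub_zero] at h1
  have h2 := le_of_mul_le_mul_right h1 (ip_self_pos hG)
  rw [div_lt_iff₀ hd] at hk
  simp only [add_re, mul_re, natCast_re, ofReal_re, natCast_im, ofReal_im, mul_zero, sub_zero]
    at h2
  linarith

/-- A nonzero solution of the first order system with frequency `n ≠ 0` in the direction of `∂_z`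
and frequency `l` in the direction of `∂_t` is an eigenfunction of a harmonic oscillator. -/
theorem exists_ladder_eigenvalue {a b ρ s : ℝ} (hb : b ≠ 0) (hs : s ^ 2 = 1 + ρ ^ 2)
    (hs0 : 0 < s) {l n : ℤ} (hn : n ≠ 0) {f g : Fn} (hsol : (f, g) ∈ solSpace a b ρ)
    (f0 : D 0 f = (2 * Real.pi * I * l : ℂ) • f) (g0 : D 0 g = (2 * Real.pi * I * l : ℂ) • g)
    (f3 : D 3 f = (2 * Real.pi * I * n : ℂ) • f) (g3 : D 3 g = (2 * Real.pi * I * n : ℂ) • g)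
    (hne : ¬(f = 0 ∧ g = 0)) :
    ∃ k : ℕ, (2 * Real.pi * n / b / s : ℂ) ^ 2 - (2 * Real.pi * I * l + b / 4) ^ 2 =
      -(k * ((4 * Real.pi * s * |n| : ℝ) : ℂ)) := by
  have hbC : (b : ℂ) ≠ 0 := by exact_mod_cast hb
  have hsC : (s : ℂ) ≠ 0 := by exact_mod_cast hs0.ne'
  have hs2 : (s : ℂ) ^ 2 = 1 + (ρ : ℂ) ^ 2 := by exact_mod_cast hs
  obtain ⟨h1, h2⟩ := mem_solSpace.1 hsol
  rw [divOp_apply, W1_apply, W2_apply, f0, g0, g3] at h1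
  rw [curlOp_apply, W1bar_apply, W2bar_apply, f0, g0, f3] at h2
  set σ : ℂ := 2 * Real.pi * I * l + b / 4 with hσ
  set τ : ℂ := 2 * Real.pi * I * l with hτ
  set z : ℂ := 2 * Real.pi * I * n with hz
  set κ : ℂ := I * z / b / s with hκ
  have hκ' : I * z / b = κ * s := by rw [hκ]; field_simp
  have hlam : (2 * Real.pi * n / b / s : ℂ) ^ 2 = κ ^ 2 := by
    rw [hκ, hz]
    have : I * (2 * Real.pi * I * n) / b / s = -(2 * Real.pi * n / b / s : ℂ) := by
      linear_combination (2 * Real.pi * n / b / s : ℂ) * I_sq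
    rw [this, neg_sq]
  set c : ℂ := s * b / 4 + a / b * z - ρ * σ - κ * ρ with hc
  set c' : ℂ := -(s * b / 4) + a / b * z - ρ * σ + κ * ρ with hc'
  set F : Fn := f + ((s : ℂ) + ρ) • g with hF
  set G : Fn := f + ((ρ : ℂ) - s) • g with hG
  have hI : I * I = -1 := I_mul_I
  have eF : ladder s c F = (((s : ℂ) + ρ) * (σ - κ)) • G := by
    rw [ladder_apply, hF, hG, hc, hσ]
    simp only [map_add, map_smul]
    linear_combination (norm := module) (2 : ℂ) • h2 - (2 * ((s : ℂ) + ρ)) • h1 + hs2 • (I • D 1 g) +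
      hs2 • ((τ + b / 2) • g) - hκ' • f + (((s : ℂ) + ρ) * hκ') • g
  have eG : ladder (-s) c' G = (((ρ : ℂ) - s) * (σ + κ)) • F := by
    rw [ladder_apply, hF, hG, hc', hσ]
    simp only [map_add, map_smul]
    push_cast
    linear_combination (norm := module) (2 : ℂ) • h2 - (2 * ((ρ : ℂ) - s)) • h1 + hs2 • (I • D 1 g) +
      hs2 • ((τ + b / 2) • g) - hκ' • f + (((ρ : ℂ) - s) * hκ') • g
  have F3 : D 3 F = z • F := by
    rw [hF, map_add, map_smul, f3, g3]
    module
  have G3 : D 3 G = z • G := by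
    rw [hG, map_add, map_smul, f3, g3]
    module
  have hlamFG : (((s : ℂ) + ρ) * (σ - κ)) * (((ρ : ℂ) - s) * (σ + κ)) = κ ^ 2 - σ ^ 2 := by
    linear_combination (κ ^ 2 - σ ^ 2) * hs2
  have eFF : ladder (-s) c' (ladder s c F) = (κ ^ 2 - σ ^ 2) • F := by
    rw [eF, map_smul, eG, smul_smul, hlamFG]
  have eGG : ladder s c (ladder (-s) c' G) = (κ ^ 2 - σ ^ 2) • G := by
    rw [eG, map_smul, eF, smul_smul, mul_comm, hlamFG]
  rw [hlam]
  have hFG : ¬(F = 0 ∧ G = 0) := by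
    rintro ⟨hF0, hG0⟩
    have hg : g = 0 := by
      have : (2 * (s : ℂ)) • g = 0 := by
        have e : (2 * (s : ℂ)) • g = F - G := by rw [hF, hG]; module
        rw [e, hF0, hG0, sub_zero]
      exact (smul_eq_zero.1 this).resolve_left (by simpa using hsC)
    refine hne ⟨?_, hg⟩
    rw [hF, hg, smul_zero, add_zero] at hF0
    exact hF0
  -- If one of `F`, `G` vanishes, a ladder relation forces one of the two coefficients to be 0,
  -- hence their product `κ² - σ²`, and `k = 0` works.
  by_cases hF0 : F = 0
  · have hG0 : G ≠ 0 := fun h => hFG ⟨hF0, h⟩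
    rw [hF0, map_zero] at eF
    have := (smul_eq_zero.1 eF.symm).resolve_right hG0
    exact ⟨0, by rw [← hlamFG, this]; simp⟩
  by_cases hG0 : G = 0
  · rw [hG0, map_zero] at eG
    have := (smul_eq_zero.1 eG.symm).resolve_right hF0
    exact ⟨0, by rw [← hlamFG, this]; simp⟩
  have hpi := Real.pi_pos
  -- The step `2 i s z = -4π s n` must be positive: for `n < 0` the ladder starts from `F`, for `n >
  -- 0` from `G` with `-s` in place of `s`.
  rcases lt_or_gt_of_ne hn with hneg | hpos
  · have hn0 : (0 : ℝ) < |n| := by exact_mod_cast abs_pos.2 hn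
    refine ladder_eigenvalue (s := s) (by positivity) ?_ hF0 F3 eFF
    rw [abs_of_neg hneg, hz]
    push_cast
    linear_combination (4 * s * Real.pi * n : ℂ) * hI
  · have hn0 : (0 : ℝ) < |n| := by exact_mod_cast abs_pos.2 hn
    refine ladder_eigenvalue (s := -s) (c := c') (c' := c) (by positivity) ?_ hG0 G3
      (by rw [neg_neg]; exact eGG)
    rw [abs_of_pos hpos, hz]
    push_cast
    linear_combination -(4 * s * Real.pi * n : ℂ) * hI

end KT

end

open scoped ContDiff

noncomputable section

namespace KT

open Complex ComplexConjugate

/-! ### Vanishing of the modes with nonzero frequency in the direction of `∂_z` -/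

/-- Multiplying by `s²` and squaring removes `|n|` and leaves only even powers of `s`; with `s² = 1
+ r²π²` this is a polynomial relation for `π` over ℚ. Its constant term is `(n² / 4β²)² ≠ 0`, so the
polynomial is nonzero, against the transcendence of `π`. -/
theorem oscillator_ne {r β : ℚ} (hβ : β ≠ 0) {n : ℤ} (hn : n ≠ 0) (k : ℕ) {s : ℝ}
    (hs : s ^ 2 = 1 + (r * Real.pi) ^ 2) (hs0 : 0 < s) :
    (n / (2 * β) / s : ℝ) ^ 2 - (Real.pi * β) ^ 2 ≠ -(k * (4 * Real.pi * s * |n|)) := by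
  intro h
  have hβR : (β : ℝ) ≠ 0 := by exact_mod_cast hβ
  let p : Polynomial ℚ := (Polynomial.C ((n : ℚ) ^ 2 / (4 * β ^ 2)) -
      Polynomial.C (β ^ 2) * Polynomial.X ^ 2 *
        (1 + Polynomial.C (r ^ 2) * Polynomial.X ^ 2)) ^ 2 -
    Polynomial.C (16 * (n : ℚ) ^ 2 * k ^ 2) * Polynomial.X ^ 2 *
      (1 + Polynomial.C (r ^ 2) * Polynomial.X ^ 2) ^ 3
  have hp : Polynomial.aeval Real.pi p = 0 := by
    have h1 : (n : ℝ) ^ 2 / (4 * β ^ 2) - β ^ 2 * Real.pi ^ 2 * s ^ 2 =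
        -(4 * Real.pi * k * |n| * s ^ 3) := by
      have h2 : (n / (2 * β) / s : ℝ) ^ 2 = (n : ℝ) ^ 2 / (4 * β ^ 2) / s ^ 2 := by
        rw [div_pow, div_pow]
        ring
      rw [h2] at h
      field_simp at h
      field_simp
      linear_combination h
    have habs : (|n| : ℝ) ^ 2 = (n : ℝ) ^ 2 := sq_abs _
    have h3 : ((n : ℝ) ^ 2 / (4 * β ^ 2) - β ^ 2 * Real.pi ^ 2 * s ^ 2) ^ 2 =
        16 * n ^ 2 * k ^ 2 * Real.pi ^ 2 * (s ^ 2) ^ 3 := by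
      rw [h1]
      push_cast at habs ⊢
      linear_combination (16 * Real.pi ^ 2 * k ^ 2 * s ^ 6) * habs
    rw [hs] at h3
    simp only [p, map_sub, map_mul, map_pow, map_add, map_one, Polynomial.aeval_X,
      Polynomial.aeval_C, map_div₀, map_intCast, map_ofNat, map_natCast, eq_ratCast]
    linear_combination h3
  have hp0 : p = 0 := by
    by_contra hne
    exact PiTranscendence.transcendental_pi ⟨p, hne, hp⟩
  have h0 : p.eval 0 = ((n : ℚ) ^ 2 / (4 * β ^ 2)) ^ 2 := by
    simp [p]
  rw [hp0, Polynomial.eval_zero] at h0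
  have hnQ : (n : ℚ) ≠ 0 := by exact_mod_cast hn
  have : ((n : ℚ) ^ 2 / (4 * β ^ 2)) ^ 2 ≠ 0 := by positivity
  exact this h0.symm

theorem mode_eq_zero {a : ℝ} {r β : ℚ} (hβ : β ≠ 0) {b ρ : ℝ} (hb : b = 4 * Real.pi * β)
    (hρ : ρ = r * Real.pi) {l n : ℤ} (hn : n ≠ 0) {f g : Fn} (hsol : (f, g) ∈ solSpace a b ρ)
    (f0 : D 0 f = (2 * Real.pi * I * l : ℂ) • f) (g0 : D 0 g = (2 * Real.pi * I * l : ℂ) • g)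
    (f3 : D 3 f = (2 * Real.pi * I * n : ℂ) • f) (g3 : D 3 g = (2 * Real.pi * I * n : ℂ) • g) :
    f = 0 ∧ g = 0 := by
  by_contra hne
  have hβR : (β : ℝ) ≠ 0 := by exact_mod_cast hβ
  have hpi := Real.pi_pos
  have hb0 : b ≠ 0 := by
    rw [hb]
    positivity
  have hs : (Real.sqrt (1 + ρ ^ 2)) ^ 2 = 1 + ρ ^ 2 := Real.sq_sqrt (by positivity)
  have hs0 : 0 < Real.sqrt (1 + ρ ^ 2) := Real.sqrt_pos.2 (by positivity)
  set s := Real.sqrt (1 + ρ ^ 2)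
  obtain ⟨k, hk⟩ := exists_ladder_eigenvalue hb0 hs hs0 hn hsol f0 g0 f3 g3 hne
  have e1 : (2 * Real.pi * n / b / s : ℂ) = ((2 * Real.pi * n / b / s : ℝ) : ℂ) := by
    push_cast; rfl
  have e2 : (2 * Real.pi * I * l + b / 4 : ℂ) ^ 2 =
      (((b / 4) ^ 2 - (2 * Real.pi * l) ^ 2 : ℝ) : ℂ) + ((Real.pi * l * b : ℝ) : ℂ) * I := by
    push_cast
    linear_combination (4 * Real.pi ^ 2 * l ^ 2 : ℂ) * I_sq
  rw [e1, e2] at hk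
  have him := congrArg im hk
  have hre := congrArg re hk
  rw [← ofReal_natCast, ← ofReal_mul, ← ofReal_neg, ← ofReal_pow, sub_im, add_im, ofReal_im,
    ofReal_im, ofReal_im, im_ofReal_mul, I_im] at him
  rw [← ofReal_natCast, ← ofReal_mul, ← ofReal_neg, ← ofReal_pow, sub_re, add_re, ofReal_re,
    ofReal_re, ofReal_re, re_ofReal_mul, I_re] at hre
  -- The imaginary part of the eigenvalue equation is `-π l b = 0`.
  have hl : (l : ℝ) = 0 := by
    have : Real.pi * l * b = 0 := by linarith
    simpa [hpi.ne', hb0] using this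
  refine oscillator_ne hβ hn k (by rw [← hρ]; exact hs) hs0 ?_
  rw [hl] at hre
  have e3 : (n / (2 * β) / s : ℝ) = 2 * Real.pi * n / b / s := by
    rw [hb]
    field_simp
    ring
  have e4 : Real.pi * β = b / 4 := by rw [hb]; ring
  rw [e3, e4]
  push_cast at hre ⊢
  linarith

theorem const_of_mem_solSpace {a : ℝ} {r β : ℚ} (hβ : β ≠ 0) {b ρ : ℝ}
    (hb : b = 4 * Real.pi * β) (hρ : ρ = r * Real.pi) {f g : Fn}
    (hsol : (f, g) ∈ solSpace a b ρ) (n : ℤ) (hn : n ≠ 0) :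
    comp 3 central3 n f = 0 ∧ comp 3 central3 n g = 0 := by
  have key : ∀ l : ℤ, comp 0 central0 l (comp 3 central3 n f) = 0 ∧
      comp 0 central0 l (comp 3 central3 n g) = 0 := by
    intro l
    refine mode_eq_zero hβ hb hρ (l := l) hn
      (comp_mem_solSpace (comp_mem_solSpace hsol central3 n) central0 l) ?_ ?_ ?_ ?_
    · rw [D_comp, comp_D_self]
    · rw [D_comp, comp_D_self]
    · rw [D_comp, D_comp, comp_D_self, map_smul]
    · rw [D_comp, D_comp, comp_D_self, map_smul]
  exact ⟨eq_zero_of_comp_eq_zero central0 fun l => (key l).1,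
    eq_zero_of_comp_eq_zero central0 fun l => (key l).2⟩

theorem D3_eq_zero {F : Fn} (h : ∀ n, n ≠ 0 → comp 3 central3 n F = 0) : D 3 F = 0 := by
  refine eq_zero_of_comp_eq_zero central3 fun n => ?_
  rw [comp_D_self]
  rcases eq_or_ne n 0 with rfl | hn
  · simp
  · rw [h n hn, smul_zero]

/-! ### The dimension of the solution space -/

/-- The frequencies of the solutions of the first order system. -/
abbrev freq (β ρ : ℝ) : Type := {q : ℤ × ℤ × ℤ // (q.1 : ℝ) * (1 + ρ ^ 2) + q.2.2 * ρ = 0 ∧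
  β * q.2.1 * (1 + ρ ^ 2) = ((q.2.1 : ℝ) ^ 2 + (q.1 : ℝ) ^ 2) * (1 + ρ ^ 2) +
    2 * q.2.2 * q.1 * ρ + (q.2.2 : ℝ) ^ 2}

theorem ip_D_character {i : Fin 4} {l k m c : ℤ} (F : Fn)
    (h : D i (character l k m) = (2 * Real.pi * I * c : ℂ) • character l k m) :
    ip (D i F) (character l k m) = 2 * Real.pi * I * c * ip F (character l k m) := by
  rw [ip_D_left, h, ip_smul_right]
  simp only [map_mul, conj_I, conj_ofReal, map_intCast, map_ofNat]
  ring

/-- The first order system for the Fourier coefficients. -/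
theorem coeff_eq {a b ρ β : ℝ} (hb : b = 4 * Real.pi * β) {f g : Fn}
    (hsol : (f, g) ∈ solSpace a b ρ) (hf : D 3 f = 0) (hg : D 3 g = 0) (l k m : ℤ) :
    ((k : ℂ) + I * l) * ip f (character l k m) +
        (ρ * (k + I * l) + I * m) * ip g (character l k m) = 0 ∧
      (β - k + I * l : ℂ) * ip g (character l k m) =
        (ρ * (β - k + I * l) + I * m) * ip f (character l k m) := by
  obtain ⟨h1, h2⟩ := mem_solSpace.1 hsol
  rw [divOp_apply, W1_apply, W2_apply, hg] at h1
  rw [curlOp_apply, W1bar_apply, W2bar_apply, hf] at h2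
  have i1 := congrArg (fun F => ip F (character l k m)) h1
  have i2 := congrArg (fun F => ip F (character l k m)) h2
  simp only [ip_add_left, ip_sub_left, ip_smul_left, ip_neg_left, ip_zero_left,
    ip_D_character _ (D0_character l k m), ip_D_character _ (D1_character l k m),
    ip_D_character _ (D2_character l k m)] at i1 i2
  have hpi : (Real.pi : ℂ) ≠ 0 := by exact_mod_cast Real.pi_ne_zero
  rw [hb] at i2
  push_cast at i2
  constructor
  · apply mul_left_cancel₀ hpi
    linear_combination i1 + (Real.pi * k * ip f (character l k m) +
      Real.pi * ρ * k * ip g (character l k m)) * I_sq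
  · apply mul_left_cancel₀ hpi
    linear_combination i2 + (Real.pi * ρ * k * ip f (character l k m) -
      Real.pi * k * ip g (character l k m)) * I_sq

/-- The coefficient of the second component is obtained by solving the curl equation; the divergence
equation then holds because the determinant vanishes at the frequencies in `freq β ρ`. -/
theorem char_mem_solSpace {a b ρ β : ℝ} (hb : b = 4 * Real.pi * β) (q : freq β ρ)
    (hne : (β - q.1.2.1 + I * q.1.1 : ℂ) ≠ 0) :
    (character q.1.1 q.1.2.1 q.1.2.2,
      (ρ + I * q.1.2.2 / (β - q.1.2.1 + I * q.1.1) : ℂ) • character q.1.1 q.1.2.1 q.1.2.2) ∈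
        solSpace a b ρ := by
  obtain ⟨⟨l, k, m⟩, h1, h2⟩ := q
  simp only at h1 h2 hne ⊢
  have h1' : (l : ℂ) * (1 + ρ ^ 2) + m * ρ = 0 := by exact_mod_cast h1
  have h2' : (β : ℂ) * k * (1 + ρ ^ 2) = ((k : ℂ) ^ 2 + (l : ℂ) ^ 2) * (1 + ρ ^ 2) +
    2 * m * l * ρ + (m : ℂ) ^ 2 := by exact_mod_cast h2
  rw [mem_solSpace, divOp_apply, curlOp_apply, W1_apply, W2_apply, W1bar_apply, W2bar_apply]
  simp only [map_smul, D0_character, D1_character, D2_character, D3_character, smul_zero, sub_zero]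
  set χ := character l k m
  set δ : ℂ := β - k + I * l with hδ
  rw [hb]
  have hI := I_sq
  constructor
  · have hx : (ρ + I * m / δ) * δ = ρ * δ + I * m := by rw [add_mul, div_mul_cancel₀ _ hne]
    have e : (k + I * l) + (ρ * (k + I * l) + I * m) * (ρ + I * m / δ) = 0 := by
      refine (mul_eq_zero.1 (?_ : _ * δ = 0)).resolve_right hne
      linear_combination (ρ * (k + I * l) + I * m) * hx +
        ((k + I * l) + (ρ * (k + I * l) + I * m) * ρ) * hδ + h2' + I * β * h1' +
        ((l : ℂ) ^ 2 * (1 + ρ ^ 2) + 2 * m * ρ * l + m ^ 2) * hI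
    linear_combination (norm := module) ((Real.pi : ℂ) * e -
      (Real.pi * k * (1 + ρ * (ρ + I * m / δ))) * hI) • χ
  · have e : δ * (ρ + I * m / δ) - (ρ * δ + I * m) = 0 := by
      rw [mul_add, mul_div_cancel₀ _ hne]
      ring
    rw [hδ] at e ⊢
    push_cast
    linear_combination (norm := module) ((Real.pi : ℂ) * e +
      (Real.pi * k * ((ρ + I * m / (β - k + I * l)) - ρ)) * hI) • χ

/-- The Fourier coefficients of the first component of a solution. -/
def coeffMap (a b ρ β : ℝ) : solSpace a b ρ →ₗ[ℂ] (freq β ρ → ℂ) where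
  toFun x q := ip x.1.1 (character q.1.1 q.1.2.1 q.1.2.2)
  map_add' x y := by
    funext q
    exact ip_add_left _ _ _
  map_smul' c x := by
    funext q
    exact ip_smul_left _ _ _

/-- Solutions are constant along `z`, hence determined by their coefficients at the characters.
Since `β` is not an integer, `β - k + i l` never vanishes, so the coefficients of `f` determine
those of `g`; off the frequencies of `freq β ρ` the determinant makes both vanish. -/
theorem coeffMap_bijective {a : ℝ} {r β : ℚ} (hβ : β ≠ 0) (hint : ∀ k : ℤ, β ≠ k) {b ρ : ℝ}
    (hb : b = 4 * Real.pi * β) (hρ : ρ = r * Real.pi) [Finite (freq β ρ)] :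
    Function.Bijective (coeffMap a b ρ β) := by
  classical
  have hne : ∀ k l : ℤ, (((β : ℝ) : ℂ) - k + I * l) ≠ 0 := by
    intro k l h
    have := congrArg re h
    simp only [add_re, sub_re, ofReal_re, intCast_re, mul_re, I_re, I_im, intCast_im, zero_mul,
      mul_zero, sub_zero, add_zero, zero_re] at this
    refine hint k ?_
    have h2 : ((β : ℝ)) = ((k : ℚ) : ℝ) := by push_cast; linarith
    exact_mod_cast h2
  constructor
  · intro x x' hx
    have h0 : coeffMap a b ρ β (x - x') = 0 := by
      funext q
      exact (ip_sub_left _ _ _).trans (sub_eq_zero.2 (congrFun hx q))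
    rw [← sub_eq_zero]
    generalize x - x' = x₀ at h0
    obtain ⟨⟨f, g⟩, hsol⟩ := x₀
    have hc := const_of_mem_solSpace hβ hb hρ hsol
    have hf3 := D3_eq_zero fun n hn => (hc n hn).1
    have hg3 := D3_eq_zero fun n hn => (hc n hn).2
    have hcoef := coeff_eq hb hsol hf3 hg3
    have hfz : ∀ l k m, ip f (character l k m) = 0 := by
      intro l k m
      by_contra hfne
      obtain ⟨c1, c2⟩ := hcoef l k m
      have hdet : ((k : ℂ) + I * l) * ((β : ℝ) - k + I * l) +
          (ρ * (k + I * l) + I * m) * (ρ * ((β : ℝ) - k + I * l) + I * m) = 0 := by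
        refine (mul_eq_zero.1 (?_ : _ * ip f (character l k m) = 0)).resolve_right hfne
        linear_combination ((β : ℝ) - k + I * l : ℂ) * c1 - (ρ * (k + I * l) + I * m) * c2
      -- The real and imaginary parts of the determinant are the two conditions that define `freq β
      -- ρ`, the imaginary one up to the factor `β ≠ 0`.
      have hdet2 : (((β : ℝ) * k * (1 + ρ ^ 2) - (((k : ℝ) ^ 2 + (l : ℝ) ^ 2) * (1 + ρ ^ 2) +
          2 * m * l * ρ + (m : ℝ) ^ 2) : ℝ) : ℂ) +
          (((β : ℝ) * ((l : ℝ) * (1 + ρ ^ 2) + m * ρ) : ℝ) : ℂ) * I = 0 := by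
        push_cast at hdet ⊢
        linear_combination hdet - ((l : ℂ) ^ 2 * (1 + ρ ^ 2) + 2 * m * ρ * l + m ^ 2) * I_sq
      have hre := congrArg re hdet2
      have him := congrArg im hdet2
      rw [add_re, ofReal_re, re_ofReal_mul, I_re, mul_zero, add_zero, zero_re] at hre
      rw [add_im, ofReal_im, im_ofReal_mul, I_im, mul_one, zero_add, zero_im] at him
      have hβR : (β : ℝ) ≠ 0 := by exact_mod_cast hβ
      have hl := (mul_eq_zero.1 him).resolve_left hβR
      exact hfne (congrFun h0 ⟨(l, k, m), hl, sub_eq_zero.1 hre⟩)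
    have hgz : ∀ l k m, ip g (character l k m) = 0 := by
      intro l k m
      have h2 := (hcoef l k m).2
      rw [hfz, mul_zero] at h2
      exact (mul_eq_zero.1 h2).resolve_left (hne k l)
    have e1 := eq_zero_of_ip_character (const_of_D_eq_zero central3 hf3) hfz
    have e2 := eq_zero_of_ip_character (const_of_D_eq_zero central3 hg3) hgz
    exact Subtype.ext (Prod.ext e1 e2)
  · intro y
    have := Fintype.ofFinite (freq β ρ)
    let v : freq β ρ → solSpace a b ρ := fun q => ⟨_, char_mem_solSpace hb q (hne _ _)⟩
    have hv : ∀ q q', coeffMap a b ρ β (v q) q' =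
        if q = q' then ip (character q.1.1 q.1.2.1 q.1.2.2) (character q.1.1 q.1.2.1 q.1.2.2)
        else 0 := by
      intro q q'
      change ip (character q.1.1 q.1.2.1 q.1.2.2) (character q'.1.1 q'.1.2.1 q'.1.2.2) = _
      split_ifs with h
      · rw [h]
      · refine ip_character_of_ne fun h2 => h (Subtype.ext ?_)
        exact h2
    have hpos : ∀ q : freq β ρ,
        ip (character q.1.1 q.1.2.1 q.1.2.2) (character q.1.1 q.1.2.1 q.1.2.2) ≠ 0 := by
      intro q h
      have := ip_self_pos (character_ne_zero q.1.1 q.1.2.1 q.1.2.2)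
      rw [h] at this
      simp at this
    refine ⟨∑ q, (y q / ip (character q.1.1 q.1.2.1 q.1.2.2)
      (character q.1.1 q.1.2.1 q.1.2.2)) • v q, ?_⟩
    funext q'
    rw [map_sum, Finset.sum_apply, Finset.sum_eq_single q']
    · rw [map_smul, Pi.smul_apply, hv, if_pos rfl, smul_eq_mul, div_mul_cancel₀ _ (hpos q')]
    · intro q _ hq
      rw [map_smul, Pi.smul_apply, hv, if_neg hq, smul_zero]
    · simp

/-! ### The frequencies -/

/-- The rational number `b / 4π = 2 · 5^N / 3`. -/
def betaOf (N : ℕ) : ℚ := 2 * 5 ^ N / 3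

theorem betaOf_ne_zero (N : ℕ) : betaOf N ≠ 0 := by
  unfold betaOf
  positivity

theorem betaOf_ne_int (N : ℕ) (k : ℤ) : betaOf N ≠ k := by
  intro h
  unfold betaOf at h
  rw [div_eq_iff (by norm_num)] at h
  have h2 : (2 * 5 ^ N : ℤ) = k * 3 := by exact_mod_cast h
  have h3 : (3 : ℤ) ∣ 2 * 5 ^ N := ⟨k, by rw [h2]; ring⟩
  have hp : Prime (3 : ℤ) := Int.prime_three
  rcases hp.dvd_or_dvd h3 with h4 | h4
  · norm_num at h4
  · have := hp.dvd_of_dvd_pow h4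
    norm_num at this

/-- For `ρ = 0` the frequencies are the lattice points on a circle. -/
def freqZeroEquiv (N : ℕ) : freq (betaOf N : ℚ) 0 ≃ GaussianCount.circle N where
  toFun q := ⟨(q.1.2.1, q.1.2.2), by
    obtain ⟨⟨l, k, m⟩, h1, h2⟩ := q
    simp only at h1 h2 ⊢
    have hl : (l : ℝ) = 0 := by simpa using h1
    rw [hl, betaOf] at h2
    push_cast at h2
    have h3 : (3 * ((k : ℝ) ^ 2 + (m : ℝ) ^ 2)) = 2 * 5 ^ N * k := by linarith
    exact_mod_cast h3⟩
  invFun q := ⟨(0, q.1.1, q.1.2), by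
    obtain ⟨⟨k, m⟩, h⟩ := q
    simp only at h ⊢
    have h3 : (3 * ((k : ℝ) ^ 2 + (m : ℝ) ^ 2)) = 2 * 5 ^ N * k := by exact_mod_cast h
    refine ⟨by simp, ?_⟩
    rw [betaOf]
    push_cast
    linarith⟩
  left_inv q := by
    obtain ⟨⟨l, k, m⟩, h1, h2⟩ := q
    have hl : (l : ℝ) = 0 := by simpa using h1
    have hl' : l = 0 := by exact_mod_cast hl
    simp [hl']
  right_inv q := rfl

/-- For a nonzero rational multiple `ρ` of `π` there is only the frequency `0`. -/
theorem freq_eq_zero {N : ℕ} {r : ℚ} (hr : r ≠ 0)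
    (q : freq (betaOf N : ℚ) (r * Real.pi)) : q.1 = (0, 0, 0) := by
  obtain ⟨⟨l, k, m⟩, h1, h2⟩ := q
  simp only at h1 h2 ⊢
  -- The first frequency condition with `ρ = rπ`, read as a polynomial in `π`; it must vanish
  -- identically.
  let p : Polynomial ℚ := Polynomial.C (l * r ^ 2) * Polynomial.X ^ 2 +
    Polynomial.C (m * r) * Polynomial.X + Polynomial.C (l : ℚ)
  have hp : p = 0 := by
    by_contra hne
    refine PiTranscendence.transcendental_pi ⟨p, hne, ?_⟩
    simp only [p, map_mul, map_pow, map_add, Polynomial.aeval_X, Polynomial.aeval_C,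
      map_intCast, eq_ratCast]
    linear_combination h1
  have hl : l = 0 := by
    have := congrArg (Polynomial.eval 0) hp
    simp [p] at this
    exact this
  have hm : m = 0 := by
    have := congrArg (Polynomial.eval 1) hp
    simp [p, hl, hr] at this
    exact this
  subst hl hm
  have hpos : (1 + (r * Real.pi) ^ 2 : ℝ) ≠ 0 := by positivity
  have h3 : (k : ℝ) * ((betaOf N : ℚ) - k : ℝ) = 0 := by
    apply mul_left_cancel₀ hpos
    push_cast at h2
    linear_combination h2
  have hk : k = 0 := by
    rcases mul_eq_zero.1 h3 with h4 | h4
    · exact_mod_cast h4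
    · exact absurd (by exact_mod_cast sub_eq_zero.1 h4) (betaOf_ne_int N k)
  rw [hk]

end KT

end

open scoped ContDiff

noncomputable section

namespace KT

open Complex ComplexConjugate

/-! ### The Hodge star in an orthonormal frame -/

theorem contract_eq {m k : ℕ} (w : Fin k → R4) (η : Alt (m + k)) (v : Fin m → R4) :
    contract k w η v = η (fun i => Fin.append w v (Fin.cast (add_comm m k) i)) := by
  induction k with
  | zero =>
    change η v = _
    congr 1
    funext i
    have : Fin.cast (add_comm m 0) i = Fin.natAdd 0 i := by
      ext
      simp
    rw [this, Fin.append_right]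
  | succ k ih =>
    change contract k (fun l => w l.succ) (η.curryLeft (w 0)) v = _
    rw [ih, ContinuousAlternatingMap.curryLeft_apply_apply]
    congr 1
    funext i
    refine Fin.cases ?_ (fun j => ?_) i
    · have : Fin.cast (add_comm m (k + 1)) 0 = Fin.castAdd m (0 : Fin (k + 1)) := by
        ext
        simp
      rw [this, Fin.append_left]
      rfl
    · rw [Matrix.cons_val_succ]
      obtain ⟨j', rfl⟩ := (finCongr (add_comm k m)).surjective j
      refine Fin.addCases (fun l => ?_) (fun l => ?_) j'
      · have e1 : Fin.cast (add_comm m k) (finCongr (add_comm k m) (Fin.castAdd m l)) =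
            Fin.castAdd m l := rfl
        have e2 : Fin.cast (add_comm m (k + 1))
            (Fin.succ (finCongr (add_comm k m) (Fin.castAdd m l))) = Fin.castAdd m l.succ := rfl
        rw [e1, e2, Fin.append_left, Fin.append_left]
      · have e1 : Fin.cast (add_comm m k) (finCongr (add_comm k m) (Fin.natAdd k l)) =
            Fin.natAdd k l := rfl
        have e2 : Fin.cast (add_comm m (k + 1))
            (Fin.succ (finCongr (add_comm k m) (Fin.natAdd k l))) = Fin.natAdd (k + 1) l := by
          ext
          simp
          omega
        rw [e1, e2, Fin.append_right, Fin.append_right]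

theorem sum_cons {k : ℕ} (B : (Fin (k + 1) → Fin 4) → ℂ) :
    ∑ c, B c = ∑ i, ∑ c', B (Fin.cons i c') := by
  rw [← Fintype.sum_prod_type', ← (Fin.consEquiv fun _ => Fin 4).sum_comp]
  rfl

theorem contract_add {m k : ℕ} (w : Fin k → R4) (η η' : Alt (m + k)) (v : Fin m → R4) :
    contract k w (η + η') v = contract k w η v + contract k w η' v := by
  rw [contract_eq, contract_eq, contract_eq]
  rfl

theorem contract_eq_sum {m k : ℕ} (w : Fin k → R4) (η : Alt (m + k)) (v : Fin m → R4) :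
    contract k w η v = ∑ j : Fin k → Fin 4, ((∏ l, w l (j l) : ℝ) : ℂ) *
      contract k (fun l => e (j l)) η v := by
  induction k with
  | zero =>
    simp [contract]
  | succ k ih =>
    rw [sum_cons]
    have h1 : contract (k + 1) w η v =
        ∑ i, (w 0 i : ℂ) * contract k (fun l => w l.succ) (η.curryLeft (e i)) v := by
      change contract k (fun l => w l.succ) (η.curryLeft (w 0)) v = _
      have hw : w 0 = ∑ i, w 0 i • e i := pi_eq_sum_univ' (w 0)
      let L : R4 →ₗ[ℝ] ℂ :=
        { toFun := fun u => contract k (fun l => w l.succ) (η.curryLeft u) v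
          map_add' := fun u u' => by rw [map_add, contract_add]
          map_smul' := fun c u => by
            rw [map_smul, contract_eq, contract_eq]
            rfl }
      change L (w 0) = ∑ i, (w 0 i : ℂ) * L (e i)
      conv_lhs => rw [hw, map_sum]
      refine Finset.sum_congr rfl fun i _ => ?_
      rw [map_smul, Complex.real_smul]
    rw [h1]
    refine Finset.sum_congr rfl fun i _ => ?_
    rw [ih, Finset.mul_sum]
    refine Finset.sum_congr rfl fun c' _ => ?_
    rw [Fin.prod_univ_succ]
    simp only [Fin.cons_zero, Fin.cons_succ]
    push_cast
    rw [mul_assoc]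
    rfl

/-- The hypothesis says that `ε` is orthonormal. Substituting it for each inverse metric coefficient
and using multilinearity replaces coordinate vectors by frame vectors. -/
theorem hodgeStar_eq_sum_frame {g : R4 →L[ℝ] R4 →L[ℝ] ℝ} {ε : Fin 4 → R4}
    (hε : ∀ i j, (gram g)⁻¹ i j = ∑ n, ε n i * ε n j) (k m : ℕ) (h : 4 = m + k) (α : Alt k)
    (v : Fin m → R4) :
    hodgeStar g k m h α v = ((Real.sqrt (gram g).det / (k.factorial : ℝ) : ℝ) : ℂ) *
      ∑ c : Fin k → Fin 4, α (fun l => ε (c l)) *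
        contract k (fun l => ε (c l)) (h ▸ det4 : Alt (m + k)) v := by
  rw [hodgeStar_apply]
  congr 1
  have h1 : ∀ i j : Fin k → Fin 4, ((∏ l, (gram g)⁻¹ (i l) (j l) : ℝ) : ℂ) =
      ∑ c : Fin k → Fin 4, ((∏ l, ε (c l) (i l) : ℝ) : ℂ) * ((∏ l, ε (c l) (j l) : ℝ) : ℂ) := by
    intro i j
    simp only [hε, Finset.prod_univ_sum, Fintype.piFinset_univ]
    push_cast
    simp only [Finset.prod_mul_distrib]
  simp only [h1]
  have h2 : ∀ c : Fin k → Fin 4, α (fun l => ε (c l)) *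
      contract k (fun l => ε (c l)) (h ▸ det4 : Alt (m + k)) v =
      ∑ i : Fin k → Fin 4, ∑ j : Fin k → Fin 4,
        ((((∏ l, ε (c l) (i l) : ℝ) : ℂ) * ((∏ l, ε (c l) (j l) : ℝ) : ℂ)) *
          α (fun l => e (i l))) * contract k (fun l => e (j l)) (h ▸ det4 : Alt (m + k)) v := by
    intro c
    rw [apply_eq_sum α, contract_eq_sum, Finset.sum_mul_sum]
    refine Finset.sum_congr rfl fun i _ => Finset.sum_congr rfl fun j _ => ?_
    ring
  simp only [h2, Finset.sum_mul]
  symm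
  rw [Finset.sum_comm]
  refine Finset.sum_congr rfl fun i _ => ?_
  rw [Finset.sum_comm]

/-- Only injective index tuples avoiding `d` contribute; these are the `k!` rearrangements of `c₀`,
all with the same value. This cancels the factor `1 / k!` of the Hodge star. -/
theorem sum_alternating {k m : ℕ} {c₀ : Fin k → Fin 4} {d : Fin m → Fin 4}
    (hc₀ : Function.Injective c₀) (hcov : ∀ i, i ∈ Set.range c₀ ∨ i ∈ Set.range d)
    (B : (Fin k → Fin 4) → ℂ) (hperm : ∀ c (σ : Equiv.Perm (Fin k)), B (c ∘ σ) = B c)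
    (hinj : ∀ c, ¬ Function.Injective c → B c = 0) (hd : ∀ c i j, c i = d j → B c = 0) :
    ∑ c, B c = (k.factorial : ℂ) * B c₀ := by
  classical
  have h1 : ∑ c ∈ Finset.univ.image (fun σ : Equiv.Perm (Fin k) => c₀ ∘ σ), B c = ∑ c, B c := by
    refine Finset.sum_subset (Finset.subset_univ _) fun c _ hc => ?_
    by_contra hB
    have hci : Function.Injective c := by
      by_contra h
      exact hB (hinj c h)
    have hr : ∀ i, ∃ j, c₀ j = c i := by
      intro i
      rcases hcov (c i) with h | ⟨j, hj⟩
      · exact h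
      · exact absurd (hd c i j hj.symm) hB
    choose τ hτ using hr
    have hτi : Function.Injective τ := fun i j hij => hci (by rw [← hτ, ← hτ, hij])
    refine hc (Finset.mem_image.2 ⟨Equiv.ofBijective τ (Finite.injective_iff_bijective.1 hτi),
      Finset.mem_univ _, funext hτ⟩)
  rw [← h1, Finset.sum_image]
  · simp only [hperm, Finset.sum_const, Finset.card_univ, Fintype.card_perm, Fintype.card_fin,
      nsmul_eq_mul]
  · intro σ _ τ _ h
    ext i
    exact congrArg Fin.val (hc₀ (congrFun h i))

/-- The position of the arguments of `contract`. -/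
def slotEquiv (k m : ℕ) : Fin k ⊕ Fin m ≃ Fin (m + k) :=
  finSumFinEquiv.trans (finCongr (add_comm k m))

theorem contract_eq_elim {m k : ℕ} (w : Fin k → R4) (η : Alt (m + k)) (v : Fin m → R4) :
    contract k w η v = η (Sum.elim w v ∘ (slotEquiv k m).symm) := by
  rw [contract_eq]
  congr 1
  funext i
  obtain ⟨j, rfl⟩ := (slotEquiv k m).surjective i
  rw [Function.comp_apply, Equiv.symm_apply_apply]
  rcases j with j | j
  · exact Fin.append_left w v j
  · exact Fin.append_right w v j

theorem contract_perm {m k : ℕ} (w : Fin k → R4) (η : Alt (m + k)) (v : Fin m → R4)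
    (σ : Equiv.Perm (Fin k)) :
    contract k (w ∘ σ) η v = Equiv.Perm.sign σ • contract k w η v := by
  rw [contract_eq_elim, contract_eq_elim]
  have h := η.toAlternatingMap.map_perm (Sum.elim w v ∘ (slotEquiv k m).symm)
    ((slotEquiv k m).permCongr (Equiv.sumCongr σ 1))
  have h2 : Equiv.Perm.sign ((slotEquiv k m).permCongr (Equiv.sumCongr σ 1)) =
      Equiv.Perm.sign σ := by
    rw [Equiv.Perm.sign_permCongr]
    exact (Equiv.Perm.sign_sumCongr σ 1).trans (by simp)
  rw [h2] at h
  refine Eq.trans (congrArg η ?_) h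
  funext i
  obtain ⟨j, rfl⟩ := (slotEquiv k m).surjective i
  rcases j with j | j <;> simp [Equiv.permCongr_apply]

theorem hodgeStar_frame {g : R4 →L[ℝ] R4 →L[ℝ] ℝ} {ε : Fin 4 → R4}
    (hε : ∀ i j, (gram g)⁻¹ i j = ∑ n, ε n i * ε n j) (k m : ℕ) (h : 4 = m + k) (α : Alt k)
    (c₀ : Fin k → Fin 4) (d : Fin m → Fin 4)
    (hc₀ : Function.Injective c₀) (hcov : ∀ i, i ∈ Set.range c₀ ∨ i ∈ Set.range d) :
    hodgeStar g k m h α (ε ∘ d) = (Real.sqrt (gram g).det : ℂ) * (α (ε ∘ c₀) *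
      contract k (ε ∘ c₀) (h ▸ det4 : Alt (m + k)) (ε ∘ d)) := by
  rw [hodgeStar_eq_sum_frame hε]
  have hs := sum_alternating hc₀ hcov (fun c => α (ε ∘ c) *
      contract k (ε ∘ c) (h ▸ det4 : Alt (m + k)) (ε ∘ d)) ?_ ?_ ?_
  · change _ * ∑ c : Fin k → Fin 4, α (ε ∘ c) * contract k (ε ∘ c) (h ▸ det4 : Alt (m + k)) (ε ∘ d)
      = _
    rw [hs]
    push_cast
    have : (k.factorial : ℂ) ≠ 0 := by exact_mod_cast k.factorial_ne_zero
    field_simp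
  · intro c σ
    have h1 := α.toAlternatingMap.map_perm (ε ∘ c) σ
    have h2 := contract_perm (ε ∘ c) (h ▸ det4 : Alt (m + k)) (ε ∘ d) σ
    change α (ε ∘ c ∘ σ) = Equiv.Perm.sign σ • α (ε ∘ c) at h1
    change contract k (ε ∘ c ∘ σ) _ _ = _ at h2
    change α (ε ∘ c ∘ σ) * contract k (ε ∘ c ∘ σ) _ _ = _
    rw [h1, h2, smul_mul_smul_comm, Int.units_mul_self, one_smul]
  · intro c hc
    have : ¬ Function.Injective (ε ∘ c) := fun h' => hc h'.of_comp
    have h1 := α.toAlternatingMap.map_eq_zero_of_not_injective _ this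
    change α (ε ∘ c) = 0 at h1
    change α (ε ∘ c) * _ = 0
    rw [h1, zero_mul]
  · intro c i j hij
    change _ * contract k (ε ∘ c) (h ▸ det4 : Alt (m + k)) (ε ∘ d) = 0
    rw [contract_eq_elim]
    refine mul_eq_zero_of_right _ ((h ▸ det4 : Alt (m + k)).map_eq_zero_of_eq _
      (i := slotEquiv k m (Sum.inl i)) (j := slotEquiv k m (Sum.inr j)) ?_ ?_)
    · simp [hij]
    · simp

/-! ### Components by type -/

/-- The character sum in the decomposition into types. -/
def typeCoeff (k p : ℕ) (T : Finset (Fin k)) : ℤ :=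
  ∑ S ∈ Finset.powersetCard p Finset.univ, (-1) ^ (S ∩ T).card

/-- For a fixed set `T` of arguments that receive `J`, the sets `S` differ only by the sign `(-1) ^
|S ∩ T|`; summing these signs gives weights that `decide` evaluates in each degree. -/
theorem typeProj_eq (J : R4 →L[ℝ] R4) {k : ℕ} (p : ℕ) (α : Alt k) (v : Fin k → R4) :
    typeProj J p α v = (1 / 2) ^ k * ∑ T : Finset (Fin k),
      (typeCoeff k p T : ℂ) * (I ^ T.card * α (fun l => if l ∈ T then J (v l) else v l)) := by
  rw [typeProj_apply, Finset.sum_comm, Finset.mul_sum]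
  refine Finset.sum_congr rfl fun T _ => ?_
  rw [typeCoeff]
  push_cast
  rw [Finset.sum_mul, Finset.mul_sum]
  refine Finset.sum_congr rfl fun S _ => ?_
  have h := α.toMultilinearMap.map_smul_univ
    (fun l => (1 / 2 : ℝ) * (if l ∈ S ∩ T then -1 else 1))
    (fun l => if l ∈ T then J (v l) else v l)
  have h2 : (fun l => slot J S T l (v l)) = fun l =>
      ((1 / 2 : ℝ) * (if l ∈ S ∩ T then -1 else 1)) • (if l ∈ T then J (v l) else v l) := by
    funext l
    by_cases hT : l ∈ T <;> by_cases hS : l ∈ S <;> simp [slot, hT, hS]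
  have h3 : ∏ l, ((1 / 2 : ℝ) * (if l ∈ S ∩ T then -1 else 1)) =
      (1 / 2) ^ k * (-1) ^ (S ∩ T).card := by
    rw [Finset.prod_mul_distrib, Finset.prod_const, Finset.card_univ, Fintype.card_fin,
      Finset.prod_ite_mem, Finset.univ_inter, Finset.prod_const]
  rw [h3, ← h2] at h
  change α (fun l => slot J S T l (v l)) = _ • α (fun l => if l ∈ T then J (v l) else v l) at h
  rw [h, Complex.real_smul]
  push_cast
  ring

end KT

end

open scoped ContDiff

noncomputable section

namespace KT

open Complex ComplexConjugate

/-! ### Components by type of forms of low degree -/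

theorem typeProj_one (J : R4 →L[ℝ] R4) (α : Alt 1) (u : R4) :
    typeProj J 0 α ![u] = (1 / 2) * (α ![u] + I * α ![J u]) := by
  rw [typeProj_eq]
  have hu : (Finset.univ : Finset (Finset (Fin 1))) = {∅, {0}} := by decide
  have hc : ∀ T : Finset (Fin 1), typeCoeff 1 0 T = 1 := by decide
  have h0 : (fun l : Fin 1 => if l ∈ (∅ : Finset (Fin 1)) then J (![u] l) else ![u] l) = ![u] := by
    ext l : 1; fin_cases l; simp
  have h1 : (fun l : Fin 1 => if l ∈ ({0} : Finset (Fin 1)) then J (![u] l) else ![u] l) =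
      ![J u] := by
    ext l : 1; fin_cases l; simp
  simp only [hc]
  rw [hu, Finset.sum_pair (by decide), h0, h1]
  simp

theorem typeProj_two (J : R4 →L[ℝ] R4) (α : Alt 2) (u v : R4) :
    typeProj J 0 α ![u, v] =
      (1 / 4) * (α ![u, v] + I * α ![J u, v] + I * α ![u, J v] - α ![J u, J v]) := by
  rw [typeProj_eq]
  have hu : (Finset.univ : Finset (Finset (Fin 2))) = {∅, {0}, {1}, {0, 1}} := by decide
  have hc : ∀ T : Finset (Fin 2), typeCoeff 2 0 T = 1 := by decide
  have key : ∀ T : Finset (Fin 2), (fun l => if l ∈ T then J (![u, v] l) else ![u, v] l) =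
      ![if 0 ∈ T then J u else u, if 1 ∈ T then J v else v] := by
    intro T
    ext l : 1
    fin_cases l <;> simp
  simp only [hc, key]
  rw [hu, Finset.sum_insert (by decide), Finset.sum_insert (by decide),
    Finset.sum_insert (by decide), Finset.sum_singleton]
  simp
  ring

theorem typeProj_three (J : R4 →L[ℝ] R4) (α : Alt 3) (u v w : R4) :
    typeProj J 1 α ![u, v, w] =
      (1 / 8) * (3 * α ![u, v, w] + I * (α ![J u, v, w] + α ![u, J v, w] + α ![u, v, J w]) +
        (α ![J u, J v, w] + α ![J u, v, J w] + α ![u, J v, J w]) +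
        3 * I * α ![J u, J v, J w]) := by
  rw [typeProj_eq]
  have hu : (Finset.univ : Finset (Finset (Fin 3))) =
      {∅, {0}, {1}, {2}, {0, 1}, {0, 2}, {1, 2}, {0, 1, 2}} := by decide
  have hc : ∀ T : Finset (Fin 3), typeCoeff 3 1 T = 3 - 2 * T.card := by decide
  have key : ∀ T : Finset (Fin 3),
      (fun l => if l ∈ T then J (![u, v, w] l) else ![u, v, w] l) =
      ![if 0 ∈ T then J u else u, if 1 ∈ T then J v else v, if 2 ∈ T then J w else w] := by
    intro T
    ext l : 1
    fin_cases l <;> simp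
  simp only [hc, key]
  rw [hu, Finset.sum_insert (by decide), Finset.sum_insert (by decide),
    Finset.sum_insert (by decide), Finset.sum_insert (by decide), Finset.sum_insert (by decide),
    Finset.sum_insert (by decide), Finset.sum_insert (by decide), Finset.sum_singleton]
  have c2 : ∀ i j : Fin 3, i ≠ j → ({i, j} : Finset (Fin 3)).card = 2 := by decide
  have c3 : ({0, 1, 2} : Finset (Fin 3)).card = 3 := by decide
  rw [c2 0 1 (by decide), c2 0 2 (by decide), c2 1 2 (by decide), c3]
  simp
  ring

theorem typeCoeff_four (T : Finset (Fin 4)) :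
    typeCoeff 4 2 T = if T.card = 0 ∨ T.card = 4 then 6 else if T.card = 2 then -2 else 0 := by
  revert T
  decide

/-- The relations `J ε₀ = ε₁`, `J ε₂ = ε₃` of a frame adapted to `J`. -/
structure IsAdapted (J : R4 →L[ℝ] R4) (ε : Fin 4 → R4) : Prop where
  zero : J (ε 0) = ε 1
  one : J (ε 1) = -ε 0
  two : J (ε 2) = ε 3
  three : J (ε 3) = -ε 2

theorem alt_two_neg_left (α : Alt 2) (u v : R4) : α ![-u, v] = -α ![u, v] := by
  have h := α.toMultilinearMap.map_smul_univ ![-1, 1] ![u, v]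
  have h' : (fun i => (![-1, 1] : Fin 2 → ℝ) i • ![u, v] i) = ![-u, v] := by
    ext l : 1; fin_cases l <;> simp
  rw [h'] at h
  simpa [Fin.prod_univ_two] using h

theorem alt_two_swap (α : Alt 2) (u v : R4) : α ![v, u] = -α ![u, v] := by
  have h := α.toAlternatingMap.map_swap ![u, v] (i := 0) (j := 1) (by decide)
  have h' : ![u, v] ∘ Equiv.swap (0 : Fin 2) 1 = ![v, u] := by
    ext l : 1; fin_cases l <;> rfl
  rwa [h'] at h

theorem alt_two_self (α : Alt 2) (u : R4) : α ![u, u] = 0 :=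
  α.map_eq_zero_of_eq _ (i := 0) (j := 1) rfl (by decide)

theorem alt_three_smul (α : Alt 3) (x y z : ℝ) (u v w : R4) :
    α ![x • u, y • v, z • w] = ((x * y * z : ℝ) : ℂ) * α ![u, v, w] := by
  have h := α.toMultilinearMap.map_smul_univ ![x, y, z] ![u, v, w]
  have h' : (fun i => ![x, y, z] i • ![u, v, w] i) = ![x • u, y • v, z • w] := by
    ext l : 1; fin_cases l <;> simp
  rw [h', Complex.real_smul, Fin.prod_univ_three] at h
  exact h

theorem alt_three_neg₀ (α : Alt 3) (u v w : R4) : α ![-u, v, w] = -α ![u, v, w] := by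
  have := alt_three_smul α (-1) 1 1 u v w
  simpa using this

theorem alt_three_neg₁ (α : Alt 3) (u v w : R4) : α ![u, -v, w] = -α ![u, v, w] := by
  have := alt_three_smul α 1 (-1) 1 u v w
  simpa using this

theorem alt_three_neg₂ (α : Alt 3) (u v w : R4) : α ![u, v, -w] = -α ![u, v, w] := by
  have := alt_three_smul α 1 1 (-1) u v w
  simpa using this

theorem alt_three_swap₀₁ (α : Alt 3) (u v w : R4) : α ![v, u, w] = -α ![u, v, w] := by
  have h := α.toAlternatingMap.map_swap ![u, v, w] (i := 0) (j := 1) (by decide)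
  have h' : ![u, v, w] ∘ Equiv.swap (0 : Fin 3) 1 = ![v, u, w] := by
    ext l : 1; fin_cases l <;> rfl
  rwa [h'] at h

theorem alt_three_swap₁₂ (α : Alt 3) (u v w : R4) : α ![u, w, v] = -α ![u, v, w] := by
  have h := α.toAlternatingMap.map_swap ![u, v, w] (i := 1) (j := 2) (by decide)
  have h' : ![u, v, w] ∘ Equiv.swap (1 : Fin 3) 2 = ![u, w, v] := by
    ext l : 1; fin_cases l <;> rfl
  rwa [h'] at h

theorem alt_three_self₀₁ (α : Alt 3) (u w : R4) : α ![u, u, w] = 0 :=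
  α.map_eq_zero_of_eq _ (i := 0) (j := 1) rfl (by decide)

theorem alt_three_self₁₂ (α : Alt 3) (u w : R4) : α ![w, u, u] = 0 :=
  α.map_eq_zero_of_eq _ (i := 1) (j := 2) rfl (by decide)

theorem typeProj_three_last {J : R4 →L[ℝ] R4} {ε : Fin 4 → R4} (h : IsAdapted J ε) (α : Alt 3) :
    typeProj J 1 α ![ε 1, ε 2, ε 3] =
      (1 / 2) * (α ![ε 1, ε 2, ε 3] - I * α ![ε 0, ε 2, ε 3]) := by
  rw [typeProj_three]
  simp only [h.one, h.two, h.three, alt_three_neg₀, alt_three_neg₂, alt_three_self₁₂,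
    alt_three_swap₁₂ α _ (ε 2) (ε 3)]
  ring

theorem typeProj_three_first {J : R4 →L[ℝ] R4} {ε : Fin 4 → R4} (h : IsAdapted J ε) (α : Alt 3) :
    typeProj J 1 α ![ε 0, ε 1, ε 3] =
      (1 / 2) * (α ![ε 0, ε 1, ε 3] - I * α ![ε 0, ε 1, ε 2]) := by
  rw [typeProj_three]
  simp only [h.zero, h.one, h.three, alt_three_neg₁, alt_three_neg₂, alt_three_self₀₁,
    alt_three_swap₀₁ α (ε 0) (ε 1)]
  ring

theorem alt_four_smul (α : Alt 4) (x y z t : ℝ) (u v w r : R4) :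
    α ![x • u, y • v, z • w, t • r] = ((x * y * z * t : ℝ) : ℂ) * α ![u, v, w, r] := by
  have h := α.toMultilinearMap.map_smul_univ ![x, y, z, t] ![u, v, w, r]
  have h' : (fun i => ![x, y, z, t] i • ![u, v, w, r] i) =
      ![x • u, y • v, z • w, t • r] := by
    ext l : 1; fin_cases l <;> simp
  rw [h', Complex.real_smul, Fin.prod_univ_four] at h
  exact h

theorem alt_four_neg₁ (α : Alt 4) (u v w r : R4) : α ![u, -v, w, r] = -α ![u, v, w, r] := by
  have := alt_four_smul α 1 (-1) 1 1 u v w r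
  simpa using this

theorem alt_four_neg₃ (α : Alt 4) (u v w r : R4) : α ![u, v, w, -r] = -α ![u, v, w, r] := by
  have := alt_four_smul α 1 1 1 (-1) u v w r
  simpa using this

theorem alt_four_swap₀₁ (α : Alt 4) (u v w r : R4) : α ![v, u, w, r] = -α ![u, v, w, r] := by
  have h := α.toAlternatingMap.map_swap ![u, v, w, r] (i := 0) (j := 1) (by decide)
  have h' : ![u, v, w, r] ∘ Equiv.swap (0 : Fin 4) 1 = ![v, u, w, r] := by
    ext l : 1; fin_cases l <;> rfl
  rwa [h'] at h

theorem alt_four_swap₂₃ (α : Alt 4) (u v w r : R4) : α ![u, v, r, w] = -α ![u, v, w, r] := by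
  have h := α.toAlternatingMap.map_swap ![u, v, w, r] (i := 2) (j := 3) (by decide)
  have h' : ![u, v, w, r] ∘ Equiv.swap (2 : Fin 4) 3 = ![u, v, r, w] := by
    ext l : 1; fin_cases l <;> rfl
  rwa [h'] at h

theorem alt_four_self₀₁ (α : Alt 4) (u w r : R4) : α ![u, u, w, r] = 0 :=
  α.map_eq_zero_of_eq _ (i := 0) (j := 1) rfl (by decide)

theorem alt_four_self₂₃ (α : Alt 4) (u w r : R4) : α ![w, r, u, u] = 0 :=
  α.map_eq_zero_of_eq _ (i := 2) (j := 3) rfl (by decide)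

/-- In complex dimension 2 every 4-form has type (2,2). In the sum, `J` must hit both or neither
vector of each pair `ε 0, ε 1` and `ε 2, ε 3`, since otherwise a vector is repeated; the four
remaining terms have weights `6 + 2 + 2 + 6 = 16`. -/
theorem typeProj_four {J : R4 →L[ℝ] R4} {ε : Fin 4 → R4} (h : IsAdapted J ε) (α : Alt 4) :
    typeProj J 2 α ε = α ε := by
  have hε : ε = ![ε 0, ε 1, ε 2, ε 3] := by
    ext l : 1; fin_cases l <;> rfl
  rw [typeProj_eq]
  have key : ∀ T : Finset (Fin 4), (fun l => if l ∈ T then J (ε l) else ε l) =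
      ![if 0 ∈ T then ε 1 else ε 0, if 1 ∈ T then -ε 0 else ε 1,
        if 2 ∈ T then ε 3 else ε 2, if 3 ∈ T then -ε 2 else ε 3] := by
    intro T
    ext l : 1
    fin_cases l <;> simp [h.zero, h.one, h.two, h.three]
  have h1 : ∀ T : Finset (Fin 4), α (fun l => if l ∈ T then J (ε l) else ε l) =
      if (0 ∈ T ↔ 1 ∈ T) ∧ (2 ∈ T ↔ 3 ∈ T) then α ε else 0 := by
    intro T
    rw [key]
    conv_rhs => rw [hε]
    by_cases h0 : 0 ∈ T <;> by_cases h1 : 1 ∈ T <;> by_cases h2 : 2 ∈ T <;>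
      by_cases h3 : 3 ∈ T <;>
      simp [h0, h1, h2, h3, alt_four_neg₁, alt_four_neg₃, alt_four_self₀₁, alt_four_self₂₃,
        alt_four_swap₀₁ α (ε 0) (ε 1), alt_four_swap₂₃ α _ _ (ε 2) (ε 3)]
  simp only [h1, mul_ite, mul_zero]
  rw [← Finset.sum_filter]
  have hf : Finset.univ.filter (fun T : Finset (Fin 4) => (0 ∈ T ↔ 1 ∈ T) ∧ (2 ∈ T ↔ 3 ∈ T)) =
      {∅, {0, 1}, {2, 3}, {0, 1, 2, 3}} := by decide
  have c2 : ∀ i j : Fin 4, i ≠ j → ({i, j} : Finset (Fin 4)).card = 2 := by decide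
  have c4 : ({0, 1, 2, 3} : Finset (Fin 4)).card = 4 := by decide
  rw [hf, Finset.sum_insert (by decide), Finset.sum_insert (by decide),
    Finset.sum_insert (by decide), Finset.sum_singleton]
  simp only [typeCoeff_four, c2 0 1 (by decide), c2 2 3 (by decide), c4]
  simp
  ring

end KT

end

open scoped ContDiff

noncomputable section

namespace KT

open Complex ComplexConjugate

/-! ### The unitary frame of `h_ρ` -/

/-- The form `φ₁ - ρ φ₂` at `p`. -/
def psi1 (a b ρ : ℝ) (p : R4) : R4 →L[ℝ] ℂ := phi1 - ρ • phi2 a b p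

theorem psi1_apply (a b ρ : ℝ) (p v : R4) :
    psi1 a b ρ p v = phi1 v - ρ * phi2 a b p v := by
  change phi1 v - ρ • phi2 a b p v = _
  rw [Complex.real_smul]

/-- The orthonormal frame dual to the real and imaginary parts of `φ₁ - ρ φ₂` and `φ₂`. -/
def eps (a b ρ : ℝ) (p : R4) : Fin 4 → R4 :=
  ![![1, 0, 0, 0], ![0, 1, 0, 0], ![ρ, 0, 1, p 1 - a / b], ![0, ρ, 0, -1 / b]]

theorem isAdapted_eps (a : ℝ) {b : ℝ} (hb : b ≠ 0) (ρ : ℝ) (p : R4) :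
    IsAdapted ((Jab a b hb).J p) (eps a b ρ p) := by
  constructor <;> rw [Jab_apply] <;> ext i <;> fin_cases i <;> simp [eps] <;> field_simp <;> ring

theorem eps_decomp (a : ℝ) {b : ℝ} (hb : b ≠ 0) (ρ : ℝ) (p v : R4) :
    v = (psi1 a b ρ p v).re • eps a b ρ p 0 + (psi1 a b ρ p v).im • eps a b ρ p 1 +
      (phi2 a b p v).re • eps a b ρ p 2 + (phi2 a b p v).im • eps a b ρ p 3 := by
  rw [psi1_apply, phi1_apply, phi2_apply]
  ext i
  fin_cases i <;> simp [eps] <;> field_simp <;> ring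

theorem phi2_eps (a : ℝ) {b : ℝ} (hb : b ≠ 0) (ρ : ℝ) (p : R4) (n : Fin 4) :
    phi2 a b p (eps a b ρ p n) = ![0, 0, 1, I] n := by
  have : (b : ℂ) ≠ 0 := by exact_mod_cast hb
  rw [phi2_apply]
  fin_cases n <;> simp [eps] <;> field_simp <;> ring

theorem psi1_eps (a : ℝ) {b : ℝ} (hb : b ≠ 0) (ρ : ℝ) (p : R4) (n : Fin 4) :
    psi1 a b ρ p (eps a b ρ p n) = ![1, I, 0, 0] n := by
  rw [psi1_apply, phi2_eps a hb, phi1_apply]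
  fin_cases n <;> simp [eps] <;> ring

theorem det4_apply (v : Fin 4 → R4) : det4 v = ((Matrix.of v).det : ℂ) := by
  change (((Pi.basisFun ℝ (Fin 4)).det v : ℝ) : ℂ) = _
  rw [Pi.basisFun_det_apply]

theorem det_eps (a b ρ : ℝ) (p : R4) : (Matrix.of (eps a b ρ p)).det = -1 / b := by
  simp [eps, Matrix.det_succ_row_zero, Fin.sum_univ_succ, Fin.succAbove]

theorem hrho_apply (a : ℝ) {b : ℝ} (hb : b ≠ 0) (ρ : ℝ) (p u v : R4) :
    (hrho a b hb ρ).g p u v = (psi1 a b ρ p u * conj (psi1 a b ρ p v)).re +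
      (phi2 a b p u * conj (phi2 a b p v)).re := by
  change sqNorm (psi1 a b ρ p) u v + sqNorm (phi2 a b p) u v = _
  rw [sqNorm_apply, sqNorm_apply]

theorem sum_hrho_eps (a : ℝ) {b : ℝ} (hb : b ≠ 0) (ρ : ℝ) (p v : R4) :
    ∑ n, (hrho a b hb ρ).g p v (eps a b ρ p n) • eps a b ρ p n = v := by
  refine Eq.trans ?_ (eps_decomp a hb ρ p v).symm
  simp only [Fin.sum_univ_four, hrho_apply, phi2_eps a hb, psi1_eps a hb]
  simp

/-- The expansion `v = ∑ g(v, εₙ) εₙ`, read in coordinates, exhibits the inverse of the Gram matrix.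
-/
theorem gram_inv_hrho (a : ℝ) {b : ℝ} (hb : b ≠ 0) (ρ : ℝ) (p : R4) :
    (gram ((hrho a b hb ρ).g p))⁻¹ = (Matrix.of (eps a b ρ p)).transpose * Matrix.of (eps a b ρ p) := by
  refine Matrix.inv_eq_right_inv ?_
  ext i j
  have h1 := congrFun (sum_hrho_eps a hb ρ p (e i)) j
  have h2 : ∀ n, (hrho a b hb ρ).g p (e i) (eps a b ρ p n) =
      ∑ k, gram ((hrho a b hb ρ).g p) i k * eps a b ρ p n k := by
    intro n
    have : eps a b ρ p n = ∑ k, eps a b ρ p n k • e k := pi_eq_sum_univ' _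
    conv_lhs => rw [this, map_sum]
    refine Finset.sum_congr rfl fun k _ => ?_
    rw [map_smul, smul_eq_mul, mul_comm]
    rfl
  simp only [h2, Finset.sum_apply, Pi.smul_apply, smul_eq_mul] at h1
  rw [Matrix.one_apply, ← Matrix.mul_assoc, Matrix.mul_apply]
  simp only [Matrix.mul_apply, Matrix.transpose_apply, Matrix.of_apply]
  rw [h1, e, Pi.single_apply]
  simp [eq_comm]

theorem gram_inv_hrho_apply (a : ℝ) {b : ℝ} (hb : b ≠ 0) (ρ : ℝ) (p : R4) (i j : Fin 4) :
    (gram ((hrho a b hb ρ).g p))⁻¹ i j = ∑ n, eps a b ρ p n i * eps a b ρ p n j := by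
  rw [gram_inv_hrho a hb, Matrix.mul_apply]
  rfl

theorem sqrt_det_gram (a : ℝ) {b : ℝ} (hb : b ≠ 0) (ρ : ℝ) (p : R4) :
    Real.sqrt (gram ((hrho a b hb ρ).g p)).det = |b| := by
  have h := congrArg Matrix.det (gram_inv_hrho a hb ρ p)
  rw [Matrix.det_nonsing_inv, Matrix.det_mul, Matrix.det_transpose, det_eps,
    Ring.inverse_eq_inv'] at h
  have h2 : (gram ((hrho a b hb ρ).g p)).det = b ^ 2 := by
    rw [← inv_inv (Matrix.det _), h]
    field_simp
  rw [h2, Real.sqrt_sq_eq_abs]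

end KT

end

open scoped ContDiff

noncomputable section

namespace KT

open Complex ComplexConjugate

/-! ### The Hodge star of `h_ρ` in the unitary frame -/

/-- The sign of the frame `eps` with respect to the coordinate orientation. -/
def orient (b : ℝ) : ℂ := ((|b| * (-1 / b) : ℝ) : ℂ)

theorem orient_mul_self {b : ℝ} (hb : b ≠ 0) : orient b * orient b = 1 := by
  rw [orient, ← ofReal_mul]
  have : |b| * (-1 / b) * (|b| * (-1 / b)) = 1 := by
    field_simp
    rw [sq_abs]
  rw [this, ofReal_one]

theorem hodgeStar_frame_of_eq {g : R4 →L[ℝ] R4 →L[ℝ] ℝ} {ε : Fin 4 → R4}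
    (hε : ∀ i j, (gram g)⁻¹ i j = ∑ n, ε n i * ε n j) (k m : ℕ) (h : 4 = m + k) (α : Alt k)
    (c₀ : Fin k → Fin 4) (d : Fin m → Fin 4)
    (hc₀ : Function.Injective c₀) (hcov : ∀ i, i ∈ Set.range c₀ ∨ i ∈ Set.range d)
    {w : Fin k → R4} {v : Fin m → R4} (hw : ε ∘ c₀ = w) (hv : ε ∘ d = v) :
    hodgeStar g k m h α v = (Real.sqrt (gram g).det : ℂ) * (α w *
      contract k w (h ▸ det4 : Alt (m + k)) v) := by
  subst hw hv
  exact hodgeStar_frame hε k m h α c₀ d hc₀ hcov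

theorem hodgeStar_four (a : ℝ) {b : ℝ} (hb : b ≠ 0) (ρ : ℝ) (p : R4) (h : 4 = 0 + 4) (α : Alt 4)
    (v : Fin 0 → R4) :
    hodgeStar ((hrho a b hb ρ).g p) 4 0 h α v = orient b * α (eps a b ρ p) := by
  have h1 := hodgeStar_frame (gram_inv_hrho_apply a hb ρ p) 4 0 h α id ![]
    Function.injective_id (fun i => Or.inl ⟨i, rfl⟩)
  rw [Subsingleton.elim v (eps a b ρ p ∘ ![]), h1, sqrt_det_gram a hb]
  have h2 : contract 4 (eps a b ρ p ∘ id) (h ▸ det4 : Alt (0 + 4)) (eps a b ρ p ∘ ![]) =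
      det4 (eps a b ρ p) := by
    change det4 _ = _
    congr 1
    ext l : 1
    fin_cases l <;> rfl
  rw [h2, det4_apply, det_eps, orient, Function.comp_id]
  push_cast
  ring

theorem hodgeStar_three (a : ℝ) {b : ℝ} (hb : b ≠ 0) (ρ : ℝ) (p : R4) (h : 4 = 1 + 3) (α : Alt 3)
    {i j k l : Fin 4} (hij : Function.Injective ![i, j, k])
    (hcov : ∀ n, n ∈ Set.range ![i, j, k] ∨ n ∈ Set.range ![l])
    (hdet : (Matrix.of ![eps a b ρ p i, eps a b ρ p j, eps a b ρ p k, eps a b ρ p l]).det =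
      1 / b) :
    hodgeStar ((hrho a b hb ρ).g p) 3 1 h α ![eps a b ρ p l] =
      -orient b * α ![eps a b ρ p i, eps a b ρ p j, eps a b ρ p k] := by
  have e1 : eps a b ρ p ∘ ![l] = ![eps a b ρ p l] := by
    ext l : 1; fin_cases l; rfl
  have e2 : eps a b ρ p ∘ ![i, j, k] = ![eps a b ρ p i, eps a b ρ p j, eps a b ρ p k] := by
    ext l : 1; fin_cases l <;> rfl
  have h4 := hodgeStar_frame_of_eq (gram_inv_hrho_apply a hb ρ p) 3 1 h α ![i, j, k] ![l] hij hcov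
    e2 e1
  rw [sqrt_det_gram a hb] at h4
  have e3 : contract 3 ![eps a b ρ p i, eps a b ρ p j, eps a b ρ p k]
      (h ▸ det4 : Alt (1 + 3)) ![eps a b ρ p l] =
      det4 ![eps a b ρ p i, eps a b ρ p j, eps a b ρ p k, eps a b ρ p l] := rfl
  rw [h4, e3, det4_apply, hdet, orient]
  push_cast
  ring

theorem hodgeStar_three_zero (a : ℝ) {b : ℝ} (hb : b ≠ 0) (ρ : ℝ) (p : R4) (h : 4 = 1 + 3)
    (α : Alt 3) : hodgeStar ((hrho a b hb ρ).g p) 3 1 h α ![eps a b ρ p 0] =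
      -orient b * α ![eps a b ρ p 1, eps a b ρ p 2, eps a b ρ p 3] := by
  refine hodgeStar_three a hb ρ p h α (by decide) (by decide) ?_
  simp [eps, Matrix.det_succ_row_zero, Fin.sum_univ_succ, Fin.succAbove]
  ring

theorem hodgeStar_three_two (a : ℝ) {b : ℝ} (hb : b ≠ 0) (ρ : ℝ) (p : R4) (h : 4 = 1 + 3)
    (α : Alt 3) : hodgeStar ((hrho a b hb ρ).g p) 3 1 h α ![eps a b ρ p 2] =
      -orient b * α ![eps a b ρ p 0, eps a b ρ p 1, eps a b ρ p 3] := by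
  refine hodgeStar_three a hb ρ p h α (by decide) (by decide) ?_
  simp [eps, Matrix.det_succ_row_zero, Fin.sum_univ_succ, Fin.succAbove]
  ring

theorem hodgeStar_two (a : ℝ) {b : ℝ} (hb : b ≠ 0) (ρ : ℝ) (p : R4) (h : 4 = 2 + 2) (α : Alt 2)
    {i j k l : Fin 4} (hij : Function.Injective ![i, j])
    (hcov : ∀ n, n ∈ Set.range ![i, j] ∨ n ∈ Set.range ![k, l]) :
    hodgeStar ((hrho a b hb ρ).g p) 2 2 h α ![eps a b ρ p k, eps a b ρ p l] =
      ((|b| * (Matrix.of ![eps a b ρ p i, eps a b ρ p j, eps a b ρ p k, eps a b ρ p l]).det : ℝ) :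
        ℂ) * α ![eps a b ρ p i, eps a b ρ p j] := by
  have h4 := hodgeStar_frame (gram_inv_hrho_apply a hb ρ p) 2 2 h α ![i, j] ![k, l] hij hcov
  have e1 : ∀ m n, eps a b ρ p ∘ ![m, n] = ![eps a b ρ p m, eps a b ρ p n] := by
    intro m n
    ext l : 1; fin_cases l <;> rfl
  rw [e1, e1, sqrt_det_gram a hb] at h4
  have e3 : contract 2 ![eps a b ρ p i, eps a b ρ p j]
      (h ▸ det4 : Alt (2 + 2)) ![eps a b ρ p k, eps a b ρ p l] =
      det4 ![eps a b ρ p i, eps a b ρ p j, eps a b ρ p k, eps a b ρ p l] := rfl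
  rw [h4, e3, det4_apply]
  push_cast
  ring

/-- The sum over the frame is kept because the arguments `v` will be coordinate vectors, on which
the exterior derivative of the 3-form is computed. -/
theorem hodgeStar_one (a : ℝ) {b : ℝ} (hb : b ≠ 0) (ρ : ℝ) (p : R4) (h : 4 = 3 + 1) (α : Alt 1)
    (v : Fin 3 → R4) :
    hodgeStar ((hrho a b hb ρ).g p) 1 3 h α v =
      ((|b| : ℝ) : ℂ) * ∑ n, α ![eps a b ρ p n] * det4 (Matrix.vecCons (eps a b ρ p n) v) := by
  rw [hodgeStar_eq_sum_frame (gram_inv_hrho_apply a hb ρ p), sqrt_det_gram a hb,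
    ← (Equiv.funUnique (Fin 1) (Fin 4)).symm.sum_comp]
  rw [Nat.factorial_one, Nat.cast_one, div_one]
  congr 1
  refine Finset.sum_congr rfl fun n _ => ?_
  have : (fun l : Fin 1 => eps a b ρ p ((Equiv.funUnique (Fin 1) (Fin 4)).symm n l)) =
      ![eps a b ρ p n] := by
    ext l : 1; fin_cases l; rfl
  rw [this]
  rfl

/-! ### Forms of type `(0, 1)` and `(0, 2)` -/

theorem conj_eq (z : ℂ) : conj z = z.re - z.im * I := by
  apply Complex.ext <;> simp

theorem alt_one_linear (α : Alt 1) (x y z t : ℝ) (u v w r : R4) :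
    α ![x • u + y • v + z • w + t • r] =
      x * α ![u] + y * α ![v] + z * α ![w] + t * α ![r] := by
  let L : R4 →ₗ[ℝ] ℂ := ((ContinuousAlternatingMap.ofSubsingleton ℝ R4 ℂ (0 : Fin 1)).symm α : R4 →L[ℝ] ℂ)
  have hL : ∀ u, α ![u] = L u := fun u => by
    change α _ = α _
    congr 1
    ext l : 1
    fin_cases l
    rfl
  simp only [hL, map_add, map_smul, Complex.real_smul]

theorem alt_two_linear (α : Alt 2) (x y z t : ℝ) (u v w r q : R4) :
    α ![x • u + y • v + z • w + t • r, q] =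
      x * α ![u, q] + y * α ![v, q] + z * α ![w, q] + t * α ![r, q] := by
  have h : ∀ u, α ![u, q] = α.curryLeft u ![q] := fun u => rfl
  simp only [h, map_add, map_smul, ContinuousAlternatingMap.add_apply,
    ContinuousAlternatingMap.smul_apply, Complex.real_smul]

theorem typeProj_one_eq_self_iff (J : R4 →L[ℝ] R4) (α : Alt 1) :
    typeProj J 0 α = α ↔ ∀ v, α ![J v] = -I * α ![v] := by
  constructor
  · intro h v
    have h1 := typeProj_one J α v
    rw [h] at h1
    linear_combination (2 * I) * h1 + α ![J v] * I_sq
  · intro h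
    ext v
    have hv : v = ![v 0] := by
      ext l : 1; fin_cases l; rfl
    rw [hv, typeProj_one, h]
    linear_combination -(1 / 2) * α ![v 0] * I_sq

theorem typeProj_two_J {J : R4 →L[ℝ] R4} (hJ : ∀ v, J (J v) = -v) (α : Alt 2) (u v : R4) :
    typeProj J 0 α ![J u, v] = -I * typeProj J 0 α ![u, v] := by
  rw [typeProj_two, typeProj_two, hJ, alt_two_neg_left, alt_two_neg_left]
  linear_combination (1 / 4) * (α ![J u, v] + α ![u, J v]) * I_sq

theorem alt_one_eq (a : ℝ) {b : ℝ} (hb : b ≠ 0) (ρ : ℝ) (p : R4) {α : Alt 1}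
    (hα : ∀ v, α ![(Jab a b hb).J p v] = -I * α ![v]) (v : R4) :
    α ![v] = α ![eps a b ρ p 0] * conj (psi1 a b ρ p v) +
      α ![eps a b ρ p 2] * conj (phi2 a b p v) := by
  conv_lhs => rw [eps_decomp a hb ρ p v]
  have h := isAdapted_eps a hb ρ p
  rw [alt_one_linear, ← h.zero, ← h.two, hα, hα, conj_eq, conj_eq]
  ring

theorem alt_two_eq_left (a : ℝ) {b : ℝ} (hb : b ≠ 0) (ρ : ℝ) (p : R4) {α : Alt 2}
    (hα : ∀ u v, α ![(Jab a b hb).J p u, v] = -I * α ![u, v]) (u v : R4) :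
    α ![u, v] = α ![eps a b ρ p 0, v] * conj (psi1 a b ρ p u) +
      α ![eps a b ρ p 2, v] * conj (phi2 a b p u) := by
  conv_lhs => rw [eps_decomp a hb ρ p u]
  have h := isAdapted_eps a hb ρ p
  rw [alt_two_linear, ← h.zero, ← h.two, hα, hα, conj_eq, conj_eq]
  ring

theorem alt_two_eq (a : ℝ) {b : ℝ} (hb : b ≠ 0) (ρ : ℝ) (p : R4) {α : Alt 2}
    (hα : ∀ u v, α ![(Jab a b hb).J p u, v] = -I * α ![u, v]) (u v : R4) :
    α ![u, v] = α ![eps a b ρ p 0, eps a b ρ p 2] *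
      (conj (psi1 a b ρ p u) * conj (phi2 a b p v) -
        conj (psi1 a b ρ p v) * conj (phi2 a b p u)) := by
  rw [alt_two_eq_left a hb ρ p hα, alt_two_swap α v, alt_two_swap α v (eps a b ρ p 2),
    alt_two_eq_left a hb ρ p hα v, alt_two_eq_left a hb ρ p hα v, alt_two_self, alt_two_self,
    alt_two_swap α (eps a b ρ p 0) (eps a b ρ p 2)]
  ring

theorem alt_two_ext_eps (a : ℝ) {b : ℝ} (hb : b ≠ 0) (ρ : ℝ) (p : R4) {α β : Alt 2}
    (h : ∀ i j, i < j → α ![eps a b ρ p i, eps a b ρ p j] = β ![eps a b ρ p i, eps a b ρ p j]) :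
    α = β := by
  have h1 : ∀ i j, α ![eps a b ρ p i, eps a b ρ p j] = β ![eps a b ρ p i, eps a b ρ p j] := by
    intro i j
    rcases lt_trichotomy i j with hij | rfl | hij
    · exact h i j hij
    · rw [alt_two_self, alt_two_self]
    · rw [alt_two_swap, h j i hij, alt_two_swap β (eps a b ρ p j)]
  have h2 : ∀ u j, α ![u, eps a b ρ p j] = β ![u, eps a b ρ p j] := by
    intro u j
    rw [eps_decomp a hb ρ p u, alt_two_linear, alt_two_linear, h1, h1, h1, h1]
  have h3 : ∀ u v, α ![v, u] = β ![v, u] := by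
    intro u v
    rw [alt_two_swap, alt_two_swap β, eps_decomp a hb ρ p u, alt_two_linear, alt_two_linear]
    simp only [alt_two_swap _ v, h2]
  ext v
  have hv : v = ![v 0, v 1] := by
    ext l : 1; fin_cases l <;> rfl
  rw [hv, h3]

/-- Such a form is a multiple of `ψ̄₁ ∧ ψ̄₂`, which is self-dual for the orientation of the frame
`eps`; the factor compares this orientation with that of the coordinates. -/
theorem hodgeStar_two_eq (a : ℝ) {b : ℝ} (hb : b ≠ 0) (ρ : ℝ) (p : R4) (h : 4 = 2 + 2) {α : Alt 2}
    (hα : ∀ u v, α ![(Jab a b hb).J p u, v] = -I * α ![u, v]) :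
    hodgeStar ((hrho a b hb ρ).g p) 2 2 h α = orient b • α := by
  refine alt_two_ext_eps a hb ρ p fun i j hij => ?_
  rw [ContinuousAlternatingMap.smul_apply, smul_eq_mul]
  have hv := fun i j : Fin 4 => alt_two_eq a hb ρ p hα (eps a b ρ p i) (eps a b ρ p j)
  have key : ∀ i' j' : Fin 4, Function.Injective ![i', j'] →
      (∀ n, n ∈ Set.range ![i', j'] ∨ n ∈ Set.range ![i, j]) →
      ((|b| * (Matrix.of ![eps a b ρ p i', eps a b ρ p j', eps a b ρ p i, eps a b ρ p j]).det : ℝ) :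
        ℂ) * α ![eps a b ρ p i', eps a b ρ p j'] = orient b * α ![eps a b ρ p i, eps a b ρ p j] →
      hodgeStar ((hrho a b hb ρ).g p) 2 2 h α ![eps a b ρ p i, eps a b ρ p j] =
      orient b * α ![eps a b ρ p i, eps a b ρ p j] := by
    intro i' j' h1 h2 h3
    rw [hodgeStar_two a hb ρ p h α h1 h2, h3]
  have main : (i = 0 ∧ j = 1) ∨ (i = 0 ∧ j = 2) ∨ (i = 0 ∧ j = 3) ∨ (i = 1 ∧ j = 2) ∨
      (i = 1 ∧ j = 3) ∨ (i = 2 ∧ j = 3) := by omega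
  rcases main with ⟨rfl, rfl⟩ | ⟨rfl, rfl⟩ | ⟨rfl, rfl⟩ | ⟨rfl, rfl⟩ | ⟨rfl, rfl⟩ | ⟨rfl, rfl⟩
  on_goal 1 => refine key 2 3 (by decide) (by decide) ?_
  on_goal 2 => refine key 1 3 (by decide) (by decide) ?_
  on_goal 3 => refine key 1 2 (by decide) (by decide) ?_
  on_goal 4 => refine key 0 3 (by decide) (by decide) ?_
  on_goal 5 => refine key 0 2 (by decide) (by decide) ?_
  on_goal 6 => refine key 0 1 (by decide) (by decide) ?_
  all_goals
    rw [hv]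
    nth_rw 2 [hv]
    simp only [psi1_eps a hb, phi2_eps a hb, orient]
    simp [eps, Matrix.det_succ_row_zero, Fin.sum_univ_succ, Fin.succAbove]

end KT

end

open scoped ContDiff

noncomputable section

namespace KT

open Complex ComplexConjugate

/-! ### Exterior derivatives in low degrees -/

theorem extDeriv_zero_form {u : R4 → Alt 0} {x : R4} (hu : DifferentiableAt ℝ u x) (v : R4) :
    extDeriv u x ![v] = fderiv ℝ (fun y => u y ![]) x v := by
  rw [extDeriv_apply hu, Fin.sum_univ_one]
  have h : ∀ i : Fin 1, i.removeNth ![v] = ![] := fun i => Subsingleton.elim _ _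
  simp [h]

theorem extDeriv_one_form {s : R4 → Alt 1} {x : R4} (hs : DifferentiableAt ℝ s x) (u v : R4) :
    extDeriv s x ![u, v] =
      fderiv ℝ (fun y => s y ![v]) x u - fderiv ℝ (fun y => s y ![u]) x v := by
  rw [extDeriv_apply hs, Fin.sum_univ_two]
  have h0 : (0 : Fin 2).removeNth ![u, v] = ![v] := by
    ext l : 1; fin_cases l; rfl
  have h1 : (1 : Fin 2).removeNth ![u, v] = ![u] := by
    ext l : 1; fin_cases l; rfl
  rw [h0, h1]
  simp
  ring

theorem extDeriv_two_form {s : R4 → Alt 2} {x : R4} (hs : DifferentiableAt ℝ s x) (u v w : R4) :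
    extDeriv s x ![u, v, w] =
      fderiv ℝ (fun y => s y ![v, w]) x u - fderiv ℝ (fun y => s y ![u, w]) x v +
        fderiv ℝ (fun y => s y ![u, v]) x w := by
  rw [extDeriv_apply hs, Fin.sum_univ_three]
  have h0 : (0 : Fin 3).removeNth ![u, v, w] = ![v, w] := by
    ext l : 1; fin_cases l <;> rfl
  have h1 : (1 : Fin 3).removeNth ![u, v, w] = ![u, w] := by
    ext l : 1; fin_cases l <;> rfl
  have h2 : (2 : Fin 3).removeNth ![u, v, w] = ![u, v] := by
    ext l : 1; fin_cases l <;> rfl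
  rw [h0, h1, h2]
  simp
  ring

theorem extDeriv_three_form {s : R4 → Alt 3} {x : R4} (hs : DifferentiableAt ℝ s x) :
    extDeriv s x e = ∑ i : Fin 4, (-1) ^ i.val •
      fderiv ℝ (fun y => s y (i.removeNth e)) x (e i) :=
  extDeriv_apply hs e

theorem alt_four_eq_det (α : Alt 4) (v : Fin 4 → R4) :
    α v = ((Matrix.of v).det : ℂ) * α e := by
  have he : ⇑(Pi.basisFun ℝ (Fin 4)) = e := by
    ext i : 1
    simp [e]
  have h : α.toAlternatingMap = (α e • det4).toAlternatingMap := by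
    refine Module.Basis.ext_alternating (Pi.basisFun ℝ (Fin 4)) fun i hi => ?_
    let σ : Equiv.Perm (Fin 4) := Equiv.ofBijective i (Finite.injective_iff_bijective.1 hi)
    have h1 : (α e • det4) e = α e := by
      have : (Matrix.of e : Matrix (Fin 4) (Fin 4) ℝ) = 1 := by
        ext i j
        simp [e, Matrix.one_apply, Pi.single_apply, eq_comm]
      rw [ContinuousAlternatingMap.smul_apply, det4_apply, this]
      simp
    rw [he]
    change α.toAlternatingMap (e ∘ σ) = (α e • det4).toAlternatingMap (e ∘ σ)
    rw [AlternatingMap.map_perm, AlternatingMap.map_perm]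
    exact congrArg _ h1.symm
  have h1 := congrArg (fun β => β v) h
  change α v = α e * det4 v at h1
  rw [h1, det4_apply, mul_comm]

/-! ### Derivatives along the unitary frame -/

theorem eps_eq_frame (a b ρ : ℝ) (p : R4) :
    eps a b ρ p 0 = frame p (e 0) ∧ eps a b ρ p 1 = frame p (e 1) ∧
    eps a b ρ p 2 = ρ • frame p (e 0) + frame p (e 2) - (a / b) • frame p (e 3) ∧
    eps a b ρ p 3 = ρ • frame p (e 1) - (1 / b) • frame p (e 3) := by
  simp only [frame_apply]
  refine ⟨?_, ?_, ?_, ?_⟩ <;> ext i <;> fin_cases i <;> simp [eps, e]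
  ring

/-- The derivations along the vector fields of the unitary frame. -/
def dEps (a b ρ : ℝ) : Fin 4 → Fn →ₗ[ℂ] Fn := ![D 0, D 1, E2 a b ρ, E3 b ρ]

theorem fderiv_eps (a b ρ : ℝ) (F : Fn) (p : R4) (n : Fin 4) :
    fderiv ℝ F p (eps a b ρ p n) = dEps a b ρ n F p := by
  obtain ⟨h0, h1, h2, h3⟩ := eps_eq_frame a b ρ p
  fin_cases n
  · change fderiv ℝ F p (eps a b ρ p 0) = _
    rw [h0]
    rfl
  · change fderiv ℝ F p (eps a b ρ p 1) = _
    rw [h1]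
    rfl
  · change fderiv ℝ F p (eps a b ρ p 2) = ρ * D 0 F p + D 2 F p - (a / b) * D 3 F p
    rw [h2, map_sub, map_add, map_smul, map_smul]
    simp [D_apply]
  · change fderiv ℝ F p (eps a b ρ p 3) = ρ * D 1 F p - (1 / b) * D 3 F p
    rw [h3, map_sub, map_smul, map_smul]
    simp [D_apply]

theorem hasFDerivAt_mul_affine (F : Fn) (A B : ℂ) (x : R4) :
    HasFDerivAt (fun y => F y * (A + B * ((y 1 - x 1 : ℝ) : ℂ)))
      (F x • B • ofRealCLM.comp (ContinuousLinearMap.proj (R := ℝ) (φ := fun _ : Fin 4 => ℝ) 1) +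
        (A + B * ((x 1 - x 1 : ℝ) : ℂ)) • fderiv ℝ F x) x := by
  have h1 : HasFDerivAt (fun y : R4 => ((y 1 - x 1 : ℝ) : ℂ))
      (ofRealCLM.comp (ContinuousLinearMap.proj (R := ℝ) (φ := fun _ : Fin 4 => ℝ) 1)) x :=
    ofRealCLM.hasFDerivAt.comp x
      ((ContinuousLinearMap.proj (R := ℝ) (φ := fun _ : Fin 4 => ℝ) 1).hasFDerivAt.sub_const (x 1))
  exact (F.differentiableAt x).hasFDerivAt.mul ((h1.const_mul B).const_add A)

theorem fderiv_mul_affine (F : Fn) (A B : ℂ) (x v : R4) :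
    fderiv ℝ (fun y => F y * (A + B * ((y 1 - x 1 : ℝ) : ℂ))) x v =
      A * fderiv ℝ F x v + B * (v 1 : ℂ) * F x := by
  rw [(hasFDerivAt_mul_affine F A B x).fderiv]
  simp
  ring

/-! ### Forms of type `(0, 1)` -/

/-- The form `f ψ̄₁ + g ψ̄₂`. -/
def oneForm (a b ρ : ℝ) (f g : R4 → ℂ) (p : R4) : Alt 1 :=
  ContinuousAlternatingMap.ofSubsingleton ℝ R4 ℂ (0 : Fin 1)
    (f p • (conjCLE.toContinuousLinearMap.comp (psi1 a b ρ p)) +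
      g p • (conjCLE.toContinuousLinearMap.comp (phi2 a b p)))

theorem oneForm_apply (a b ρ : ℝ) (f g : R4 → ℂ) (p v : R4) :
    oneForm a b ρ f g p ![v] = f p * conj (psi1 a b ρ p v) + g p * conj (phi2 a b p v) := rfl

/-- On a fixed vector, `φ₂` is affine in the coordinate `x`. Exterior derivatives are evaluated on
vectors frozen at one point, so this slope is the only source of zeroth order terms. -/
theorem phi2_sub (a b : ℝ) (x y v : R4) :
    phi2 a b y v = phi2 a b x v + I * b * (v 2 : ℂ) * ((y 1 - x 1 : ℝ) : ℂ) := by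
  rw [phi2_apply, phi2_apply]
  push_cast
  ring

theorem fderiv_oneForm (a b ρ : ℝ) (f g : Fn) (x u v : R4) :
    fderiv ℝ (fun y => oneForm a b ρ f g y ![v]) x u =
      conj (psi1 a b ρ x v) * fderiv ℝ f x u + conj (phi2 a b x v) * fderiv ℝ g x u +
        I * b * (v 2) * (u 1) * (ρ * f x - g x) := by
  have h : (fun y => oneForm a b ρ f g y ![v]) =
      (fun y => f y * (conj (psi1 a b ρ x v) + (I * b * ρ * v 2) * ((y 1 - x 1 : ℝ) : ℂ))) +
      fun y => g y * (conj (phi2 a b x v) + (-(I * b * v 2)) * ((y 1 - x 1 : ℝ) : ℂ)) := by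
    funext y
    rw [oneForm_apply, psi1_apply, phi2_sub a b x y, psi1_apply, Pi.add_apply]
    simp only [map_add, map_sub, map_mul, conj_I, conj_ofReal]
    ring
  have hd := fun (F : Fn) (A B : ℂ) => (hasFDerivAt_mul_affine F A B x).differentiableAt
  rw [h, fderiv_add (hd f _ _) (hd g _ _), _root_.add_apply, fderiv_mul_affine, fderiv_mul_affine]
  ring

theorem contDiff_eps (a b ρ : ℝ) (n : Fin 4) : ContDiff ℝ ∞ fun p => eps a b ρ p n := by
  refine contDiff_pi.2 fun i => ?_
  fin_cases n <;> fin_cases i <;> simp [eps] <;> fun_prop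

theorem eps_deck (a b ρ : ℝ) (γ : Fin 4 → ℤ) (p : R4) (n : Fin 4) :
    eps a b ρ (deck γ p) n = fderiv ℝ (deck γ) p (eps a b ρ p n) := by
  rw [fderiv_deck, deckLin_apply]
  ext i
  fin_cases n <;> fin_cases i <;> simp [eps, deck]
  ring

theorem contDiff_oneForm (a b ρ : ℝ) {f g : R4 → ℂ} (hf : ContDiff ℝ ∞ f) (hg : ContDiff ℝ ∞ g) :
    ContDiff ℝ ∞ (oneForm a b ρ f g) := by
  refine contDiff_alt fun i => ?_
  have h : (fun l => e (i l)) = ![e (i 0)] := by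
    ext l : 1; fin_cases l; rfl
  simp only [h, oneForm_apply, psi1_apply]
  have h2 : ContDiff ℝ ∞ fun x => phi2 a b x (e (i 0)) :=
    (contDiff_phi2 a b).clm_apply contDiff_const
  have h3 : ∀ G : R4 → ℂ, ContDiff ℝ ∞ G → ContDiff ℝ ∞ fun x => conj (G x) := fun G hG =>
    conjCLE.toContinuousLinearMap.contDiff.comp hG
  exact (hf.mul (h3 _ (contDiff_const.sub (contDiff_const.mul h2)))).add (hg.mul (h3 _ h2))

theorem oneForm_mem_formSpace (a b ρ : ℝ) (f g : Fn) : oneForm a b ρ f g ∈ formSpace 1 := by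
  refine ⟨contDiff_oneForm a b ρ f.contDiff g.contDiff, fun γ p => ?_⟩
  ext v
  have hv : v = ![v 0] := by
    ext l : 1; fin_cases l; rfl
  rw [ContinuousAlternatingMap.compContinuousLinearMap_apply]
  have h2 : ⇑(fderiv ℝ (deck γ) p) ∘ v = ![fderiv ℝ (deck γ) p (v 0)] := by
    ext l : 1; fin_cases l; rfl
  rw [h2, hv, oneForm_apply, oneForm_apply, psi1_apply, psi1_apply]
  simp only [Matrix.cons_val_zero]
  rw [phi1_deck, phi2_deck, f.2.2, g.2.2]

theorem oneForm_J (a : ℝ) {b : ℝ} (hb : b ≠ 0) (ρ : ℝ) (f g : R4 → ℂ) (p v : R4) :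
    oneForm a b ρ f g p ![(Jab a b hb).J p v] = -I * oneForm a b ρ f g p ![v] := by
  rw [oneForm_apply, oneForm_apply, psi1_apply, psi1_apply, phi1_J, phi2_J]
  simp only [map_sub, map_mul, conj_I]
  ring

/-- The value of a one-form on a vector field of the unitary frame. -/
def evalEps (a b ρ : ℝ) (n : Fin 4) (s : R4 → Alt 1) (hs : s ∈ formSpace 1) : Fn :=
  ⟨fun p => s p ![eps a b ρ p n], by
    refine ⟨contDiff_apply hs.1 fun l => ?_, fun γ p => ?_⟩
    · fin_cases l
      exact contDiff_eps a b ρ n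
    · change s (deck γ p) ![eps a b ρ (deck γ p) n] = s p ![eps a b ρ p n]
      rw [← hs.2 γ p, ContinuousAlternatingMap.compContinuousLinearMap_apply, eps_deck]
      congr 1
      ext l : 1; fin_cases l; rfl⟩

theorem eq_oneForm (a : ℝ) {b : ℝ} (hb : b ≠ 0) (ρ : ℝ) {s : R4 → Alt 1} (hs : s ∈ formSpace 1)
    (ht : ∀ x, typeProj ((Jab a b hb).J x) 0 (s x) = s x) :
    s = oneForm a b ρ (evalEps a b ρ 0 s hs) (evalEps a b ρ 2 s hs) := by
  funext p
  ext v
  have hv : v = ![v 0] := by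
    ext l : 1; fin_cases l; rfl
  rw [hv, oneForm_apply, alt_one_eq a hb ρ p ((typeProj_one_eq_self_iff _ _).1 (ht p))]
  rfl

end KT

end

open scoped ContDiff

noncomputable section

namespace KT

open Complex ComplexConjugate

/-! ### The operators `∂̄` and `∂̄*` in the unitary frame -/

theorem Fn.add_apply (F G : Fn) (p : R4) : (F + G) p = F p + G p := rfl

theorem Fn.sub_apply (F G : Fn) (p : R4) : (F - G) p = F p - G p := rfl

theorem Fn.neg_apply (F : Fn) (p : R4) : (-F) p = -F p := rfl

theorem Fn.smul_apply (c : ℂ) (F : Fn) (p : R4) : (c • F) p = c * F p := rfl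

/-- A (0,2)-form is determined by its value on `ε 0, ε 2`, so a single evaluation suffices. The
terms `b / 4` and `ρ b / 4` of the curl come from `dφ₂ = i b dx ∧ dy`. -/
theorem dbar_oneForm (a : ℝ) {b : ℝ} (hb : b ≠ 0) (ρ : ℝ) (f g : Fn) (x u v : R4) :
    dbar (Jab a b hb) 0 (oneForm a b ρ f g) x ![u, v] = curlOp a b ρ (f, g) x *
      (conj (psi1 a b ρ x u) * conj (phi2 a b x v) -
        conj (psi1 a b ρ x v) * conj (phi2 a b x u)) := by
  have hd : DifferentiableAt ℝ (oneForm a b ρ f g) x :=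
    (contDiff_oneForm a b ρ f.contDiff g.contDiff).differentiable (by simp) x
  change typeProj ((Jab a b hb).J x) 0 (extDeriv (oneForm a b ρ f g) x) ![u, v] = _
  rw [alt_two_eq a hb ρ x (typeProj_two_J ((Jab a b hb).sq x) _)]
  congr 1
  have hJ := isAdapted_eps a hb ρ x
  rw [typeProj_two, hJ.zero, hJ.two]
  simp only [extDeriv_one_form hd, fderiv_oneForm, fderiv_eps, psi1_eps a hb, phi2_eps a hb,
    curlOp_apply, W2bar, W1bar]
  simp only [dEps, eps, Fn.add_apply, Fn.neg_apply, Fn.smul_apply, LinearMap.smul_apply,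
    LinearMap.add_apply]
  simp
  ring_nf
  simp only [I_sq]
  ring

theorem dbar_oneForm_J (a : ℝ) {b : ℝ} (hb : b ≠ 0) (ρ : ℝ) (f g : Fn) (x u v : R4) :
    dbar (Jab a b hb) 0 (oneForm a b ρ f g) x ![(Jab a b hb).J x u, v] =
      -I * dbar (Jab a b hb) 0 (oneForm a b ρ f g) x ![u, v] :=
  typeProj_two_J ((Jab a b hb).sq x) _ u v

theorem fderiv_dbar_oneForm (a : ℝ) {b : ℝ} (hb : b ≠ 0) (ρ : ℝ) (f g : Fn) (x u v z : R4) :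
    fderiv ℝ (fun y => dbar (Jab a b hb) 0 (oneForm a b ρ f g) y ![u, v]) x z =
      (conj (psi1 a b ρ x u) * conj (phi2 a b x v) -
        conj (psi1 a b ρ x v) * conj (phi2 a b x u)) * fderiv ℝ (curlOp a b ρ (f, g)) x z +
      (I * b * (conj (phi1 v) * u 2 - conj (phi1 u) * v 2)) * z 1 * curlOp a b ρ (f, g) x := by
  rw [← fderiv_mul_affine]
  congr 2
  funext y
  rw [dbar_oneForm, psi1_apply, psi1_apply, psi1_apply, psi1_apply, phi2_sub a b x y u,
    phi2_sub a b x y v]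
  simp only [map_add, map_sub, map_mul, conj_I, conj_ofReal]
  ring

theorem phi1_eps (a b ρ : ℝ) (p : R4) (n : Fin 4) :
    phi1 (eps a b ρ p n) = ![1, I, (ρ : ℂ), I * ρ] n := by
  rw [phi1_apply]
  fin_cases n <;> simp [eps]

theorem hodgeStar_dbar_oneForm (a : ℝ) {b : ℝ} (hb : b ≠ 0) (ρ : ℝ) (f g : Fn) (y : R4)
    (h : 4 = 2 + 2) :
    hodgeStar ((hrho a b hb ρ).g y) 2 2 h (dbar (Jab a b hb) 0 (oneForm a b ρ f g) y) =
      orient b • dbar (Jab a b hb) 0 (oneForm a b ρ f g) y :=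
  hodgeStar_two_eq a hb ρ y h (dbar_oneForm_J a hb ρ f g y)

theorem del_hodgeStar_dbar (a : ℝ) {b : ℝ} (hb : b ≠ 0) (ρ : ℝ) (f g : Fn) (x : R4)
    (h : 4 = 2 + 2) :
    del (Jab a b hb) 0 (fun y => hodgeStar ((hrho a b hb ρ).g y) 2 2 h
        (dbar (Jab a b hb) 0 (oneForm a b ρ f g) y)) x =
      orient b • typeProj ((Jab a b hb).J x) 1
        (extDeriv (dbar (Jab a b hb) 0 (oneForm a b ρ f g)) x) := by
  simp only [hodgeStar_dbar_oneForm]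
  rw [← typeProj_smul, ← extDeriv_csmul _
    (contDiff_dbar _ 0 (contDiff_oneForm a b ρ f.contDiff g.contDiff))]
  rfl

theorem dbarStar_one_eq {𝒥 : AlmostComplex} (h : Hermitian 𝒥) (β : R4 → Alt 2) (x : R4)
    (v : Fin 1 → R4) :
    dbarStar h 1 2 rfl 2 β x v = -(hodgeStar (h.g x) 3 1 rfl
      (del 𝒥 0 (fun y => hodgeStar (h.g y) 2 2 rfl (β y)) x) v) := by
  have h1 : del 𝒥 (2 - 2) (fun y => hodgeStar (h.g y) (1 + 1) 2 rfl (β y)) x =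
      del 𝒥 0 (fun y => hodgeStar (h.g y) 2 2 rfl (β y)) x := rfl
  have h2 : hodgeStar (h.g x) (2 + 1) 1 rfl
      (del 𝒥 (2 - 2) (fun y => hodgeStar (h.g y) (1 + 1) 2 rfl (β y)) x) =
      hodgeStar (h.g x) 3 1 rfl (del 𝒥 0 (fun y => hodgeStar (h.g y) 2 2 rfl (β y)) x) := by
    rw [h1]
  exact congrArg (fun α : Alt 1 => -(α v)) h2

theorem dbarStar_zero_eq {𝒥 : AlmostComplex} (h : Hermitian 𝒥) (s : R4 → Alt 1) (x : R4)
    (v : Fin 0 → R4) :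
    dbarStar h 0 3 rfl 1 s x v = -(hodgeStar (h.g x) 4 0 rfl
      (del 𝒥 1 (fun y => hodgeStar (h.g y) 1 3 rfl (s y)) x) v) := by
  have h1 : del 𝒥 (2 - 1) (fun y => hodgeStar (h.g y) (0 + 1) 3 rfl (s y)) x =
      del 𝒥 1 (fun y => hodgeStar (h.g y) 1 3 rfl (s y)) x := rfl
  have h2 : hodgeStar (h.g x) (3 + 1) 0 rfl
      (del 𝒥 (2 - 1) (fun y => hodgeStar (h.g y) (0 + 1) 3 rfl (s y)) x) =
      hodgeStar (h.g x) 4 0 rfl (del 𝒥 1 (fun y => hodgeStar (h.g y) 1 3 rfl (s y)) x) := by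
    rw [h1]
  exact congrArg (fun α : Alt 0 => -(α v)) h2

/-- The two Hodge stars contribute the orientation sign twice, so it disappears by
`orient_mul_self`. What remains is the formal adjoint of the curl in its first component, up to the
factor 2 from the norms of the forms. -/
theorem dbarStar_dbar_zero (a : ℝ) {b : ℝ} (hb : b ≠ 0) (ρ : ℝ) (f g : Fn) (x : R4) :
    dbarStar (hrho a b hb ρ) 1 2 rfl 2 (dbar (Jab a b hb) 0 (oneForm a b ρ f g)) x
      ![eps a b ρ x 0] = ((2 : ℂ) • (W2 a b ρ (curlOp a b ρ (f, g)) -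
        (ρ * b / 4 : ℂ) • curlOp a b ρ (f, g))) x := by
  have hd : DifferentiableAt ℝ (dbar (Jab a b hb) 0 (oneForm a b ρ f g)) x :=
    (contDiff_dbar _ 0 (contDiff_oneForm a b ρ f.contDiff g.contDiff)).differentiable (by simp) x
  rw [dbarStar_one_eq, del_hodgeStar_dbar, hodgeStar_three_zero, ContinuousAlternatingMap.smul_apply, smul_eq_mul,
    typeProj_three_last (isAdapted_eps a hb ρ x), extDeriv_two_form hd, extDeriv_two_form hd]
  simp only [fderiv_dbar_oneForm, fderiv_eps, psi1_eps a hb, phi2_eps a hb, phi1_eps]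
  generalize curlOp a b ρ (f, g) = w
  simp only [W2, dEps, eps, Fn.sub_apply, Fn.smul_apply, LinearMap.smul_apply, LinearMap.sub_apply]
  simp
  have ho := orient_mul_self hb
  linear_combination ((2⁻¹ * (-(I * b * (I * ρ) * w x) + E2 a b ρ w x +
    (-(I * E3 b ρ w x) + I * b * I * ρ * w x) -
      I * (I * E2 a b ρ w x + (E3 b ρ w x + -(I * b * ρ * w x)))))) * ho +
    (1 / 2) * (b * ρ * w x - E2 a b ρ w x) * I_sq

theorem dbarStar_dbar_two (a : ℝ) {b : ℝ} (hb : b ≠ 0) (ρ : ℝ) (f g : Fn) (x : R4) :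
    dbarStar (hrho a b hb ρ) 1 2 rfl 2 (dbar (Jab a b hb) 0 (oneForm a b ρ f g)) x
      ![eps a b ρ x 2] = ((2 : ℂ) • (-W1 (curlOp a b ρ (f, g)) +
        (b / 4 : ℂ) • curlOp a b ρ (f, g))) x := by
  have hd : DifferentiableAt ℝ (dbar (Jab a b hb) 0 (oneForm a b ρ f g)) x :=
    (contDiff_dbar _ 0 (contDiff_oneForm a b ρ f.contDiff g.contDiff)).differentiable (by simp) x
  rw [dbarStar_one_eq, del_hodgeStar_dbar, hodgeStar_three_two, ContinuousAlternatingMap.smul_apply, smul_eq_mul,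
    typeProj_three_first (isAdapted_eps a hb ρ x), extDeriv_two_form hd, extDeriv_two_form hd]
  simp only [fderiv_dbar_oneForm, fderiv_eps, psi1_eps a hb, phi2_eps a hb, phi1_eps]
  generalize curlOp a b ρ (f, g) = w
  simp only [W1, dEps, eps, Fn.add_apply, Fn.neg_apply, Fn.smul_apply, LinearMap.smul_apply, LinearMap.sub_apply]
  simp
  have ho := orient_mul_self hb
  linear_combination (2⁻¹ * (-D 0 w x + I * D 1 w x -
    I * (-(I * D 0 w x) - (D 1 w x + -(I * b * w x))))) * ho +
    (1 / 2) * (D 0 w x - b * w x) * I_sq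

theorem det4_cons_removeNth (v : R4) (i : Fin 4) :
    det4 (Matrix.vecCons v (i.removeNth e)) = (-1) ^ i.val * (v i : ℂ) := by
  have h : (i.removeNth e : Fin 3 → R4) = ![e (i.succAbove 0), e (i.succAbove 1),
      e (i.succAbove 2)] := by
    ext l : 1; fin_cases l <;> rfl
  rw [det4_apply, h]
  fin_cases i <;>
    simp [Matrix.det_succ_row_zero, Fin.sum_univ_succ, Fin.succAbove, e]

theorem hodgeStar_oneForm (a : ℝ) {b : ℝ} (hb : b ≠ 0) (ρ : ℝ) (f g : Fn) (y : R4)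
    (h : 4 = 3 + 1) (i : Fin 4) :
    hodgeStar ((hrho a b hb ρ).g y) 1 3 h (oneForm a b ρ f g y) (i.removeNth e) =
      (-1) ^ i.val * (((|b| : ℝ) : ℂ) * ![f y + ρ * g y, -I * (f y + ρ * g y), g y,
        g y * (y 1 - a / b + I / b)] i) := by
  rw [hodgeStar_one, Fin.sum_univ_four]
  simp only [det4_cons_removeNth, oneForm_apply, psi1_eps a hb, phi2_eps a hb]
  fin_cases i <;> simp [eps]
  · exact Or.inl (by ring)
  · exact Or.inl (by ring)
  · ring

/-- The star of the form is the volume form contracted with the complex vector field `f (ε₀ - i ε₁)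
+ g (ε₂ - i ε₃)`, so its exterior derivative is the divergence of that field. The frame fields are
divergence free, and only derivatives of `f` and `g` survive. -/
theorem extDeriv_hodgeStar_oneForm (a : ℝ) {b : ℝ} (hb : b ≠ 0) (ρ : ℝ) (f g : Fn) (x : R4)
    (h : 4 = 3 + 1) :
    extDeriv (fun y => hodgeStar ((hrho a b hb ρ).g y) 1 3 h (oneForm a b ρ f g y)) x e =
      ((|b| : ℝ) : ℂ) * (2 * divOp a b ρ (f, g) x) := by
  have hd : DifferentiableAt ℝ
      (fun y => hodgeStar ((hrho a b hb ρ).g y) 1 3 h (oneForm a b ρ f g y)) x :=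
    (contDiff_hodgeStar (hrho a b hb ρ) 1 3 h
      (contDiff_oneForm a b ρ f.contDiff g.contDiff)).differentiable (by simp) x
  rw [extDeriv_three_form hd]
  simp only [hodgeStar_oneForm]
  have key : ∀ (F : Fn) (A B : ℂ) (c : ℂ) (v : R4),
      fderiv ℝ (fun y => c * (((|b| : ℝ) : ℂ) * (F y * (A + B * ((y 1 - x 1 : ℝ) : ℂ))))) x v =
      c * (((|b| : ℝ) : ℂ) * (A * fderiv ℝ F x v + B * (v 1 : ℂ) * F x)) := by
    intro F A B c v
    rw [← fderiv_mul_affine, fderiv_const_mul, fderiv_const_mul]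
    · rfl
    · exact (hasFDerivAt_mul_affine F A B x).differentiableAt
    · exact (hasFDerivAt_mul_affine F A B x).differentiableAt.const_mul _
  have k0 := key (f + (ρ : ℂ) • g) 1 0 1 (e 0)
  have k1 := key (f + (ρ : ℂ) • g) (-I) 0 (-1) (e 1)
  have k2 := key g 1 0 1 (e 2)
  have k3 := key g (x 1 - a / b + I / b) 1 (-1) (e 3)
  rw [Fin.sum_univ_four]
  simp
  have j0 : (fun y : R4 => ((|b| : ℝ) : ℂ) * (f y + ρ * g y)) =
      fun y => 1 * (((|b| : ℝ) : ℂ) * ((f + (ρ : ℂ) • g) y * (1 + 0 * ((y 1 - x 1 : ℝ) : ℂ)))) := by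
    funext y
    rw [Fn.add_apply, Fn.smul_apply]
    ring
  have j1 : (fun y : R4 => ((|b| : ℝ) : ℂ) * (I * (f y + ρ * g y))) =
      fun y => -1 * (((|b| : ℝ) : ℂ) *
        ((f + (ρ : ℂ) • g) y * (-I + 0 * ((y 1 - x 1 : ℝ) : ℂ)))) := by
    funext y
    rw [Fn.add_apply, Fn.smul_apply]
    ring
  have j2 : (fun y : R4 => ((|b| : ℝ) : ℂ) * g y) =
      fun y => 1 * (((|b| : ℝ) : ℂ) * (g y * (1 + 0 * ((y 1 - x 1 : ℝ) : ℂ)))) := by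
    funext y
    ring
  have j3 : (fun y : R4 => (-1) ^ 3 * (((|b| : ℝ) : ℂ) * (g y * (y 1 - a / b + I / b)))) =
      fun y => -1 * (((|b| : ℝ) : ℂ) *
        (g y * ((x 1 - a / b + I / b) + 1 * ((y 1 - x 1 : ℝ) : ℂ)))) := by
    funext y
    push_cast
    ring
  rw [j0, j1, j2, j3, k0, k1, k2, k3]
  have d0 : ∀ F : Fn, fderiv ℝ F x (e 0) = D 0 F x := fun F => by simp [D_apply, frame_e]
  have d1 : ∀ F : Fn, fderiv ℝ F x (e 1) = D 1 F x := fun F => by simp [D_apply, frame_e]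
  -- The term `-x D 3` cancels against the coefficient `x` of `∂_z` in `ε₂`.
  have d2 : ∀ F : Fn, fderiv ℝ F x (e 2) = D 2 F x - x 1 * D 3 F x := fun F => by
    simp [D_apply, frame_e]
  have d3 : ∀ F : Fn, fderiv ℝ F x (e 3) = D 3 F x := fun F => by simp [D_apply, frame_e]
  have e31 : (e 3 1 : ℝ) = 0 := by simp [e]
  rw [d0, d1, d2, d3, e31, divOp_apply, W1_apply, W2_apply, map_add, map_add, map_smul, map_smul]
  simp only [Fn.add_apply, Fn.sub_apply, Fn.smul_apply]
  push_cast
  ring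

theorem dbarStar_oneForm (a : ℝ) {b : ℝ} (hb : b ≠ 0) (ρ : ℝ) (f g : Fn) (x : R4)
    (v : Fin 0 → R4) :
    dbarStar (hrho a b hb ρ) 0 3 rfl 1 (oneForm a b ρ f g) x v =
      ((-2 : ℂ) • divOp a b ρ (f, g)) x := by
  rw [dbarStar_zero_eq, hodgeStar_four]
  change -(orient b * typeProj ((Jab a b hb).J x) 2 (extDeriv (fun y =>
    hodgeStar ((hrho a b hb ρ).g y) 1 3 rfl (oneForm a b ρ f g y)) x) (eps a b ρ x)) = _
  rw [typeProj_four (isAdapted_eps a hb ρ x), alt_four_eq_det, extDeriv_hodgeStar_oneForm, det_eps,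
    Fn.smul_apply]
  have ho := orient_mul_self hb
  rw [orient] at ho ⊢
  push_cast at ho ⊢
  linear_combination (-2 * divOp a b ρ (f, g) x) * ho

end KT

end

open scoped ContDiff

noncomputable section

namespace KT

open Complex ComplexConjugate

/-! ### Harmonic forms and the first order system -/

theorem dbar_dbarStar_oneForm (a : ℝ) {b : ℝ} (hb : b ≠ 0) (ρ : ℝ) (f g : Fn) (x : R4) (v : R4) :
    dbar (Jab a b hb) 0 (dbarStar (hrho a b hb ρ) 0 3 rfl 1 (oneForm a b ρ f g)) x ![v] =
      (1 / 2) * (fderiv ℝ ((-2 : ℂ) • divOp a b ρ (f, g) : Fn) x v +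
        I * fderiv ℝ ((-2 : ℂ) • divOp a b ρ (f, g) : Fn) x ((Jab a b hb).J x v)) := by
  have hd : DifferentiableAt ℝ (dbarStar (hrho a b hb ρ) 0 3 rfl 1 (oneForm a b ρ f g)) x :=
    (contDiff_dbarStar (hrho a b hb ρ) 0 3 rfl 1
      (contDiff_oneForm a b ρ f.contDiff g.contDiff)).differentiable (by simp) x
  have h1 : (fun y => dbarStar (hrho a b hb ρ) 0 3 rfl 1 (oneForm a b ρ f g) y ![]) =
      ((-2 : ℂ) • divOp a b ρ (f, g) : Fn) :=
    funext fun y => dbarStar_oneForm a hb ρ f g y ![]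
  rw [dbar, typeProj_one, extDeriv_zero_form hd, extDeriv_zero_form hd, h1]

theorem laplacian_eps_zero (a : ℝ) {b : ℝ} (hb : b ≠ 0) (ρ : ℝ) (f g : Fn) (x : R4) :
    laplacian (hrho a b hb ρ) (oneForm a b ρ f g) x ![eps a b ρ x 0] =
      (W1bar ((-2 : ℂ) • divOp a b ρ (f, g)) + (2 : ℂ) • (W2 a b ρ (curlOp a b ρ (f, g)) -
        (ρ * b / 4 : ℂ) • curlOp a b ρ (f, g))) x := by
  rw [laplacian, ContinuousAlternatingMap.add_apply, dbarStar_dbar_zero, dbar_dbarStar_oneForm,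
    (isAdapted_eps a hb ρ x).zero, fderiv_eps, fderiv_eps, Fn.add_apply]
  rfl

theorem laplacian_eps_two (a : ℝ) {b : ℝ} (hb : b ≠ 0) (ρ : ℝ) (f g : Fn) (x : R4) :
    laplacian (hrho a b hb ρ) (oneForm a b ρ f g) x ![eps a b ρ x 2] =
      (W2bar a b ρ ((-2 : ℂ) • divOp a b ρ (f, g)) + (2 : ℂ) • (-W1 (curlOp a b ρ (f, g)) +
        (b / 4 : ℂ) • curlOp a b ρ (f, g))) x := by
  rw [laplacian, ContinuousAlternatingMap.add_apply, dbarStar_dbar_two, dbar_dbarStar_oneForm,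
    (isAdapted_eps a hb ρ x).two, fderiv_eps, fderiv_eps, Fn.add_apply]
  rfl

/-- The values of the Laplacian on `ε 0` and `ε 2` are the two second order equations of
`div_curl_eq_zero`. Conversely a solution of the first order system has `∂̄ s = 0` and `∂̄* s = 0`.
-/
theorem laplacian_oneForm_eq_zero_iff (a : ℝ) {b : ℝ} (hb : b ≠ 0) (ρ : ℝ) (f g : Fn) :
    laplacian (hrho a b hb ρ) (oneForm a b ρ f g) = 0 ↔ (f, g) ∈ solSpace a b ρ := by
  constructor
  · intro h
    refine mem_solSpace.2 (div_curl_eq_zero rfl rfl (Fn.ext fun x => ?_) (Fn.ext fun x => ?_))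
    · rw [← laplacian_eps_zero a hb, h]
      rfl
    · rw [← laplacian_eps_two a hb, h]
      rfl
  · intro h
    obtain ⟨hdiv, hcurl⟩ := mem_solSpace.1 h
    have hs := contDiff_oneForm a b ρ f.contDiff g.contDiff
    have h1 : dbarStar (hrho a b hb ρ) 0 3 rfl 1 (oneForm a b ρ f g) = 0 := by
      funext x
      ext v
      rw [dbarStar_oneForm, hdiv, smul_zero]
      rfl
    have h2 : dbar (Jab a b hb) 0 (oneForm a b ρ f g) = 0 := by
      funext x
      ext v
      have hv : v = ![v 0, v 1] := by
        ext l : 1; fin_cases l <;> rfl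
      rw [hv, dbar_oneForm, hcurl]
      exact zero_mul _
    have z : ∀ {k : ℕ} (F : R4 → Alt k), (0 : ℂ) • F = 0 := fun F =>
      funext fun x => zero_smul ℂ (F x)
    have e3 := dbar_smul (Jab a b hb) 0 0 (contDiff_dbarStar (hrho a b hb ρ) 0 3 rfl 1 hs)
    have e4 := dbarStar_smul (hrho a b hb ρ) 1 2 rfl 2 0 (contDiff_dbar (Jab a b hb) 0 hs)
    rw [z, z] at e3 e4
    funext x
    simp only [laplacian]
    rw [h1, h2, e3, e4]
    exact add_zero 0

/-- The solutions of the first order system are the coefficients of the harmonic forms. -/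
def harmonicMap (a : ℝ) {b : ℝ} (hb : b ≠ 0) (ρ : ℝ) :
    solSpace a b ρ →ₗ[ℂ] harmonic (hrho a b hb ρ) where
  toFun s := ⟨oneForm a b ρ s.1.1 s.1.2, oneForm_mem_formSpace a b ρ _ _,
    fun x => (typeProj_one_eq_self_iff _ _).2 (oneForm_J a hb ρ _ _ x),
    (laplacian_oneForm_eq_zero_iff a hb ρ _ _).2 s.2⟩
  map_add' s t := by
    refine Subtype.ext (funext fun x => ?_)
    ext v
    have hv : v = ![v 0] := by
      ext l : 1; fin_cases l; rfl
    change oneForm a b ρ (s.1.1 + t.1.1 : Fn) (s.1.2 + t.1.2 : Fn) x v =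
      oneForm a b ρ s.1.1 s.1.2 x v + oneForm a b ρ t.1.1 t.1.2 x v
    rw [hv]
    simp only [oneForm_apply, Fn.add_apply]
    ring
  map_smul' c s := by
    refine Subtype.ext (funext fun x => ?_)
    ext v
    have hv : v = ![v 0] := by
      ext l : 1; fin_cases l; rfl
    change oneForm a b ρ (c • s.1.1 : Fn) (c • s.1.2 : Fn) x v = c * oneForm a b ρ s.1.1 s.1.2 x v
    rw [hv]
    simp only [oneForm_apply, Fn.smul_apply]
    ring

theorem harmonicMap_bijective (a : ℝ) {b : ℝ} (hb : b ≠ 0) (ρ : ℝ) :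
    Function.Bijective (harmonicMap a hb ρ) := by
  constructor
  · intro s t hst
    have h : ∀ x v, oneForm a b ρ s.1.1 s.1.2 x ![v] = oneForm a b ρ t.1.1 t.1.2 x ![v] :=
      fun x v => congrArg (fun r => r.1 x ![v]) hst
    refine Subtype.ext (Prod.ext (Fn.ext fun x => ?_) (Fn.ext fun x => ?_))
    · simpa [oneForm_apply, psi1_eps a hb, phi2_eps a hb] using h x (eps a b ρ x 0)
    · simpa [oneForm_apply, psi1_eps a hb, phi2_eps a hb] using h x (eps a b ρ x 2)
  · rintro ⟨s, hs, ht, hl⟩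
    have he := eq_oneForm a hb ρ hs ht
    refine ⟨⟨(evalEps a b ρ 0 s hs, evalEps a b ρ 2 s hs), ?_⟩, Subtype.ext he.symm⟩
    rw [← laplacian_oneForm_eq_zero_iff a hb, ← he]
    exact hl

theorem h01_hrho (a : ℝ) {r β : ℚ} (hβ : β ≠ 0) (hint : ∀ k : ℤ, β ≠ k) {b ρ : ℝ} (hb : b ≠ 0)
    (hbβ : b = 4 * Real.pi * β) (hρ : ρ = r * Real.pi) [Finite (freq β ρ)] :
    FiniteDimensional ℂ (harmonic (hrho a b hb ρ)) ∧
      h01 (hrho a b hb ρ) = Nat.card (freq β ρ) := by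
  have := Fintype.ofFinite (freq β ρ)
  let E : harmonic (hrho a b hb ρ) ≃ₗ[ℂ] (freq β ρ → ℂ) :=
    (LinearEquiv.ofBijective _ (harmonicMap_bijective a hb ρ)).symm.trans
      (LinearEquiv.ofBijective _ (coeffMap_bijective (a := a) hβ hint hbβ hρ))
  refine ⟨Module.Finite.equiv E.symm, ?_⟩
  rw [h01, E.finrank_eq, Module.finrank_fintype_fun_eq_card, Nat.card_eq_fintype_card]

theorem bK_eq (N : ℕ) : bK (2 * N + 1) = 4 * Real.pi * (betaOf N : ℚ) := by
  rw [bK, betaOf]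
  have : (2 * N + 1 - 1) / 2 = N := by omega
  rw [this]
  push_cast
  ring

theorem h01_zero (N : ℕ) (a : ℝ) :
    FiniteDimensional ℂ (harmonic (hrho a (bK (2 * N + 1)) (bK_ne_zero _) 0)) ∧
      h01 (hrho a (bK (2 * N + 1)) (bK_ne_zero _) 0) = 2 * N + 1 := by
  obtain ⟨E⟩ := GaussianCount.card_circle N
  have E' := (freqZeroEquiv N).trans E
  have : Finite (freq (betaOf N : ℚ) 0) := Finite.of_equiv _ E'.symm
  have h := h01_hrho a (r := 0) (betaOf_ne_zero N) (betaOf_ne_int N) (bK_ne_zero _) (bK_eq N)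
    (by simp : (0 : ℝ) = (0 : ℚ) * Real.pi)
  rw [Nat.card_congr E', Nat.card_fin] at h
  exact h

theorem h01_pi (N : ℕ) (a : ℝ) {r : ℚ} (hr : r ≠ 0) :
    FiniteDimensional ℂ (harmonic (hrho a (bK (2 * N + 1)) (bK_ne_zero _) (r * Real.pi))) ∧
      h01 (hrho a (bK (2 * N + 1)) (bK_ne_zero _) (r * Real.pi)) = 1 := by
  have hs : ∀ q q' : freq (betaOf N : ℚ) (r * Real.pi), q = q' := fun q q' =>
    Subtype.ext ((freq_eq_zero hr q).trans (freq_eq_zero hr q').symm)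
  have : Subsingleton (freq (betaOf N : ℚ) (r * Real.pi)) := ⟨hs⟩
  have : Nonempty (freq (betaOf N : ℚ) (r * Real.pi)) := ⟨⟨(0, 0, 0), by simp⟩⟩
  have h := h01_hrho a (r := r) (betaOf_ne_zero N) (betaOf_ne_int N) (bK_ne_zero _) (bK_eq N) rfl
  rw [Nat.card_eq_one_iff_unique.2 ⟨inferInstance, inferInstance⟩] at h
  exact h

end KT

end

theorem theorem5p1 :
    (∀ (K : ℕ) (a r : ℚ), Odd K → r ≠ 0 →
      FiniteDimensional ℂ (KT.harmonic (KT.hrho a (KT.bK K) (KT.bK_ne_zero K) 0)) ∧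
      KT.h01 (KT.hrho a (KT.bK K) (KT.bK_ne_zero K) 0) = K ∧
      FiniteDimensional ℂ (KT.harmonic (KT.hrho a (KT.bK K) (KT.bK_ne_zero K) (r * Real.pi))) ∧
      KT.h01 (KT.hrho a (KT.bK K) (KT.bK_ne_zero K) (r * Real.pi)) = 1) ∧
    ∃ (𝒥 : KT.AlmostComplex) (h h' : KT.Hermitian 𝒥),
      FiniteDimensional ℂ (KT.harmonic h) ∧ FiniteDimensional ℂ (KT.harmonic h') ∧
      KT.h01 h ≠ KT.h01 h' := by
  have main : ∀ (K : ℕ) (a r : ℚ), Odd K → r ≠ 0 →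
      FiniteDimensional ℂ (KT.harmonic (KT.hrho a (KT.bK K) (KT.bK_ne_zero K) 0)) ∧
      KT.h01 (KT.hrho a (KT.bK K) (KT.bK_ne_zero K) 0) = K ∧
      FiniteDimensional ℂ (KT.harmonic (KT.hrho a (KT.bK K) (KT.bK_ne_zero K) (r * Real.pi))) ∧
      KT.h01 (KT.hrho a (KT.bK K) (KT.bK_ne_zero K) (r * Real.pi)) = 1 := by
    rintro K a r ⟨N, rfl⟩ hr
    exact ⟨(KT.h01_zero N a).1, (KT.h01_zero N a).2, (KT.h01_pi N a hr).1, (KT.h01_pi N a hr).2⟩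
  refine ⟨main, ?_⟩
  -- With `K = 3` the two Hodge numbers are 3 and 1.
  obtain ⟨h1, h2, h3, h4⟩ := main 3 0 1 (by decide) one_ne_zero
  exact ⟨_, _, _, h1, h3, by rw [h2, h4]; decide⟩
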